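/- **Theorem 4 (Barely supercritical regime).** Fix $\tau\in(2,3)$ and put $\alpha=1/(\tau-1)$. For each $n$ let $\boldsymbol d_n=(d_1,\dots,d_n)$ be a sequence of non-negative integers with $d_1\ge d_2\ge\dots\ge d_n$ (the $d_i$ may depend on $n$) whose sum $\ell_n=\sum_{i\in[n]}d_i$ is even. The configuration model $\mathrm{CM}_n(\boldsymbol d)$ is the random multigraph on $[n]$ obtained by attaching $d_i$ half-edges to vertex $i$ and choosing a uniformly random perfect matching of the $\ell_n$ half-edges. For $p_n\in(0,1]$, let $\mathrm{CM}_n(\boldsymbol d,p_n)$ be the multigraph obtained from it by retaining each edge independently with probability $p_n$. Let $\nu_n=\sum_{i\in[n]}d_i(d_i-1)/\ell_n$ and, for a fixed $\lambda>0$, let $p_c(\lambda)=\frac{\lambda}{\nu_n}(1+o(1))$. Let $D_n$ be the degree $d_V$ of a uniformly chosen $V\in[n]$, and $D_n^\star$ the degree $d_{V^\star}$ of a vertex $V^\star$ with $\mathbb P(V^\star=i)=d_i/\ell_n$. Suppose that $p_c(\lambda)\ll p_n\ll 1$ as $n\to\infty$ (where $a_n\ll b_n$ means $a_n/b_n\to0$),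 and that 1. $d_1=O(n^{\alpha})$; 2. $(D_n)_{n\ge1}$ is uniformly integrable and $\frac1n\sum_{i\in[n]}d_i\to\mu$ for some $\mu>0$; 3. there is a constant $\kappa>0$ such that, for every fixed $t>0$, as $n\to\infty$, $$1-\mathbb E\big[e^{-t p_n^{1/(3-\tau)}D_n^\star}\big]=\kappa\,p_n^{(\tau-2)/(3-\tau)}\big(t^{\tau-2}+o(1)\big).$$ Let $\mathscr C_{(i)}(p_n)$ be the $i$-th largest connected component of $\mathrm{CM}_n(\boldsymbol d,p_n)$, where $|\mathscr C|$ is the number of vertices of $\mathscr C$ (an isolated vertex without a loop counts as a component of size $0$), $\mathrm E(\mathscr C)$ is its number of edges (with multiplicity, loops included), and components of equal size are ordered by decreasing number of edges; $|\mathscr C_{(i)}|=\mathrm E(\mathscr C_{(i)})=0$ if there are fewer than $i$ components. Then, as $n\to\infty$, $$\frac{|\mathscr C_{(1)}(p_n)|}{n p_n^{1/(3-\tau)}}\xrightarrow{\ \mathbb P\ }\mu\kappa^{1/(3-\tau)},\qquad \frac{\mathrm E(\mathscr C_{(1)}(p_n))}{n p_n^{1/(3-\tau)}}\xrightarrow{\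 \mathbb P\ }\mu\kappa^{1/(3-\tau)},$$ and, for every fixed $i\ge2$, $$\frac{|\mathscr C_{(i)}(p_n)|}{n p_n^{1/(3-\tau)}}\xrightarrow{\ \mathbb P\ }0,\qquad \frac{\mathrm E(\mathscr C_{(i)}(p_n))}{n p_n^{1/(3-\tau)}}\xrightarrow{\ \mathbb P\ }0.$$ -/

import Mathlib

open MeasureTheory ProbabilityTheory Filter Topology

noncomputable section

namespace ConfigModel

/-! ### The configuration model and percolation on it -/

/-- The half-edges of a degree sequence `d` on the vertex set `Fin n`: vertex `i` carries `d i`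
half-edges. -/
abbrev HalfEdge {n : ℕ} (d : Fin n → ℕ) : Type := Σ i : Fin n, Fin (d i)

/-- A perfect matching of the set `H`: the map sends each element to its partner. -/
def Pairing (H : Type) : Type :=
  {f : H → H // Function.Involutive f ∧ ∀ h, f h ≠ h}

instance (H : Type) : MeasurableSpace (Pairing H) := ⊤

/-- The edges of a perfect matching, as unordered pairs of half-edges. -/
def Pairing.edges {H : Type} (f : Pairing H) : Set (Sym2 H) :=
  Set.range fun h => s(h, f.1 h)

/-- The law of the percolated configuration model `CM_n(d, p)`: the half-edges are matched
uniformly at random, and then every edge is retained independently with probability `p`. An outcome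
is the set of retained edges, each given by its two half-edges; loops and multiple edges are
allowed. -/
def percolatedLaw {n : ℕ} (d : Fin n → ℕ) (p : unitInterval) :
    Measure (Set (Sym2 (HalfEdge d))) :=
  (uniformOn (Set.univ : Set (Pairing (HalfEdge d)))).bind fun f => setBernoulli f.edges p

/-! ### Components of a multigraph given by pairs of half-edges -/

/-- The simple graph underlying the multigraph with edge set `R` (loops and multiplicities do not
matter for connectivity). -/
def skeleton {n : ℕ} {d : Fin n → ℕ} (R : Set (Sym2 (HalfEdge d))) : SimpleGraph (Fin n) :=
  SimpleGraph.fromEdgeSet (Sym2.map Sigma.fst '' R)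

/-- The connected components of the multigraph with edge set `R`. -/
abbrev Component {n : ℕ} {d : Fin n → ℕ} (R : Set (Sym2 (HalfEdge d))) : Type :=
  (skeleton R).ConnectedComponent

/-- The number of edges in a component, counted with multiplicity and including loops. -/
def edgeCount {n : ℕ} {d : Fin n → ℕ} (R : Set (Sym2 (HalfEdge d))) (C : Component R) : ℕ :=
  {e ∈ R | ∀ h ∈ e, h.1 ∈ C.supp}.ncard

open Classical in
/-- The size of a component is its number of vertices, except that an isolated vertex (one without
any edge, not even a loop) has component size zero by convention. -/
def size {n : ℕ} {d : Fin n → ℕ} (R : Set (Sym2 (HalfEdge d))) (C : Component R) : ℕ :=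
  if edgeCount R C = 0 then 0 else C.supp.ncard

open Classical in
/-- The pairs (size, number of edges) of all the components, in decreasing order of size, where
components of the same size are listed in decreasing order of their number of edges. -/
def profile {n : ℕ} {d : Fin n → ℕ} (R : Set (Sym2 (HalfEdge d))) : List (ℕ ×ₗ ℕ) :=
  (((Finset.univ : Finset (Component R)).val.map
    fun C => toLex (size R C, edgeCount R C))).sort (· ≥ ·)

/-- The size of the `i`-th largest component, `i = 1, 2, …`, and zero if there are fewer than `i`
components. -/
def rankedSize {n : ℕ} {d : Fin n → ℕ} (i : ℕ) (R : Set (Sym2 (HalfEdge d))) : ℕ :=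
  (ofLex ((profile R).getD (i - 1) (toLex (0, 0)))).1

/-- The number of edges of the `i`-th largest component, `i = 1, 2, …`, and zero if there are fewer
than `i` components. -/
def rankedEdges {n : ℕ} {d : Fin n → ℕ} (i : ℕ) (R : Set (Sym2 (HalfEdge d))) : ℕ :=
  (ofLex ((profile R).getD (i - 1) (toLex (0, 0)))).2

/-! ### Degree sequences -/

/-- The total degree `ℓ_n`. -/
def totalDegree {n : ℕ} (d : Fin n → ℕ) : ℕ := ∑ i, d i

/-- A perfect matching of the half-edges exists when the total degree is even. -/
theorem pairing_nonempty {n : ℕ} (d : Fin n → ℕ) (h : Even (totalDegree d)) :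
    Nonempty (Pairing (HalfEdge d)) := by
  obtain ⟨k, hk⟩ := h
  have hc : Fintype.card (HalfEdge d) = Fintype.card (Fin k × Bool) := by
    simp [totalDegree] at hk ⊢; omega
  let e := Fintype.equivOfCardEq hc
  refine ⟨⟨fun x => e.symm ((e x).1, !(e x).2), fun x => by simp, fun x hx => ?_⟩⟩
  have := congrArg (fun y => (e y).2) hx
  simp at this

/-- The law of the percolated configuration model is a probability measure when the total degree is
even. -/
theorem isProbabilityMeasure_percolatedLaw {n : ℕ} (d : Fin n → ℕ) (h : Even (totalDegree d))
    (p : unitInterval) : IsProbabilityMeasure (percolatedLaw d p) := by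
  have := pairing_nonempty d h
  have : Finite (Pairing (HalfEdge d)) := Subtype.finite
  unfold percolatedLaw
  exact isProbabilityMeasure_bind measurable_from_top.aemeasurable
    (Eventually.of_forall fun f => inferInstance)

/-- The criticality parameter `ν_n = ∑ d_i (d_i - 1) / ∑ d_i`. -/
def criticality {n : ℕ} (d : Fin n → ℕ) : ℝ :=
  (∑ i, (d i : ℝ) * ((d i : ℝ) - 1)) / ∑ i, (d i : ℝ)

/-- `E[D_n]` for the degree `D_n` of a uniformly chosen vertex. -/
def meanDegree {n : ℕ} (d : Fin n → ℕ) : ℝ := (∑ i, (d i : ℝ)) / n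

/-- `E[D_n 1{D_n > K}]` for the degree `D_n` of a uniformly chosen vertex. -/
def meanDegreeAbove {n : ℕ} (d : Fin n → ℕ) (K : ℝ) : ℝ :=
  (∑ i with K < (d i : ℝ), (d i : ℝ)) / n

/-- The Laplace transform `E[exp(-s D_n^*)]` of the degree `D_n^*` of a size-biased vertex, that is,
of a vertex equal to `i` with probability `d_i / ℓ_n`. -/
def sizeBiasedLaplace {n : ℕ} (d : Fin n → ℕ) (s : ℝ) : ℝ :=
  ∑ i, (d i : ℝ) / (totalDegree d : ℝ) * Real.exp (-(s * (d i : ℝ)))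

/-- The conditions on the degree sequences `d n = (d_1 ≥ … ≥ d_n)` in the barely supercritical
regime. -/
structure SupercriticalDegrees (τ μ κ : ℝ) (d : ∀ n : ℕ, Fin n → ℕ) (p : ℕ → unitInterval) :
    Prop where
  /-- the degrees are listed in non-increasing order -/
  antitone : ∀ n, Antitone (d n)
  /-- the total degree is even -/
  even : ∀ n, Even (totalDegree (d n))
  /-- `d_1 = O(n^α)` with `α = 1 / (τ - 1)` -/
  maxDegree : ∃ C : ℝ, ∀ n : ℕ, ∀ hn : 0 < n, (d n ⟨0, hn⟩ : ℝ) ≤ C * (n : ℝ) ^ (1 / (τ - 1))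
  /-- the sequence `D_n` is uniformly integrable -/
  unifIntegrable : ∀ ε : ℝ, 0 < ε → ∃ K : ℝ, ∀ n, meanDegreeAbove (d n) K ≤ ε
  mu_pos : 0 < μ
  /-- `E[D_n] → μ` -/
  mean : Tendsto (fun n => meanDegree (d n)) atTop (𝓝 μ)
  kappa_pos : 0 < κ
  /-- `1 - E[exp(-t p_n^{1/(3-τ)} D_n^*)] = κ p_n^{(τ-2)/(3-τ)} (t^{τ-2} + o(1))` for all `t > 0` -/
  laplace : ∀ t : ℝ, 0 < t →
    Tendsto (fun n => (1 - sizeBiasedLaplace (d n) (t * (p n : ℝ) ^ (1 / (3 - τ)))) /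
      (κ * (p n : ℝ) ^ ((τ - 2) / (3 - τ)))) atTop (𝓝 (t ^ (τ - 2)))

/-! ### Convergence in probability along a sequence of probability spaces -/

/-- `X n` converges in probability to the constant `c`, where `X n` lives on the `n`-th of a
sequence of probability spaces. -/
def TendstoInProb {Ω : ℕ → Type} [∀ n, MeasurableSpace (Ω n)] (P : ∀ n, Measure (Ω n))
    (X : ∀ n, Ω n → ℝ) (c : ℝ) : Prop :=
  ∀ ε : ℝ, 0 < ε → Tendsto (fun n => P n {ω | ε ≤ |X n ω - c|}) atTop (𝓝 0)

end ConfigModel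

end

set_option linter.unusedSectionVars false


/-! Write `N` for the total degree, `s = p^{1/(3-τ)}` and `σ = p^{(τ-2)/(3-τ)}`, so that `s = σ p`,
and put `L = N σ`, `M = N s = L p`. The percolated multigraph is explored with i.i.d. samples, each
a uniform half-edge and a `p`-coin: the sample is the partner of the half-edge under exploration,
unless it is already used, in which case it is discarded. Since the partner is uniform over the free
half-edges, this rejection scheme leaves the law of the percolated model unchanged
(`iidE_condP_run`).

After `t L` samples about `t M` coins have shown retention. The vertices of these retained samples
have total degree about `∑ d_v (1 - exp(-t s d_v))`, which the Laplace hypothesis evaluates as `κ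
t^{τ-2} L` (`tendsto_meanCovered`), while about `t L` half-edges have been explored. So roughly `(κ
t^{τ-2} - t) L` half-edges are active. This is positive exactly for `0 < t < m`, where `m =
κ^{1/(3-τ)}`, because `τ - 2 < 1`. Hence the exploration stays active, inside one component, from a
small multiple of `L` up to nearly `m L`, and it is over soon after `m L`. That component has about
`m M` edges, and almost as many vertices because few samples collide (`exists_component_of_window`).
Since `N ~ μ n`, this is `μ κ^{1/(3-τ)} n s`.

The exploration starts from random seeds, each half-edge being a seed with probability `δ σ`. There
are enough of them not to run out before the active window, but their retained edges find too little
volume to delay the end. Every component they touch other than the giant has only edges found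
outside the window. Two large components that exist in the graph are both touched except with
probability at most `2 exp(-δ σ e M)`, the seeds being independent of the graph, so a second large
component is excluded (`percolatedLaw_not_hasGiant_le`).

Errors are second-moment or Markov bounds for functions of the samples and seeds, apart from the
retained seeds, which are controlled through the law of the model. Uniform integrability makes
collisions negligible. The bound `d_1 = O(n^α)` enters through `eventually_exists_lt`: if `s d_1`
stayed bounded, the Laplace functional would be at most linear in `t`, contradicting `t^{τ-2}`.
Hence `n^α s → ∞`, which yields both `N s σ → ∞`, for the seeds, and `n^α / L → 0`, for the
concentration of the covered volume. -/

noncomputable section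

namespace ConfigModel

/-! ### Finite products of a weighted finite alphabet -/

section IID

variable {ι α : Type*} [Fintype ι] [DecidableEq ι] [Fintype α]

/-- A probability vector on a finite alphabet. -/
structure IsWeight (w : α → ℝ) : Prop where
  nonneg : ∀ a, 0 ≤ w a
  sum_one : ∑ a, w a = 1

/-- The expectation of `F` when the letters are independent with law `w`. -/
def iidE (w : α → ℝ) (F : (ι → α) → ℝ) : ℝ := ∑ ω, (∏ i, w (ω i)) * F ω

variable {w : α → ℝ}

theorem iidE_add (F G : (ι → α) → ℝ) : iidE w (fun ω => F ω + G ω) = iidE w F + iidE w G := by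
  simp [iidE, mul_add, Finset.sum_add_distrib]

theorem iidE_const_mul (c : ℝ) (F : (ι → α) → ℝ) : iidE w (fun ω => c * F ω) = c * iidE w F := by
  simp only [iidE, Finset.mul_sum]
  exact Finset.sum_congr rfl fun ω _ => by ring

theorem iidE_sum {κ : Type*} (s : Finset κ) (F : κ → (ι → α) → ℝ) :
    iidE w (fun ω => ∑ k ∈ s, F k ω) = ∑ k ∈ s, iidE w (F k) := by
  simp only [iidE, Finset.mul_sum]
  exact Finset.sum_comm

theorem iidE_mono (hw : IsWeight w) {F G : (ι → α) → ℝ} (h : ∀ ω, F ω ≤ G ω) :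
    iidE w F ≤ iidE w G :=
  Finset.sum_le_sum fun ω _ =>
    mul_le_mul_of_nonneg_left (h ω) (Finset.prod_nonneg fun _ _ => hw.nonneg _)

theorem iidE_prod (f : ι → α → ℝ) :
    iidE w (fun ω => ∏ i, f i (ω i)) = ∏ i, ∑ a, w a * f i a := by
  classical
  rw [Finset.prod_univ_sum]
  simp [iidE, Finset.prod_mul_distrib]

theorem iidE_prod_subset (hw : IsWeight w) (J : Finset ι) (f : α → ℝ) :
    iidE w (fun ω => ∏ i ∈ J, f (ω i)) = (∑ a, w a * f a) ^ J.card := by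
  have h : ∀ ω : ι → α, ∏ i ∈ J, f (ω i) = ∏ i, (fun i a => if i ∈ J then f a else 1) i (ω i) := by
    intro ω; simp [Finset.prod_ite_mem]
  rw [funext h]
  refine (iidE_prod (fun i a => if i ∈ J then f a else 1)).trans ?_
  have h2 : ∀ i, (∑ a, w a * if i ∈ J then f a else 1) = if i ∈ J then ∑ a, w a * f a else 1 := by
    intro i; split_ifs <;> simp [hw.sum_one]
  simp_rw [h2]
  simp [Finset.prod_ite_mem]

theorem iidE_const (hw : IsWeight w) (c : ℝ) : iidE w (fun _ : ι → α => c) = c := by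
  have := iidE_prod_subset (ι := ι) hw ∅ (fun _ => 1)
  simp only [Finset.prod_empty, Finset.card_empty, pow_zero] at this
  have h := iidE_const_mul (w := w) c (fun _ : ι → α => 1)
  rw [this] at h; simpa using h

theorem iidE_sub (F G : (ι → α) → ℝ) : iidE w (fun ω => F ω - G ω) = iidE w F - iidE w G := by
  simp [iidE, mul_sub, Finset.sum_sub_distrib]

theorem iidE_coord (hw : IsWeight w) (i : ι) (f : α → ℝ) :
    iidE w (fun ω => f (ω i)) = ∑ a, w a * f a := by
  simpa using iidE_prod_subset hw {i} f

theorem iidE_coord_mul (hw : IsWeight w) {i j : ι} (hij : i ≠ j) (f g : α → ℝ) :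
    iidE w (fun ω => f (ω i) * g (ω j)) = (∑ a, w a * f a) * ∑ a, w a * g a := by
  have h : ∀ ω : ι → α, f (ω i) * g (ω j) =
      ∏ k, (fun k a => if k = i then f a else if k = j then g a else 1) k (ω k) := by
    intro ω
    have : ∀ k, (if k = i then f (ω k) else if k = j then g (ω k) else 1) =
        (if k = i then f (ω k) else 1) * (if k = j then g (ω k) else 1) := by
      intro k; by_cases h1 : k = i
      · have : k ≠ j := fun h => hij (h1 ▸ h)
        simp [h1, hij]
      · simp [h1]
    simp only [this, Finset.prod_mul_distrib, Finset.prod_ite_eq', Finset.mem_univ, if_true]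
  rw [funext h]
  refine (iidE_prod (fun k a => if k = i then f a else if k = j then g a else 1)).trans ?_
  have h2 : ∀ k, (∑ a, w a * if k = i then f a else if k = j then g a else 1) =
      (if k = i then ∑ a, w a * f a else 1) * (if k = j then ∑ a, w a * g a else 1) := by
    intro k; by_cases h1 : k = i
    · simp [h1, hij]
    · by_cases h3 : k = j <;> simp [h1, h3, hw.sum_one, Ne.symm hij]
  simp only [h2, Finset.prod_mul_distrib, Finset.prod_ite_eq', Finset.mem_univ, if_true]

/-- Resampling one letter preserves the product law. This is the Fubini step behind the one-step
analysis of the exploration. -/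
theorem iidE_update (hw : IsWeight w) (i : ι) (F : (ι → α) → ℝ) :
    iidE w F = iidE w (fun ω => ∑ a, w a * F (Function.update ω i a)) := by
  classical
  simp only [iidE, Finset.mul_sum]
  rw [Finset.sum_comm]
  -- reorganise both sides along the equivalence that splits off the letter `i`
  rw [← (Equiv.funSplitAt i α).symm.sum_comp, Fintype.sum_prod_type]
  refine Finset.sum_congr rfl fun a _ => ?_
  rw [← (Equiv.funSplitAt i α).symm.sum_comp, Fintype.sum_prod_type, Finset.sum_comm]
  refine Finset.sum_congr rfl fun g _ => ?_
  have hu : ∀ b, Function.update ((Equiv.funSplitAt i α).symm (b, g)) i a =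
      (Equiv.funSplitAt i α).symm (a, g) := by
    intro b; ext j
    by_cases hj : j = i
    · subst hj; simp [Equiv.funSplitAt, Equiv.piSplitAt]
    · simp [Equiv.funSplitAt, Equiv.piSplitAt, hj]
  simp only [hu]
  have hp : ∀ b, ∏ k, w ((Equiv.funSplitAt i α).symm (b, g) k) = w b * ∏ k : {j // j ≠ i}, w (g k) := by
    intro b
    rw [Fintype.prod_eq_mul_prod_subtype_ne _ i]
    congr 1
    · simp [Equiv.funSplitAt, Equiv.piSplitAt]
    · refine Finset.prod_congr rfl fun k _ => ?_
      simp [Equiv.funSplitAt, Equiv.piSplitAt, k.2]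
  simp only [hp]
  rw [← Finset.sum_mul, ← Finset.sum_mul, hw.sum_one]
  ring

open Classical in
/-- The probability of an event when the letters are independent with law `w`. -/
def iidP (w : α → ℝ) (A : (ι → α) → Prop) : ℝ := iidE w (fun ω => if A ω then 1 else 0)

theorem iidP_mono (hw : IsWeight w) {A B : (ι → α) → Prop} (h : ∀ ω, A ω → B ω) :
    iidP w A ≤ iidP w B :=
  iidE_mono hw fun ω => by
    by_cases hA : A ω
    · simp [hA, h ω hA]
    · simp only [hA, if_false]; split_ifs <;> norm_num

theorem iidP_le_one (hw : IsWeight w) (A : (ι → α) → Prop) : iidP w A ≤ 1 := by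
  refine (iidE_mono hw (G := fun _ => 1) fun ω => ?_).trans (iidE_const hw 1).le
  split_ifs <;> norm_num

theorem iidP_or_le (hw : IsWeight w) (A B : (ι → α) → Prop) :
    iidP w (fun ω => A ω ∨ B ω) ≤ iidP w A + iidP w B := by
  unfold iidP
  rw [← iidE_add]
  refine iidE_mono hw fun ω => ?_
  by_cases hA : A ω <;> by_cases hB : B ω <;> simp [hA, hB]

theorem iidP_exists_le (hw : IsWeight w) {κ : Type*} (s : Finset κ) (A : κ → (ι → α) → Prop) :
    iidP w (fun ω => ∃ k ∈ s, A k ω) ≤ ∑ k ∈ s, iidP w (A k) := by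
  classical
  unfold iidP
  rw [← iidE_sum]
  refine iidE_mono hw fun ω => ?_
  split_ifs with h
  · obtain ⟨k, hk, hA⟩ := h
    refine le_trans ?_ (Finset.single_le_sum (f := fun k => if A k ω then (1 : ℝ) else 0)
      (fun k _ => by split_ifs <;> norm_num) hk)
    simp [hA]
  · exact Finset.sum_nonneg fun k _ => by split_ifs <;> norm_num

theorem iidP_markov (hw : IsWeight w) {F : (ι → α) → ℝ} (hF : ∀ ω, 0 ≤ F ω) {c : ℝ} (hc : 0 < c) :
    iidP w (fun ω => c < F ω) ≤ iidE w F / c := by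
  rw [div_eq_inv_mul, ← iidE_const_mul]
  refine iidE_mono hw fun ω => ?_
  split_ifs with h
  · rw [← div_eq_inv_mul, le_div_iff₀ hc]; linarith
  · exact mul_nonneg (inv_nonneg.2 hc.le) (hF ω)

theorem iidP_chebyshev (hw : IsWeight w) (F : (ι → α) → ℝ) (m : ℝ) {c : ℝ} (hc : 0 < c) :
    iidP w (fun ω => c < |F ω - m|) ≤ iidE w (fun ω => (F ω - m) ^ 2) / c ^ 2 := by
  refine (iidP_mono hw fun ω h => ?_).trans (iidP_markov hw (fun ω => sq_nonneg _) (by positivity))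
  rw [← sq_abs (F ω - m)]
  exact pow_lt_pow_left₀ h hc.le two_ne_zero

/-- The variance of the number of letters of a given kind is at most the mean. -/
theorem iidE_sq_count_le (hw : IsWeight w) (f : α → ℝ) (hf : ∀ a, f a * f a = f a) (J : Finset ι) :
    iidE w (fun ω => (∑ i ∈ J, f (ω i) - J.card * ∑ a, w a * f a) ^ 2) ≤
      J.card * ∑ a, w a * f a := by
  set θ := ∑ a, w a * f a with hθ
  have h1 : ∀ ω : ι → α, (∑ i ∈ J, f (ω i) - J.card * θ) ^ 2 =
      ∑ i ∈ J, ∑ j ∈ J, f (ω i) * f (ω j) - 2 * (J.card * θ) * ∑ i ∈ J, f (ω i) +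
        (J.card * θ) ^ 2 := by
    intro ω
    rw [← Finset.sum_mul_sum]; ring
  have h2 : ∀ i j, iidE w (fun ω : ι → α => f (ω i) * f (ω j)) = if i = j then θ else θ * θ := by
    intro i j
    split_ifs with hij
    · subst hij; simp only [hf]; exact iidE_coord hw i f
    · exact iidE_coord_mul hw hij f f
  simp_rw [h1]
  rw [iidE_add, iidE_sub, iidE_const hw, iidE_const_mul, iidE_sum, iidE_sum]
  have h3 : ∀ i ∈ J, iidE w (fun ω : ι → α => ∑ j ∈ J, f (ω i) * f (ω j)) =
      J.card * (θ * θ) + (θ - θ * θ) := by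
    intro i hi
    rw [iidE_sum]
    have : ∀ j ∈ J, iidE w (fun ω : ι → α => f (ω i) * f (ω j)) =
        θ * θ + if i = j then θ - θ * θ else 0 := by
      intro j _; rw [h2]; split_ifs <;> ring
    rw [Finset.sum_congr rfl this, Finset.sum_add_distrib]
    simp [hi]
  have h4 : ∀ i ∈ J, iidE w (fun ω : ι → α => f (ω i)) = θ := fun i _ => iidE_coord hw i f
  rw [Finset.sum_congr rfl h3, Finset.sum_congr rfl h4]
  simp only [Finset.sum_const, nsmul_eq_mul]
  nlinarith [mul_nonneg (Nat.cast_nonneg (α := ℝ) J.card) (mul_self_nonneg θ)]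

/-- Weighted coverage: the kinds `v` are disjoint, and `b v` is the weight of the kinds that do not
occur among the letters in `J`. -/
theorem iidE_sq_uncovered_le (hw : IsWeight w) {V : Type*} [Fintype V] (f : V → α → ℝ)
    (hf : ∀ v a, f v a * f v a = f v a) (hdisj : ∀ u v, u ≠ v → ∀ a, f u a * f v a = 0)
    (hf1 : ∀ u v, u ≠ v → ∀ a, f u a + f v a ≤ 1) (hf1' : ∀ v a, f v a ≤ 1)
    (b : V → ℝ) (hb : ∀ v, 0 ≤ b v) (J : Finset ι) {B : ℝ} (hB : ∀ v, b v ≤ B) :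
    iidE w (fun ω => (∑ v, b v * ∏ i ∈ J, (1 - f v (ω i)) -
        ∑ v, b v * (1 - ∑ a, w a * f v a) ^ J.card) ^ 2) ≤
      B * ∑ v, b v * (1 - (1 - ∑ a, w a * f v a) ^ J.card) := by
  classical
  set q : V → ℝ := fun v => ∑ a, w a * f v a with hq
  set P : V → ℝ := fun v => (1 - q v) ^ J.card with hP
  have hf0 : ∀ v a, 0 ≤ f v a := fun v a => by rw [← hf]; exact mul_self_nonneg _
  have hq0 : ∀ v, 0 ≤ q v := fun v => Finset.sum_nonneg fun a _ => mul_nonneg (hw.nonneg a) (hf0 v a)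
  have hq1 : ∀ v, q v ≤ 1 := fun v => by
    rw [← hw.sum_one]
    exact Finset.sum_le_sum fun a _ => mul_le_of_le_one_right (hw.nonneg a) (hf1' v a)
  have hq2 : ∀ u v, u ≠ v → q u + q v ≤ 1 := fun u v huv => by
    rw [← hw.sum_one, hq]; simp only; rw [← Finset.sum_add_distrib]
    refine Finset.sum_le_sum fun a _ => ?_
    rw [← mul_add]
    exact mul_le_of_le_one_right (hw.nonneg a) (hf1 u v huv a)
  have hE1 : ∀ v, iidE w (fun ω : ι → α => ∏ i ∈ J, (1 - f v (ω i))) = P v := by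
    intro v
    rw [iidE_prod_subset hw J (fun a => 1 - f v a)]
    simp [mul_sub, hw.sum_one, hP, hq]
  have hE2 : ∀ u v, iidE w (fun ω : ι → α => (∏ i ∈ J, (1 - f u (ω i))) *
      ∏ i ∈ J, (1 - f v (ω i))) ≤ P u * P v + if u = v then 1 - P v else 0 := by
    intro u v
    have hP0 : 0 ≤ P v := pow_nonneg (by linarith [hq1 v]) _
    have hP1 : P v ≤ 1 := pow_le_one₀ (by linarith [hq1 v]) (by linarith [hq0 v])
    simp_rw [← Finset.prod_mul_distrib]
    split_ifs with huv
    · subst huv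
      have : ∀ a, (1 - f u a) * (1 - f u a) = 1 - f u a := fun a => by linarith [hf u a]
      simp_rw [this, hE1]
      nlinarith [mul_nonneg (sub_nonneg.2 hP1) (sub_nonneg.2 hP1)]
    -- Distinct kinds are disjoint, so their joint absence in one letter has probability `1 - q u -
    -- q v ≤ (1 - q u)(1 - q v)`: the absences are negatively correlated and only the diagonal
    -- contributes to the variance.
    · rw [iidE_prod_subset hw J (fun a => (1 - f u a) * (1 - f v a))]
      have : ∑ a, w a * ((1 - f u a) * (1 - f v a)) = 1 - q u - q v := by
        have h : ∀ a, w a * ((1 - f u a) * (1 - f v a)) = w a - w a * f u a - w a * f v a := by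
          intro a; have := hdisj u v huv a; linear_combination w a * this
        simp only [h, Finset.sum_sub_distrib, hw.sum_one, hq]
      rw [this, add_zero, ← mul_pow]
      refine pow_le_pow_left₀ (by linarith [hq2 u v huv]) ?_ _
      nlinarith [mul_nonneg (hq0 u) (hq0 v)]
  have h1 : ∀ ω : ι → α, (∑ v, b v * ∏ i ∈ J, (1 - f v (ω i)) - ∑ v, b v * P v) ^ 2 =
      ∑ u, ∑ v, (b u * b v) * ((∏ i ∈ J, (1 - f u (ω i))) * ∏ i ∈ J, (1 - f v (ω i))) -
      2 * (∑ v, b v * P v) * ∑ v, b v * ∏ i ∈ J, (1 - f v (ω i)) + (∑ v, b v * P v) ^ 2 := by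
    intro ω
    have : ∑ u, ∑ v, (b u * b v) * ((∏ i ∈ J, (1 - f u (ω i))) * ∏ i ∈ J, (1 - f v (ω i))) =
        (∑ u, b u * ∏ i ∈ J, (1 - f u (ω i))) * ∑ v, b v * ∏ i ∈ J, (1 - f v (ω i)) := by
      rw [Finset.sum_mul_sum]
      exact Finset.sum_congr rfl fun u _ => Finset.sum_congr rfl fun v _ => by ring
    rw [this]; ring
  change iidE w (fun ω : ι → α => (∑ v, b v * ∏ i ∈ J, (1 - f v (ω i)) - ∑ v, b v * P v) ^ 2) ≤
    B * ∑ v, b v * (1 - P v)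
  rw [funext h1, iidE_add, iidE_sub, iidE_const hw, iidE_const_mul, iidE_sum, iidE_sum]
  simp only [iidE_sum, iidE_const_mul, hE1]
  have h5 : ∑ u, ∑ v, (b u * b v) * iidE w (fun ω : ι → α => (∏ i ∈ J, (1 - f u (ω i))) *
      ∏ i ∈ J, (1 - f v (ω i))) ≤
      ∑ u, ∑ v, (b u * b v) * (P u * P v + if u = v then 1 - P v else 0) :=
    Finset.sum_le_sum fun u _ => Finset.sum_le_sum fun v _ =>
      mul_le_mul_of_nonneg_left (hE2 u v) (mul_nonneg (hb u) (hb v))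
  have h6 : ∑ u, ∑ v, (b u * b v) * (P u * P v + if u = v then 1 - P v else 0) =
      (∑ v, b v * P v) ^ 2 + ∑ v, b v * (b v * (1 - P v)) := by
    simp_rw [mul_add, Finset.sum_add_distrib]
    congr 1
    · rw [sq, Finset.sum_mul_sum]
      exact Finset.sum_congr rfl fun u _ => Finset.sum_congr rfl fun v _ => by ring
    · refine Finset.sum_congr rfl fun u _ => ?_
      simp [mul_assoc]
  have h7 : ∑ v, b v * (b v * (1 - P v)) ≤ B * ∑ v, b v * (1 - P v) := by
    rw [Finset.mul_sum]
    refine Finset.sum_le_sum fun v _ => mul_le_mul_of_nonneg_right (hB v) ?_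
    exact mul_nonneg (hb v) (sub_nonneg.2 (pow_le_one₀ (by linarith [hq1 v]) (by linarith [hq0 v])))
  nlinarith [h5, h6, h7]

end IID

end ConfigModel

end

noncomputable section

namespace ConfigModel

/-! ### Conditional laws of a percolated uniform matching -/

section Law

variable {H : Type} [Fintype H] [DecidableEq H]

instance : Finite (Pairing H) := Subtype.finite

instance : Fintype (Pairing H) := Fintype.ofFinite _

/-- The edges of a perfect matching as a finset. -/
def Pairing.edgeFinset (f : Pairing H) : Finset (Sym2 H) :=
  Finset.univ.image fun h => s(h, f.1 h)

theorem Pairing.coe_edgeFinset (f : Pairing H) : (f.edgeFinset : Set (Sym2 H)) = f.edges := by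
  simp [Pairing.edgeFinset, Pairing.edges]

theorem Pairing.mem_edgeFinset (f : Pairing H) {a b : H} : s(a, b) ∈ f.edgeFinset ↔ f.1 a = b := by
  simp only [Pairing.edgeFinset, Finset.mem_image, Finset.mem_univ, true_and, Sym2.eq_iff]
  constructor
  · rintro ⟨h, ⟨rfl, h2⟩ | ⟨rfl, h2⟩⟩
    · exact h2
    · rw [← h2]; exact f.2.1 h
  · rintro rfl; exact ⟨a, Or.inl ⟨rfl, rfl⟩⟩

theorem Pairing.edge_unique (f : Pairing H) {e e' : Sym2 H} (he : e ∈ f.edgeFinset)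
    (he' : e' ∈ f.edgeFinset) {h : H} (h1 : h ∈ e) (h2 : h ∈ e') : e = e' := by
  obtain ⟨b, rfl⟩ := Sym2.mem_iff_exists.1 h1
  obtain ⟨b', rfl⟩ := Sym2.mem_iff_exists.1 h2
  rw [f.mem_edgeFinset] at he he'
  rw [← he, ← he']

open Classical in
/-- The probability that `r` together with a `p`-random subset of `E` has the property `B`. -/
def coinAvg (p : ℝ) (B : Set (Sym2 H) → Prop) (E r : Finset (Sym2 H)) : ℝ :=
  ∑ R ∈ E.powerset, p ^ R.card * (1 - p) ^ (E.card - R.card) * if B ↑(r ∪ R) then 1 else 0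

/-- Conditioning on the coin of `e`; this is how coins are revealed one edge at a time. -/
theorem coinAvg_insert (p : ℝ) (B : Set (Sym2 H) → Prop) {E : Finset (Sym2 H)} (r : Finset (Sym2 H))
    {e : Sym2 H} (he : e ∉ E) :
    coinAvg p B (insert e E) r = p * coinAvg p B E (insert e r) + (1 - p) * coinAvg p B E r := by
  classical
  unfold coinAvg
  rw [Finset.sum_powerset_insert he, add_comm, Finset.mul_sum, Finset.mul_sum]
  congr 1
  · refine Finset.sum_congr rfl fun R hR => ?_
    have heR : e ∉ R := fun h => he (Finset.mem_powerset.1 hR h)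
    rw [Finset.card_insert_of_notMem he, Finset.card_insert_of_notMem heR, Nat.add_sub_add_right,
      Finset.union_insert, Finset.insert_union, pow_succ]
    ring
  · refine Finset.sum_congr rfl fun R hR => ?_
    rw [Finset.card_insert_of_notMem he,
      Nat.sub_add_comm (Finset.card_le_card (Finset.mem_powerset.1 hR)), pow_succ]
    ring

theorem coinAvg_eq_one {p : ℝ} {B : Set (Sym2 H) → Prop} {E r : Finset (Sym2 H)}
    (h : ∀ R ⊆ E, B ↑(r ∪ R)) : coinAvg p B E r = 1 := by
  unfold coinAvg
  rw [Finset.sum_congr rfl fun R hR => by rw [if_pos (h R (Finset.mem_powerset.1 hR)), mul_one],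
    Finset.sum_pow_mul_eq_add_pow]
  simp

theorem coinAvg_eq_zero {p : ℝ} {B : Set (Sym2 H) → Prop} {E r : Finset (Sym2 H)}
    (h : ∀ R ⊆ E, ¬ B ↑(r ∪ R)) : coinAvg p B E r = 0 := by
  unfold coinAvg
  exact Finset.sum_eq_zero fun R hR => by rw [if_neg (h R (Finset.mem_powerset.1 hR)), mul_zero]

theorem coinAvg_nonneg {p : ℝ} (hp0 : 0 ≤ p) (hp1 : p ≤ 1) (B : Set (Sym2 H) → Prop)
    (E r : Finset (Sym2 H)) : 0 ≤ coinAvg p B E r := by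
  refine Finset.sum_nonneg fun R _ => mul_nonneg (mul_nonneg (pow_nonneg hp0 _)
    (pow_nonneg (by linarith) _)) (by split_ifs <;> norm_num)

theorem coinAvg_mono {p : ℝ} (hp0 : 0 ≤ p) (hp1 : p ≤ 1) {B B' : Set (Sym2 H) → Prop}
    {E r : Finset (Sym2 H)} (h : ∀ R ⊆ E, B ↑(r ∪ R) → B' ↑(r ∪ R)) :
    coinAvg p B E r ≤ coinAvg p B' E r := by
  refine Finset.sum_le_sum fun R hR => mul_le_mul_of_nonneg_left ?_ (mul_nonneg (pow_nonneg hp0 _)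
    (pow_nonneg (by linarith) _))
  have := h R (Finset.mem_powerset.1 hR)
  by_cases hB : B ↑(r ∪ R)
  · rw [if_pos hB, if_pos (this hB)]
  · rw [if_neg hB]; split_ifs <;> norm_num

theorem coinAvg_le_one {p : ℝ} (hp0 : 0 ≤ p) (hp1 : p ≤ 1) (B : Set (Sym2 H) → Prop)
    (E r : Finset (Sym2 H)) : coinAvg p B E r ≤ 1 :=
  (coinAvg_mono hp0 hp1 (B' := fun _ => True) fun _ _ _ => trivial).trans
    (coinAvg_eq_one fun _ _ => trivial).le

/-- The perfect matchings that contain all the edges in `m`. -/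
def extensions (m : Finset (Sym2 H)) : Finset (Pairing H) :=
  Finset.univ.filter fun f => m ⊆ f.edgeFinset

theorem mem_extensions {m : Finset (Sym2 H)} {f : Pairing H} :
    f ∈ extensions m ↔ m ⊆ f.edgeFinset := by simp [extensions]

/-- The half-edges that can still be matched to `a` when the edges in `m` are given. -/
def partners (m : Finset (Sym2 H)) (a : H) : Finset H :=
  Finset.univ.filter fun x => (∀ e ∈ m, x ∉ e) ∧ x ≠ a

/-- Conjugation of a perfect matching by a transposition. -/
def Pairing.swapConj (f : Pairing H) (x y : H) : Pairing H :=
  ⟨fun h => Equiv.swap x y (f.1 (Equiv.swap x y h)), fun h => by simp [f.2.1 _], fun h hh => by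
    have := congrArg (Equiv.swap x y) hh
    simp only [Equiv.swap_apply_self] at this
    exact f.2.2 _ this⟩

theorem Pairing.swapConj_swapConj (f : Pairing H) (x y : H) :
    (f.swapConj x y).swapConj x y = f := by
  apply Subtype.ext; funext h; simp [Pairing.swapConj]

/-- Neither `x` nor `y` is `a` or lies on an edge of `m`, so the transposition fixes `a` and all
given edges, and only the partner of `a` moves. -/
theorem swapConj_mem_extensions {m : Finset (Sym2 H)} {a x y : H} (hx : x ∈ partners m a)
    (hy : y ∈ partners m a) {f : Pairing H}
    (hf : f ∈ extensions (insert s(a, x) m)) :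
    f.swapConj x y ∈ extensions (insert s(a, y) m) := by
  simp only [partners, Finset.mem_filter, Finset.mem_univ, true_and] at hx hy
  rw [mem_extensions, Finset.insert_subset_iff, f.mem_edgeFinset] at hf
  rw [mem_extensions, Finset.insert_subset_iff, Pairing.mem_edgeFinset]
  constructor
  · simp [Pairing.swapConj, Equiv.swap_apply_of_ne_of_ne hx.2.symm hy.2.symm, hf.1]
  · intro e he
    have h2 := hf.2 he
    have h3 := hx.1 e he
    have h4 := hy.1 e he
    induction e using Sym2.ind with
    | _ u v =>
      rw [f.mem_edgeFinset] at h2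
      simp only [Sym2.mem_iff, not_or] at h3 h4
      rw [Pairing.mem_edgeFinset]
      simp [Pairing.swapConj, Equiv.swap_apply_of_ne_of_ne (Ne.symm h3.1) (Ne.symm h4.1), h2,
        Equiv.swap_apply_of_ne_of_ne (Ne.symm h3.2) (Ne.symm h4.2)]

/-- Conjugation is a bijection between the two sets. In probabilistic terms, given `m` the partner
of `a` is uniform on `partners m a`. -/
theorem card_extensions_insert {m : Finset (Sym2 H)} {a x y : H} (hx : x ∈ partners m a)
    (hy : y ∈ partners m a) :
    (extensions (insert s(a, x) m)).card = (extensions (insert s(a, y) m)).card := by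
  refine Finset.card_bij' (fun f _ => f.swapConj x y) (fun f _ => f.swapConj x y) ?_ ?_ ?_ ?_
  · exact fun f hf => swapConj_mem_extensions hx hy hf
  · intro f hf
    have := swapConj_mem_extensions hy hx hf
    have hc : f.swapConj x y = f.swapConj y x := by
      apply Subtype.ext; funext h; simp [Pairing.swapConj, Equiv.swap_comm x y]
    simpa only [hc] using this
  · exact fun f _ => f.swapConj_swapConj x y
  · exact fun f _ => f.swapConj_swapConj x y

theorem sum_extensions {m : Finset (Sym2 H)} {a : H} (ha : ∀ e ∈ m, a ∉ e) (F : Pairing H → ℝ) :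
    ∑ f ∈ extensions m, F f = ∑ x ∈ partners m a, ∑ f ∈ extensions (insert s(a, x) m), F f := by
  have h : ∀ f ∈ extensions m, f.1 a ∈ partners m a := by
    intro f hf
    simp only [partners, Finset.mem_filter, Finset.mem_univ, true_and]
    refine ⟨fun e he hfe => ?_, f.2.2 a⟩
    have h1 : s(a, f.1 a) = e :=
      f.edge_unique (f.mem_edgeFinset.2 rfl) (mem_extensions.1 hf he) (by simp) hfe
    exact ha e he (h1 ▸ by simp)
  rw [← Finset.sum_fiberwise_of_maps_to h]
  refine Finset.sum_congr rfl fun x _ => Finset.sum_congr ?_ fun _ _ => rfl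
  ext f
  simp [mem_extensions, Finset.insert_subset_iff, Pairing.mem_edgeFinset, and_comm]

/-- The conditional probability that the retained edges have the property `B`, given that the edges
in `m` are in the matching and that `r` is the set of those among them that are retained. -/
def condP (p : ℝ) (B : Set (Sym2 H) → Prop) (m r : Finset (Sym2 H)) : ℝ :=
  (∑ f ∈ extensions m, coinAvg p B (f.edgeFinset \ m) r) / (extensions m).card

theorem card_extensions_eq {m : Finset (Sym2 H)} {a : H} (ha : ∀ e ∈ m, a ∉ e) {x : H}
    (hx : x ∈ partners m a) :
    (extensions m).card = (partners m a).card * (extensions (insert s(a, x) m)).card := by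
  have h := sum_extensions ha (fun _ => 1)
  simp only [Finset.sum_const, nsmul_eq_mul, mul_one] at h
  rw [Finset.sum_congr rfl fun y hy => by rw [card_extensions_insert hy hx]] at h
  rw [Finset.sum_const, nsmul_eq_mul] at h
  exact_mod_cast h

/-- The tower property for revealing the partner of `a` and its coin. Multiplying out the number of
partners avoids a separate case for an empty set of partners. -/
theorem card_mul_condP (p : ℝ) (B : Set (Sym2 H) → Prop) {m : Finset (Sym2 H)}
    (r : Finset (Sym2 H)) {a : H} (ha : ∀ e ∈ m, a ∉ e) :
    (partners m a).card * condP p B m r = ∑ x ∈ partners m a,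
      (p * condP p B (insert s(a, x) m) (insert s(a, x) r) +
        (1 - p) * condP p B (insert s(a, x) m) r) := by
  have hsum : ∑ f ∈ extensions m, coinAvg p B (f.edgeFinset \ m) r = ∑ x ∈ partners m a,
      ∑ f ∈ extensions (insert s(a, x) m),
        (p * coinAvg p B (f.edgeFinset \ insert s(a, x) m) (insert s(a, x) r) +
          (1 - p) * coinAvg p B (f.edgeFinset \ insert s(a, x) m) r) := by
    rw [sum_extensions ha]
    refine Finset.sum_congr rfl fun x _ => Finset.sum_congr rfl fun f hf => ?_
    rw [mem_extensions, Finset.insert_subset_iff] at hf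
    rw [← coinAvg_insert]
    · congr 1
      ext e
      simp only [Finset.mem_sdiff, Finset.mem_insert, not_or]
      constructor
      · rintro ⟨h1, h2⟩
        by_cases h : e = s(a, x)
        · exact Or.inl h
        · exact Or.inr ⟨h1, h, h2⟩
      · rintro (rfl | ⟨h1, _, h2⟩)
        · exact ⟨hf.1, fun h => ha _ h (by simp)⟩
        · exact ⟨h1, h2⟩
    · simp
  unfold condP
  rw [hsum, Finset.sum_div, Finset.mul_sum]
  refine Finset.sum_congr rfl fun x hx => ?_
  rw [card_extensions_eq ha hx, Finset.sum_add_distrib, ← Finset.mul_sum, ← Finset.mul_sum]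
  have hc : ((partners m a).card : ℝ) ≠ 0 := by
    exact_mod_cast (Finset.card_pos.2 ⟨x, hx⟩).ne'
  push_cast
  rw [mul_div_assoc', mul_div_mul_left _ _ hc, add_div, mul_div_assoc, mul_div_assoc]

theorem extensions_insert_nonempty {m : Finset (Sym2 H)} {a : H} (ha : ∀ e ∈ m, a ∉ e) {x : H}
    (hx : x ∈ partners m a) (h : (extensions m).Nonempty) :
    (extensions (insert s(a, x) m)).Nonempty := by
  rw [← Finset.card_pos] at h ⊢
  rw [card_extensions_eq ha hx] at h
  exact Nat.pos_of_mul_pos_left h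

theorem condP_nonneg {p : ℝ} (hp0 : 0 ≤ p) (hp1 : p ≤ 1) (B : Set (Sym2 H) → Prop)
    (m r : Finset (Sym2 H)) : 0 ≤ condP p B m r :=
  div_nonneg (Finset.sum_nonneg fun _ _ => coinAvg_nonneg hp0 hp1 B _ _) (Nat.cast_nonneg _)

theorem condP_le_one {p : ℝ} (hp0 : 0 ≤ p) (hp1 : p ≤ 1) (B : Set (Sym2 H) → Prop)
    (m r : Finset (Sym2 H)) : condP p B m r ≤ 1 := by
  refine div_le_one_of_le₀ ?_ (Nat.cast_nonneg _)
  refine (Finset.sum_le_card_nsmul _ _ 1 fun f _ => coinAvg_le_one hp0 hp1 B _ _).trans ?_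
  simp

theorem condP_eq_zero {p : ℝ} {B : Set (Sym2 H) → Prop} {m r : Finset (Sym2 H)}
    (h : ∀ f ∈ extensions m, ∀ R ⊆ f.edgeFinset \ m, ¬ B ↑(r ∪ R)) : condP p B m r = 0 := by
  unfold condP
  rw [Finset.sum_eq_zero fun f hf => coinAvg_eq_zero (h f hf), zero_div]

theorem condP_eq_one {p : ℝ} {B : Set (Sym2 H) → Prop} {m r : Finset (Sym2 H)}
    (hm : (extensions m).Nonempty)
    (h : ∀ f ∈ extensions m, ∀ R ⊆ f.edgeFinset \ m, B ↑(r ∪ R)) : condP p B m r = 1 := by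
  unfold condP
  rw [Finset.sum_congr rfl fun f hf => coinAvg_eq_one (h f hf)]
  simp [(Finset.card_pos.2 hm).ne']

/-- A given half-edge belongs to a retained edge with probability `p`. -/
theorem condP_mem_retained [Nonempty (Pairing H)] (p : ℝ) (h : H) :
    condP p (fun R : Set (Sym2 H) => ∃ e ∈ R, h ∈ e) ∅ ∅ = p := by
  have hc : ∀ f ∈ extensions (∅ : Finset (Sym2 H)),
      coinAvg p (fun R : Set (Sym2 H) => ∃ e ∈ R, h ∈ e) (f.edgeFinset \ ∅) ∅ = p := by
    intro f _
    have he : s(h, f.1 h) ∈ f.edgeFinset := f.mem_edgeFinset.2 rfl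
    rw [Finset.sdiff_empty, ← Finset.insert_erase he, coinAvg_insert _ _ _ (by simp),
      coinAvg_eq_one, coinAvg_eq_zero]
    · ring
    · rintro R hR ⟨e, heR, hhe⟩
      simp only [Finset.empty_union, Finset.mem_coe] at heR
      have := Finset.mem_erase.1 (hR heR)
      exact this.1 (f.edge_unique this.2 he hhe (by simp))
    · intro R _
      exact ⟨s(h, f.1 h), by simp, by simp⟩
  unfold condP
  rw [Finset.sum_congr rfl hc]
  have : (extensions (∅ : Finset (Sym2 H))).Nonempty := by
    obtain ⟨f⟩ := ‹Nonempty (Pairing H)›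
    exact ⟨f, by simp [mem_extensions]⟩
  simp [(Finset.card_pos.2 this).ne']

/-- The random set is almost surely a subset of the finitely many edges, and the mass of each subset
is explicit; from here on the model is a finite sum. -/
theorem setBernoulli_real_eq_coinAvg (f : Pairing H) (p : unitInterval)
    (B : Set (Sym2 H) → Prop) :
    (setBernoulli f.edges p).real {R | B R} = coinAvg p B f.edgeFinset ∅ := by
  classical
  have h1 : (setBernoulli f.edges p).real {R | B R} = (setBernoulli f.edges p).real
      (((f.edgeFinset.powerset.filter fun R : Finset (Sym2 H) => B (R : Set (Sym2 H))).image
        (fun R : Finset (Sym2 H) => (R : Set (Sym2 H))) : Finset (Set (Sym2 H))) :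
          Set (Set (Sym2 H))) := by
    rw [measureReal_def, setBernoulli_apply_eq_apply_subsets, measureReal_def]
    congr 2
    ext R
    simp only [Set.mem_ofPred_eq, Finset.coe_image, Finset.coe_filter, Finset.mem_powerset,
      Set.mem_image]
    constructor
    · rintro ⟨hB, hR⟩
      refine ⟨R.toFinset, ⟨?_, by simpa using hB⟩, by simp⟩
      rw [← f.coe_edgeFinset] at hR
      simpa [← Finset.coe_subset] using hR
    · rintro ⟨R', ⟨h1, h2⟩, rfl⟩
      exact ⟨h2, by rw [← f.coe_edgeFinset]; exact_mod_cast h1⟩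
  rw [h1, ← sum_measureReal_singleton, Finset.sum_image fun _ _ _ _ h => Finset.coe_injective h,
    Finset.sum_filter]
  unfold coinAvg
  refine Finset.sum_congr rfl fun R hR => ?_
  rw [Finset.mem_powerset] at hR
  rw [Finset.empty_union]
  split_ifs with hB
  · rw [setBernoulli_real_singleton _ (by rw [← f.coe_edgeFinset]; exact_mod_cast hR)
      (Set.toFinite _), ← f.coe_edgeFinset, ← Finset.coe_sdiff, Set.ncard_coe_finset,
      Set.ncard_coe_finset, Finset.card_sdiff_of_subset hR, mul_one]
  · simp

end Law

theorem percolatedLaw_real_eq_condP {n : ℕ} (d : Fin n → ℕ) (hd : Even (totalDegree d))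
    (p : unitInterval) (B : Set (Sym2 (HalfEdge d)) → Prop) :
    (percolatedLaw d p).real {R | B R} = condP p B ∅ ∅ := by
  classical
  have := pairing_nonempty d hd
  have hmeas : MeasurableSet {R : Set (Sym2 (HalfEdge d)) | B R} := (Set.toFinite _).measurableSet
  have : IsProbabilityMeasure (uniformOn (Set.univ : Set (Pairing (HalfEdge d)))) :=
    isProbabilityMeasure_uniformOn Set.finite_univ Set.univ_nonempty
  unfold percolatedLaw
  rw [measureReal_def, Measure.bind_apply hmeas measurable_from_top.aemeasurable,
    lintegral_fintype, ENNReal.toReal_sum]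
  · have h1 : ∀ f : Pairing (HalfEdge d), ((setBernoulli f.edges p) {R | B R} *
        uniformOn (Set.univ : Set (Pairing (HalfEdge d))) {f}).toReal =
        coinAvg p B f.edgeFinset ∅ / Fintype.card (Pairing (HalfEdge d)) := by
      intro f
      rw [ENNReal.toReal_mul, ← measureReal_def, setBernoulli_real_eq_coinAvg, uniformOn_univ]
      simp [div_eq_mul_inv]
    rw [Finset.sum_congr rfl fun f _ => h1 f]
    simp [condP, extensions, Finset.sum_div]
  · intro f _
    exact ENNReal.mul_ne_top (measure_ne_top _ _) (measure_ne_top _ _)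

end ConfigModel

end

noncomputable section

namespace ConfigModel

/-! ### Exploration of the percolated configuration model by independent samples -/

section Exploration

variable {n : ℕ} {d : Fin n → ℕ}

/-- The half-edge `h` belongs to one of the edges in `m`. -/
def Matched (m : Finset (Sym2 (HalfEdge d))) (h : HalfEdge d) : Prop := ∃ e ∈ m, h ∈ e

/-- The vertex `v` is incident to one of the edges in `r`. -/
def Found (r : Finset (Sym2 (HalfEdge d))) (v : Fin n) : Prop := ∃ e ∈ r, ∃ h ∈ e, h.1 = v

theorem Matched.mono {m m' : Finset (Sym2 (HalfEdge d))} (h : m ⊆ m') {x : HalfEdge d}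
    (hx : Matched m x) : Matched m' x :=
  let ⟨e, he, hxe⟩ := hx; ⟨e, h he, hxe⟩

theorem Found.mono {r r' : Finset (Sym2 (HalfEdge d))} (h : r ⊆ r') {v : Fin n}
    (hv : Found r v) : Found r' v :=
  let ⟨e, he, hve⟩ := hv; ⟨e, h he, hve⟩

theorem matched_insert {m : Finset (Sym2 (HalfEdge d))} {a x h : HalfEdge d} :
    Matched (insert s(a, x) m) h ↔ h = a ∨ h = x ∨ Matched m h := by
  simp [Matched, or_assoc]

theorem found_insert {r : Finset (Sym2 (HalfEdge d))} {a x : HalfEdge d} {v : Fin n} :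
    Found (insert s(a, x) r) v ↔ v = a.1 ∨ v = x.1 ∨ Found r v := by
  constructor
  · rintro ⟨e, he, h, hh, rfl⟩
    rcases Finset.mem_insert.1 he with rfl | he
    · rcases Sym2.mem_iff.1 hh with rfl | rfl <;> simp
    · exact Or.inr (Or.inr ⟨e, he, h, hh, rfl⟩)
  · rintro (rfl | rfl | h)
    · exact ⟨_, Finset.mem_insert_self _ _, a, by simp, rfl⟩
    · exact ⟨_, Finset.mem_insert_self _ _, x, by simp, rfl⟩
    · exact h.mono (Finset.subset_insert _ _)

variable (d) in
/-- The state of an exploration: the matched edges `m` revealed so far, the retained edges `r` among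
them, and the half-edges `A` from which the matched edges were explored. -/
structure Exploration where
  m : Finset (Sym2 (HalfEdge d))
  r : Finset (Sym2 (HalfEdge d))
  A : Finset (HalfEdge d)

/-- An active half-edge is an unmatched half-edge at a vertex that has been found. -/
def Active (st : Exploration d) (h : HalfEdge d) : Prop := ¬ Matched st.m h ∧ Found st.r h.1

open Classical in
/-- The next half-edge to explore: an active one if there is any, otherwise an unmatched seed. -/
def pick (Q : Finset (HalfEdge d)) (st : Exploration d) : Option (HalfEdge d) :=
  if h : ∃ a, Active st a then some h.choose
  else if h : ∃ a ∈ Q, ¬ Matched st.m a then some h.choose else none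

theorem pick_eq_some {Q : Finset (HalfEdge d)} {st : Exploration d} {a : HalfEdge d}
    (h : pick Q st = some a) :
    ¬ Matched st.m a ∧ (Active st a ∨ (∀ b, ¬ Active st b) ∧ a ∈ Q) := by
  unfold pick at h
  split_ifs at h with h1 h2
  · obtain rfl := Option.some.inj h
    exact ⟨h1.choose_spec.1, Or.inl h1.choose_spec⟩
  · obtain rfl := Option.some.inj h
    exact ⟨h2.choose_spec.2, Or.inr ⟨not_exists.1 h1, h2.choose_spec.1⟩⟩

theorem pick_eq_none {Q : Finset (HalfEdge d)} {st : Exploration d} (h : pick Q st = none) :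
    (∀ b, ¬ Active st b) ∧ ∀ a ∈ Q, Matched st.m a := by
  unfold pick at h
  split_ifs at h with h1 h2
  exact ⟨not_exists.1 h1, fun a ha => not_not.1 fun hc => h2 ⟨a, ha, hc⟩⟩

open Classical in
/-- One step of the exploration. The sample `y.1` is the partner of the picked half-edge unless it
is already matched, in which case nothing happens; the coin `y.2` decides about retention. -/
def advance (Q : Finset (HalfEdge d)) (st : Exploration d) (y : HalfEdge d × Bool) :
    Exploration d :=
  match pick Q st with
  | none => st
  | some a => if Matched st.m y.1 ∨ y.1 = a then st else
      ⟨insert s(a, y.1) st.m, if y.2 then insert s(a, y.1) st.r else st.r, insert a st.A⟩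

theorem advance_cases (Q : Finset (HalfEdge d)) (st : Exploration d) (y : HalfEdge d × Bool) :
    (advance Q st y = st ∧ (pick Q st = none ∨ ∃ a, pick Q st = some a ∧
      (Matched st.m y.1 ∨ y.1 = a))) ∨
    ∃ a, pick Q st = some a ∧ ¬ Matched st.m y.1 ∧ y.1 ≠ a ∧ advance Q st y =
      ⟨insert s(a, y.1) st.m, if y.2 then insert s(a, y.1) st.r else st.r, insert a st.A⟩ := by
  unfold advance
  cases h : pick Q st with
  | none => simp
  | some a =>
    by_cases h2 : Matched st.m y.1 ∨ y.1 = a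
    · left; simp only [if_pos h2, true_and]; exact Or.inr ⟨a, rfl, h2⟩
    · right
      rw [not_or] at h2
      exact ⟨a, rfl, h2.1, h2.2, by simp [h2]⟩

/-- The state after `k` steps driven by the samples `ω`. -/
def run {K : ℕ} (Q : Finset (HalfEdge d)) (ω : Fin K → HalfEdge d × Bool) : ℕ → Exploration d
  | 0 => ⟨∅, ∅, ∅⟩
  | k + 1 => if h : k < K then advance Q (run Q ω k) (ω ⟨k, h⟩) else run Q ω k

variable {K : ℕ} {Q : Finset (HalfEdge d)} {ω : Fin K → HalfEdge d × Bool}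

theorem run_succ (i : Fin K) : run Q ω (i + 1) = advance Q (run Q ω i) (ω i) := by
  simp [run]

theorem run_congr {ω' : Fin K → HalfEdge d × Bool} :
    ∀ {k : ℕ}, (∀ i : Fin K, (i : ℕ) < k → ω i = ω' i) → run Q ω k = run Q ω' k
  | 0, _ => rfl
  | k + 1, h => by
    simp only [run]
    rw [run_congr (k := k) fun i hi => h i (by omega)]
    split_ifs with hk
    · rw [h ⟨k, hk⟩ (by simp)]
    · rfl

/-- The law of a sample: a uniform half-edge together with a coin. -/
def sampleWeight (d : Fin n → ℕ) (p : ℝ) (y : HalfEdge d × Bool) : ℝ :=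
  (1 / (Fintype.card (HalfEdge d) : ℝ)) * if y.2 then p else 1 - p

theorem sum_sampleWeight_mul (p : ℝ) (f : HalfEdge d × Bool → ℝ) :
    ∑ y, sampleWeight d p y * f y =
      (1 / (Fintype.card (HalfEdge d) : ℝ)) * ∑ x, (p * f (x, true) + (1 - p) * f (x, false)) := by
  rw [Fintype.sum_prod_type, Finset.mul_sum]
  refine Finset.sum_congr rfl fun x _ => ?_
  simp [sampleWeight]; ring

theorem isWeight_sampleWeight [Nonempty (HalfEdge d)] {p : ℝ} (hp0 : 0 ≤ p) (hp1 : p ≤ 1) :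
    IsWeight (sampleWeight d p) := by
  refine ⟨fun y => mul_nonneg (by positivity) (by split_ifs <;> linarith), ?_⟩
  have h := sum_sampleWeight_mul (d := d) p (fun _ => 1)
  simp only [mul_one] at h
  rw [h]
  have : (Fintype.card (HalfEdge d) : ℝ) ≠ 0 := by exact_mod_cast Fintype.card_ne_zero
  simp only [add_sub_cancel, Finset.sum_const, Finset.card_univ, nsmul_eq_mul, mul_one]
  field_simp

/-- The martingale property of the rejection scheme. Discarded samples leave the state and hence
`condP` unchanged, and accepted samples are uniform over the possible partners, so they average to
`condP` as well by `card_mul_condP`. -/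
theorem sum_sampleWeight_condP [Nonempty (HalfEdge d)] {p : ℝ} (hp0 : 0 ≤ p) (hp1 : p ≤ 1)
    (B : Set (Sym2 (HalfEdge d)) → Prop) (Q : Finset (HalfEdge d)) (st : Exploration d) :
    ∑ y, sampleWeight d p y * condP p B (advance Q st y).m (advance Q st y).r =
      condP p B st.m st.r := by
  classical
  cases h : pick Q st with
  | none =>
    have : ∀ y, advance Q st y = st := fun y => by simp [advance, h]
    simp only [this]
    rw [← Finset.sum_mul, (isWeight_sampleWeight hp0 hp1).sum_one, one_mul]
  | some a =>
    have ha : ∀ e ∈ st.m, a ∉ e := fun e he hae => (pick_eq_some h).1 ⟨e, he, hae⟩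
    have hN : (Fintype.card (HalfEdge d) : ℝ) ≠ 0 := by exact_mod_cast Fintype.card_ne_zero
    rw [sum_sampleWeight_mul p (fun y => condP p B (advance Q st y).m (advance Q st y).r)]
    rw [← Finset.sum_add_sum_compl (partners st.m a)]
    have h1 : ∀ x ∈ (partners st.m a)ᶜ, p * condP p B (advance Q st (x, true)).m
        (advance Q st (x, true)).r + (1 - p) * condP p B (advance Q st (x, false)).m
        (advance Q st (x, false)).r = condP p B st.m st.r := by
      intro x hx
      have hx' : Matched st.m x ∨ x = a := by
        by_contra hc
        rw [not_or] at hc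
        refine Finset.mem_compl.1 hx ?_
        simp only [partners, Finset.mem_filter, Finset.mem_univ, true_and]
        exact ⟨fun e he hxe => hc.1 ⟨e, he, hxe⟩, hc.2⟩
      have : ∀ c, advance Q st (x, c) = st := fun c => by simp [advance, h, hx']
      rw [this, this]; ring
    have h2 : ∀ x ∈ partners st.m a, p * condP p B (advance Q st (x, true)).m
        (advance Q st (x, true)).r + (1 - p) * condP p B (advance Q st (x, false)).m
        (advance Q st (x, false)).r = p * condP p B (insert s(a, x) st.m) (insert s(a, x) st.r) +
        (1 - p) * condP p B (insert s(a, x) st.m) st.r := by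
      intro x hx
      simp only [partners, Finset.mem_filter, Finset.mem_univ, true_and] at hx
      have hx' : ¬ (Matched st.m x ∨ x = a) := by
        rw [not_or]
        exact ⟨fun ⟨e, he, hxe⟩ => hx.1 e he hxe, hx.2⟩
      simp [advance, h, hx']
    rw [Finset.sum_congr rfl h1, Finset.sum_congr rfl h2, ← card_mul_condP p B st.r ha,
      Finset.sum_const, nsmul_eq_mul, ← add_mul]
    have h3 : ((partners st.m a).card : ℝ) + ((partners st.m a)ᶜ.card : ℝ) =
        Fintype.card (HalfEdge d) := by exact_mod_cast Finset.card_add_card_compl _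
    rw [h3]
    field_simp

/-- Revealing the edges along an exploration preserves the law of the percolated model. -/
theorem iidE_condP_run [Nonempty (HalfEdge d)] {p : ℝ} (hp0 : 0 ≤ p) (hp1 : p ≤ 1)
    (B : Set (Sym2 (HalfEdge d)) → Prop) (Q : Finset (HalfEdge d)) {k : ℕ} (hk : k ≤ K) :
    iidE (sampleWeight d p) (fun ω : Fin K → HalfEdge d × Bool =>
      condP p B (run Q ω k).m (run Q ω k).r) = condP p B ∅ ∅ := by
  have hw := isWeight_sampleWeight (d := d) hp0 hp1
  induction k with
  | zero => simp only [run]; exact iidE_const (ι := Fin K) hw _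
  | succ k ih =>
    rw [← ih (by omega), iidE_update hw ⟨k, hk⟩]
    congr 1
    funext ω
    rw [← sum_sampleWeight_condP hp0 hp1 B Q (run Q ω k)]
    refine Finset.sum_congr rfl fun y _ => ?_
    have h1 : run Q (Function.update ω ⟨k, hk⟩ y) (k + 1) = advance Q (run Q ω k) y := by
      have := run_succ (Q := Q) (ω := Function.update ω ⟨k, hk⟩ y) ⟨k, hk⟩
      simp only [Function.update_self] at this
      rw [this, run_congr (ω' := ω)]
      intro i hi
      exact Function.update_of_ne (fun h => by simp [h] at hi) _ _
    rw [h1]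

end Exploration

end ConfigModel

end

noncomputable section

namespace ConfigModel

/-! ### Deterministic bookkeeping: the exploration compared with the raw samples -/

section Invariants

variable {n : ℕ} {d : Fin n → ℕ} {K : ℕ}

open Classical in
/-- The samples before time `k` whose coin shows retention. -/
def coins (ω : Fin K → HalfEdge d × Bool) (k : ℕ) : Finset (Fin K) :=
  Finset.univ.filter fun i => (i : ℕ) < k ∧ (ω i).2 = true

/-- The vertex of the sample `i` is also the vertex of another sample or of a seed. -/
def Collides (Q : Finset (HalfEdge d)) (ω : Fin K → HalfEdge d × Bool) (i : Fin K) : Prop :=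
  (∃ j, j ≠ i ∧ (ω j).1.1 = (ω i).1.1) ∨ ∃ h ∈ Q, h.1 = (ω i).1.1

open Classical in
/-- The samples that collide. -/
def collisions (Q : Finset (HalfEdge d)) (ω : Fin K → HalfEdge d × Bool) : Finset (Fin K) :=
  Finset.univ.filter fun i => Collides Q ω i

open Classical in
/-- The samples that collide and whose coin shows retention. -/
def coinCollisions (Q : Finset (HalfEdge d)) (ω : Fin K → HalfEdge d × Bool) : Finset (Fin K) :=
  Finset.univ.filter fun i => Collides Q ω i ∧ (ω i).2 = true

open Classical in
/-- The vertices of the samples before time `k` whose coin shows retention. -/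
def covered (ω : Fin K → HalfEdge d × Bool) (k : ℕ) : Finset (Fin n) :=
  Finset.univ.filter fun v => ∃ i : Fin K, (i : ℕ) < k ∧ (ω i).2 = true ∧ (ω i).1.1 = v

open Classical in
/-- The vertices of those samples with a retention coin that are repeated half-edges or seeds. -/
def spoiled (Q : Finset (HalfEdge d)) (ω : Fin K → HalfEdge d × Bool) : Finset (Fin n) :=
  Finset.univ.filter fun v => ∃ i, (ω i).2 = true ∧ (ω i).1.1 = v ∧
    ((∃ j, j < i ∧ (ω j).1 = (ω i).1) ∨ (ω i).1 ∈ Q)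

open Classical in
/-- The vertices of the seeds that belong to an edge in `r`. -/
def seedVertices (Q : Finset (HalfEdge d)) (r : Finset (Sym2 (HalfEdge d))) : Finset (Fin n) :=
  Finset.univ.filter fun v => ∃ h ∈ Q, h.1 = v ∧ Matched r h

open Classical in
/-- The vertices that have been found. -/
def foundSet (r : Finset (Sym2 (HalfEdge d))) : Finset (Fin n) :=
  Finset.univ.filter fun v => Found r v

/-- The total degree of a set of vertices. -/
def vol (d : Fin n → ℕ) (W : Finset (Fin n)) : ℕ := ∑ v ∈ W, d v

theorem vol_mono {W W' : Finset (Fin n)} (h : W ⊆ W') : vol d W ≤ vol d W' :=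
  Finset.sum_le_sum_of_subset h

theorem vol_union_le (W W' : Finset (Fin n)) : vol d (W ∪ W') ≤ vol d W + vol d W' :=
  Finset.sum_union_inter (s₁ := W) (s₂ := W') (f := d) ▸ Nat.le_add_right _ _

theorem card_filter_fst_mem (W : Finset (Fin n)) :
    (Finset.univ.filter fun h : HalfEdge d => h.1 ∈ W).card = vol d W := by
  have : (Finset.univ.filter fun h : HalfEdge d => h.1 ∈ W) =
      W.sigma fun _ => Finset.univ := by ext h; simp
  rw [this, Finset.card_sigma]; simp [vol]

/-- What is known about an exploration after `k` steps. -/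
structure Invariant (Q : Finset (HalfEdge d)) (ω : Fin K → HalfEdge d × Bool) (k : ℕ)
    (st : Exploration d) : Prop where
  found : ∀ v, Found st.r v → v ∈ covered ω k ∨ v ∈ seedVertices Q st.r
  matched : ∀ h, Matched st.m h → h ∈ st.A ∨ ∃ i : Fin K, (i : ℕ) < k ∧ (ω i).1 = h
  source : ∀ a ∈ st.A, a ∈ Q ∨ Found st.r a.1
  source_matched : ∀ a ∈ st.A, Matched st.m a
  card_A : st.A.card = st.m.card
  sub : st.r ⊆ st.m
  card_m : st.m.card ≤ k
  card_r : st.r.card ≤ (coins ω k).card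
  connected : ∀ h h', Active st h → Active st h' →
    (skeleton (st.r : Set (Sym2 (HalfEdge d)))).Reachable h.1 h'.1

variable {Q : Finset (HalfEdge d)} {ω : Fin K → HalfEdge d × Bool} {k : ℕ} {st : Exploration d}

theorem mem_coins {i : Fin K} : i ∈ coins ω k ↔ (i : ℕ) < k ∧ (ω i).2 = true := by simp [coins]

theorem mem_covered {v : Fin n} :
    v ∈ covered ω k ↔ ∃ i : Fin K, (i : ℕ) < k ∧ (ω i).2 = true ∧ (ω i).1.1 = v := by simp [covered]

theorem mem_seedVertices {r : Finset (Sym2 (HalfEdge d))} {v : Fin n} :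
    v ∈ seedVertices Q r ↔ ∃ h ∈ Q, h.1 = v ∧ Matched r h := by simp [seedVertices]

theorem coins_mono {k k' : ℕ} (h : k ≤ k') : coins ω k ⊆ coins ω k' := fun i hi => by
  rw [mem_coins] at hi ⊢; exact ⟨by omega, hi.2⟩

theorem covered_mono {k k' : ℕ} (h : k ≤ k') : covered ω k ⊆ covered ω k' := fun v hv => by
  rw [mem_covered] at hv ⊢
  obtain ⟨i, hi, h2⟩ := hv
  exact ⟨i, by omega, h2⟩

theorem seedVertices_mono {r r' : Finset (Sym2 (HalfEdge d))} (h : r ⊆ r') :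
    seedVertices Q r ⊆ seedVertices Q r' := fun v hv => by
  rw [mem_seedVertices] at hv ⊢
  obtain ⟨g, hg, hv, hm⟩ := hv
  exact ⟨g, hg, hv, hm.mono h⟩

theorem skeleton_mono {R R' : Set (Sym2 (HalfEdge d))} (h : R ⊆ R') : skeleton R ≤ skeleton R' :=
  SimpleGraph.fromEdgeSet_mono (Set.image_mono h)

theorem reachable_of_mem {R : Set (Sym2 (HalfEdge d))} {a x : HalfEdge d} (h : s(a, x) ∈ R) :
    (skeleton R).Reachable a.1 x.1 := by
  by_cases hax : a.1 = x.1
  · rw [hax]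
  · refine SimpleGraph.Adj.reachable ?_
    unfold skeleton
    rw [SimpleGraph.fromEdgeSet_adj]
    exact ⟨⟨s(a, x), h, by simp⟩, hax⟩

/-- A vertex that was found before the sample `i` is the vertex of another sample or of a seed. -/
theorem Invariant.collides_of_found {i : Fin K} (I : Invariant Q ω i st)
    (h : Found st.r (ω i).1.1) : Collides Q ω i := by
  rcases I.found _ h with h | h
  · obtain ⟨j, hj, -, hv⟩ := mem_covered.1 h
    exact Or.inl ⟨j, fun hji => by simp [hji] at hj, hv⟩
  · obtain ⟨g, hg, hv, -⟩ := mem_seedVertices.1 h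
    exact Or.inr ⟨g, hg, hv⟩

/-- A half-edge is used up either as a source, hence a seed or at a found vertex, or as an earlier
sample. A discarded sample whose vertex is not found is thus a repetition of the very same half-edge
or a seed, which is much rarer than a repeated vertex. -/
theorem Invariant.rejected {i : Fin K} (I : Invariant Q ω i st) {a : HalfEdge d}
    (ha : pick Q st = some a) (h : Matched st.m (ω i).1 ∨ (ω i).1 = a) :
    Found st.r (ω i).1.1 ∨ (∃ j, j < i ∧ (ω j).1 = (ω i).1) ∨ (ω i).1 ∈ Q := by
  rcases h with h | h
  · rcases I.matched _ h with h | ⟨j, hj, h⟩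
    · rcases I.source _ h with h | h
      · exact Or.inr (Or.inr h)
      · exact Or.inl h
    · exact Or.inr (Or.inl ⟨j, hj, h⟩)
  · rcases (pick_eq_some ha).2 with h2 | h2
    · left; rw [h]; exact h2.2
    · right; right; rw [h]; exact h2.2

theorem Invariant.collides_of_rejected {i : Fin K} (I : Invariant Q ω i st) {a : HalfEdge d}
    (ha : pick Q st = some a) (h : Matched st.m (ω i).1 ∨ (ω i).1 = a) : Collides Q ω i := by
  rcases I.rejected ha h with h | ⟨j, hj, h⟩ | h
  · exact I.collides_of_found h
  · exact Or.inl ⟨j, hj.ne, by rw [h]⟩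
  · exact Or.inr ⟨_, h, rfl⟩

/-- Active half-edges stay connected to the picked one. -/
theorem reachable_of_active_insert {a x : HalfEdge d} {c : Bool} {u : Fin n} {m r A}
    (hpick : ∀ g, Active ⟨m, r, A⟩ g →
      (skeleton (r : Set (Sym2 (HalfEdge d)))).Reachable u g.1)
    (ha : c = true → ∀ R : Set (Sym2 (HalfEdge d)), (r : Set (Sym2 (HalfEdge d))) ⊆ R →
      s(a, x) ∈ R → (skeleton R).Reachable u a.1) {A' : Finset (HalfEdge d)} :
    ∀ g, Active (⟨insert s(a, x) m, if c then insert s(a, x) r else r, A'⟩ : Exploration d) g →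
      (skeleton ((if c then insert s(a, x) r else r : Finset _) :
        Set (Sym2 (HalfEdge d)))).Reachable u g.1 := by
  rintro g ⟨hg1, hg2⟩
  rw [matched_insert, not_or, not_or] at hg1
  cases c with
  | false => exact hpick g ⟨hg1.2.2, by simpa using hg2⟩
  | true =>
    simp only [if_true] at hg2 ⊢
    have hsub : (r : Set (Sym2 (HalfEdge d))) ⊆ ↑(insert s(a, x) r) := by
      simp
    have hmem : s(a, x) ∈ ((insert s(a, x) r : Finset _) : Set (Sym2 (HalfEdge d))) := by simp
    rcases found_insert.1 hg2 with h | h | h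
    · rw [h]; exact ha rfl _ hsub hmem
    · rw [h]; exact (ha rfl _ hsub hmem).trans (reachable_of_mem hmem)
    · exact (hpick g ⟨hg1.2.2, h⟩).mono (skeleton_mono hsub)

theorem invariant_zero : Invariant Q ω 0 (⟨∅, ∅, ∅⟩ : Exploration d) where
  found := fun v ⟨e, he, _⟩ => by simp at he
  matched := fun h ⟨e, he, _⟩ => by simp at he
  source := fun a ha => by simp at ha
  source_matched := fun a ha => by simp at ha
  card_A := rfl
  sub := le_rfl
  card_m := by simp
  card_r := by simp
  connected := fun h h' ⟨_, ⟨e, he, _⟩⟩ => by simp at he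

theorem Invariant.step {i : Fin K} (I : Invariant Q ω i st) :
    Invariant Q ω (i + 1) (advance Q st (ω i)) := by
  rcases advance_cases Q st (ω i) with ⟨hst, -⟩ | ⟨a, ha, hx, hxa, hst⟩
  · rw [hst]
    exact
    { found := fun v hv => (I.found v hv).imp_left fun h => covered_mono (by omega) h
      matched := fun h hh => (I.matched h hh).imp_right fun ⟨j, hj, e⟩ => ⟨j, by omega, e⟩
      source := I.source
      source_matched := I.source_matched
      card_A := I.card_A
      sub := I.sub
      card_m := I.card_m.trans (by omega)
      card_r := I.card_r.trans (Finset.card_le_card (coins_mono (by omega)))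
      connected := I.connected }
  · have hps := pick_eq_some ha
    have hr : st.r ⊆ if (ω i).2 then insert s(a, (ω i).1) st.r else st.r := by
      split_ifs <;> simp
    have hnotm : s(a, (ω i).1) ∉ st.m := fun h => hps.1 ⟨_, h, by simp⟩
    rw [hst]
    refine ⟨?_, ?_, ?_, ?_, ?_, ?_, ?_, ?_, ?_⟩
    · intro v hv
      have hold : ∀ v, Found st.r v → v ∈ covered ω (i + 1) ∨
          v ∈ seedVertices Q (if (ω i).2 then insert s(a, (ω i).1) st.r else st.r) := fun v hv =>
        (I.found v hv).imp (fun h => covered_mono (by omega) h) fun h => seedVertices_mono hr h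
      cases hc : (ω i).2 with
      | false => simp only [hc] at hv hold ⊢; exact hold v hv
      | true =>
        simp only [hc, if_true] at hv hold ⊢
        rcases found_insert.1 hv with h | h | h
        · rcases hps.2 with h2 | h2
          · rw [h]; exact hold _ h2.2
          · right; rw [mem_seedVertices]
            exact ⟨a, h2.2, h.symm, _, Finset.mem_insert_self _ _, by simp⟩
        · left; rw [mem_covered]; exact ⟨i, by omega, hc, h.symm⟩
        · exact hold v h
    · intro h hh
      rcases matched_insert.1 hh with h1 | h1 | h1
      · left; simp [h1]
      · right; exact ⟨i, by omega, h1.symm⟩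
      · rcases I.matched h h1 with h2 | ⟨j, hj, h2⟩
        · left; simp [h2]
        · right; exact ⟨j, by omega, h2⟩
    · intro b hb
      rcases Finset.mem_insert.1 hb with rfl | hb
      · rcases hps.2 with h2 | h2
        · right; exact h2.2.mono hr
        · left; exact h2.2
      · exact (I.source b hb).imp_right fun h => h.mono hr
    · intro b hb
      rcases Finset.mem_insert.1 hb with rfl | hb
      · exact ⟨_, Finset.mem_insert_self _ _, by simp⟩
      · exact (I.source_matched b hb).mono (Finset.subset_insert _ _)
    · have : a ∉ st.A := fun h => hps.1 (I.source_matched a h)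
      simp only
      rw [Finset.card_insert_of_notMem this, Finset.card_insert_of_notMem hnotm, I.card_A]
    · simp only
      split_ifs
      · exact Finset.insert_subset_insert _ I.sub
      · exact I.sub.trans (Finset.subset_insert _ _)
    · simp only
      rw [Finset.card_insert_of_notMem hnotm]
      exact Nat.add_le_add_right I.card_m 1
    · simp only
      split_ifs with hc
      · refine (Finset.card_insert_le _ _).trans ?_
        have hi : i ∉ coins ω i := by simp [mem_coins]
        have hsub : insert i (coins ω i) ⊆ coins ω (i + 1) := by
          rw [Finset.insert_subset_iff]
          exact ⟨mem_coins.2 ⟨by omega, hc⟩, coins_mono (by omega)⟩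
        have := Finset.card_le_card hsub
        rw [Finset.card_insert_of_notMem hi] at this
        have := I.card_r
        omega
      · exact I.card_r.trans (Finset.card_le_card (coins_mono (by omega)))
    -- All active half-edges are connected to the source `a`: it was either active itself, or a seed
    -- taken when nothing was active, in which case the only active half-edges afterwards come from
    -- the new edge.
    · have key : ∀ g, Active (⟨insert s(a, (ω i).1) st.m,
          if (ω i).2 then insert s(a, (ω i).1) st.r else st.r, insert a st.A⟩ : Exploration d) g →
          (skeleton ((if (ω i).2 then insert s(a, (ω i).1) st.r else st.r : Finset _) :
            Set (Sym2 (HalfEdge d)))).Reachable a.1 g.1 := by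
        refine reachable_of_active_insert (A := st.A) ?_ fun _ R _ _ => SimpleGraph.Reachable.refl _
        intro g hg
        rcases hps.2 with h2 | h2
        · exact I.connected a g h2 hg
        · exact absurd hg (h2.1 g)
      intro h h' hh hh'
      exact (key h hh).symm.trans (key h' hh')

theorem invariant_run : ∀ {k : ℕ}, k ≤ K → Invariant Q ω k (run Q ω k)
  | 0, _ => invariant_zero
  | k + 1, hk => by
    have := (invariant_run (k := k) (by omega)).step (i := ⟨k, hk⟩)
    have h2 := run_succ (Q := Q) (ω := ω) ⟨k, hk⟩
    simp only at h2 this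
    rwa [h2]

theorem run_r_mono_step (i : Fin K) : (run Q ω i).r ⊆ (run Q ω (i + 1)).r := by
  rw [run_succ]
  rcases advance_cases Q (run Q ω i) (ω i) with ⟨hst, -⟩ | ⟨a, ha, hx, hxa, hst⟩ <;> rw [hst]
  simp only
  split_ifs
  · exact Finset.subset_insert _ _
  · exact le_rfl

theorem run_r_mono {k k' : ℕ} (h : k ≤ k') (hk : k' ≤ K) : (run Q ω k).r ⊆ (run Q ω k').r := by
  induction k', h using Nat.le_induction with
  | base => exact le_rfl
  | succ j hj ih => exact (ih (by omega)).trans (run_r_mono_step ⟨j, hk⟩)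

/-- Once there is nothing to explore, the exploration is finished. -/
theorem pick_run_none_mono {k k' : ℕ} (h : k ≤ k') (hk : k' ≤ K)
    (hn : pick Q (run Q ω k) = none) : run Q ω k' = run Q ω k := by
  induction k', h using Nat.le_induction with
  | base => rfl
  | succ j hj ih =>
    have h1 := ih (by omega)
    have h2 := run_succ (Q := Q) (ω := ω) ⟨j, hk⟩
    simp only at h2
    rw [h2, h1]
    simp [advance, hn]

/-- `condP` is a quotient by the number of extensions, so a sure event has conditional probability
one only if an extension exists. -/
theorem extensions_run_nonempty (hne : Nonempty (Pairing (HalfEdge d))) :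
    ∀ {k : ℕ}, k ≤ K → (extensions (run Q ω k).m).Nonempty
  | 0, _ => by
    obtain ⟨f⟩ := hne
    exact ⟨f, by simp [mem_extensions, run]⟩
  | k + 1, hk => by
    have ih := extensions_run_nonempty hne (k := k) (by omega)
    have h2 := run_succ (Q := Q) (ω := ω) ⟨k, hk⟩
    simp only at h2
    rw [h2]
    rcases advance_cases Q (run Q ω k) (ω ⟨k, hk⟩) with ⟨hst, -⟩ | ⟨a, ha, hx, hxa, hst⟩
    · rwa [hst]
    · rw [hst]
      refine extensions_insert_nonempty (fun e he hae => (pick_eq_some ha).1 ⟨e, he, hae⟩) ?_ ih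
      simp only [partners, Finset.mem_filter, Finset.mem_univ, true_and]
      exact ⟨fun e he hxe => hx ⟨e, he, hxe⟩, hxa⟩

/-- While the exploration is not finished, all samples without collision are used. -/
theorem unfinished_bounds : ∀ {k : ℕ}, k ≤ K → (∀ i < k, pick Q (run Q ω i) ≠ none) →
    k ≤ (run Q ω k).m.card + ((collisions Q ω).filter fun i : Fin K => (i : ℕ) < k).card ∧
    (coins ω k).card ≤ (run Q ω k).r.card +
      ((coinCollisions Q ω).filter fun i : Fin K => (i : ℕ) < k).card ∧
    ∀ v ∈ covered ω k, Found (run Q ω k).r v ∨ v ∈ spoiled Q ω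
  | 0, _, _ => by
    refine ⟨by simp, by simp [coins], fun v hv => ?_⟩
    simp [mem_covered] at hv
  | k + 1, hk, hp => by
    obtain ⟨h1, h2, h3⟩ := unfinished_bounds (k := k) (by omega) fun i hi => hp i (by omega)
    have I := invariant_run (Q := Q) (ω := ω) (k := k) (by omega)
    set i : Fin K := ⟨k, hk⟩ with hi
    have hIi : Invariant Q ω (i : ℕ) (run Q ω k) := I
    have hrs : run Q ω (k + 1) = advance Q (run Q ω k) (ω i) := run_succ i
    have hcoins : (coins ω (k + 1)).card ≤ (coins ω k).card + if (ω i).2 then 1 else 0 := by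
      have hsub : coins ω (k + 1) ⊆ if (ω i).2 then insert i (coins ω k) else coins ω k := by
        intro j hj
        rw [mem_coins] at hj
        by_cases hjk : (j : ℕ) < k
        · split_ifs <;> simp [mem_coins, hjk, hj.2]
        · have : j = i := Fin.ext (by simp [hi]; omega)
          subst this
          simp [hj.2]
      refine (Finset.card_le_card hsub).trans ?_
      split_ifs
      · exact Finset.card_insert_le _ _
      · simp
    have hcov : ∀ v ∈ covered ω (k + 1), v ∈ covered ω k ∨ ((ω i).2 = true ∧ (ω i).1.1 = v) := by
      intro v hv
      obtain ⟨j, hj, hc, hv⟩ := mem_covered.1 hv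
      by_cases hjk : (j : ℕ) < k
      · left; exact mem_covered.2 ⟨j, hjk, hc, hv⟩
      · have : j = i := Fin.ext (by simp [hi]; omega)
        subst this; exact Or.inr ⟨hc, hv⟩
    have hfil : ∀ S : Finset (Fin K), (S.filter fun j : Fin K => (j : ℕ) < k) ⊆
        S.filter fun j : Fin K => (j : ℕ) < k + 1 := fun S j hj => by
      simp only [Finset.mem_filter] at hj ⊢; exact ⟨hj.1, by omega⟩
    have hfil' : ∀ S : Finset (Fin K), i ∈ S → (S.filter fun j : Fin K => (j : ℕ) < k).card + 1 ≤
        (S.filter fun j : Fin K => (j : ℕ) < k + 1).card := fun S hS => by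
      have hni : i ∉ S.filter fun j : Fin K => (j : ℕ) < k := by simp [hi]
      rw [← Finset.card_insert_of_notMem hni]
      refine Finset.card_le_card ?_
      rw [Finset.insert_subset_iff]
      exact ⟨Finset.mem_filter.2 ⟨hS, by simp [hi]⟩, hfil S⟩
    have hg1 := Finset.card_le_card (hfil (collisions Q ω))
    have hg2 := Finset.card_le_card (hfil (coinCollisions Q ω))
    rw [hrs]
    rcases advance_cases Q (run Q ω k) (ω i) with ⟨hst, hn | ⟨a, ha, hrej⟩⟩ | ⟨a, ha, hx, hxa, hst⟩
    · exact absurd hn (hp k (by omega))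
    · have hcol := hIi.collides_of_rejected ha hrej
      rw [hst]
      refine ⟨?_, ?_, ?_⟩
      · have := hfil' (collisions Q ω) (by simp [collisions, hcol])
        omega
      · by_cases hc : (ω i).2 = true
        · have := hfil' (coinCollisions Q ω) (by simp [coinCollisions, hcol, hc])
          rw [if_pos hc] at hcoins
          omega
        · rw [if_neg hc] at hcoins
          omega
      · intro v hv
        rcases hcov v hv with h | ⟨hc, rfl⟩
        · exact h3 v h
        · rcases hIi.rejected ha hrej with h | h
          · exact Or.inl h
          · right; simp only [spoiled, Finset.mem_filter, Finset.mem_univ, true_and]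
            exact ⟨i, hc, rfl, h⟩
    · rw [hst]
      have hnotm : s(a, (ω i).1) ∉ (run Q ω k).m := fun h => (pick_eq_some ha).1 ⟨_, h, by simp⟩
      have hnotr : s(a, (ω i).1) ∉ (run Q ω k).r := fun h => hnotm (I.sub h)
      refine ⟨?_, ?_, ?_⟩
      · simp only
        rw [Finset.card_insert_of_notMem hnotm]
        omega
      · simp only
        split_ifs with hc
        · rw [if_pos hc] at hcoins
          rw [Finset.card_insert_of_notMem hnotr]
          omega
        · rw [if_neg hc] at hcoins
          omega
      · intro v hv
        rcases hcov v hv with h | ⟨hc, rfl⟩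
        · exact (h3 v h).imp_left fun h => h.mono (by simp only; split_ifs <;> simp)
        · left; simp only [hc, if_true]; exact found_insert.2 (Or.inr (Or.inl rfl))

/-- If the exploration is unfinished but has no active half-edge after `k` steps, then the volume
covered by the first `k` samples is small. -/
theorem vol_covered_le (hk : k ≤ K) (hp : ∀ i < k, pick Q (run Q ω i) ≠ none)
    (hact : ∀ h, ¬ Active (run Q ω k) h) :
    vol d (covered ω k) ≤ vol d (spoiled Q ω) + k + (coins ω K).card + (collisions Q ω).card := by
  classical
  have I := invariant_run (Q := Q) (ω := ω) hk
  obtain ⟨-, -, h3⟩ := unfinished_bounds (Q := Q) (ω := ω) hk hp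
  set st := run Q ω k with hst
  have h1 : vol d (covered ω k) ≤ vol d (spoiled Q ω) + vol d (foundSet st.r) := by
    refine (vol_mono fun v hv => ?_).trans (vol_union_le _ _)
    rcases h3 v hv with h | h
    · exact Finset.mem_union_right _ (by simpa [foundSet] using h)
    · exact Finset.mem_union_left _ h
  -- With nothing active, every half-edge at a found vertex is matched, hence a source or a sample.
  -- A sample at a found vertex that is not itself retained shares its vertex with another sample or
  -- a seed, so it collides.
  have h2 : vol d (foundSet st.r) ≤ st.A.card + ((coins ω K) ∪ collisions Q ω).card := by
    rw [← card_filter_fst_mem]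
    have hsub : (Finset.univ.filter fun h : HalfEdge d => h.1 ∈ foundSet st.r) ⊆
        st.A ∪ (coins ω K ∪ collisions Q ω).image fun i => (ω i).1 := by
      intro h hh
      have hf : Found st.r h.1 := by simpa [foundSet] using hh
      have hm : Matched st.m h := by
        by_contra hc
        exact hact h ⟨hc, hf⟩
      rcases I.matched h hm with h4 | ⟨i, hi, rfl⟩
      · exact Finset.mem_union_left _ h4
      · refine Finset.mem_union_right _ (Finset.mem_image_of_mem _ ?_)
        rcases I.found _ hf with h5 | h5
        · obtain ⟨j, hj, hc, hv⟩ := mem_covered.1 h5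
          by_cases hij : j = i
          · subst hij
            exact Finset.mem_union_left _ (mem_coins.2 ⟨j.2, hc⟩)
          · refine Finset.mem_union_right _ ?_
            simp only [collisions, Finset.mem_filter, Finset.mem_univ, true_and]
            exact Or.inl ⟨j, hij, hv⟩
        · obtain ⟨g, hg, hv, -⟩ := mem_seedVertices.1 h5
          refine Finset.mem_union_right _ ?_
          simp only [collisions, Finset.mem_filter, Finset.mem_univ, true_and]
          exact Or.inr ⟨g, hg, hv⟩
    exact (Finset.card_le_card hsub).trans ((Finset.card_union_le _ _).trans
      (Nat.add_le_add_left Finset.card_image_le _))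
  have h4 := Finset.card_union_le (coins ω K) (collisions Q ω)
  have h5 := I.card_A
  have h6 := I.card_m
  omega

/-- If the exploration is not finished after `K` steps, then `K` is small. -/
theorem le_of_unfinished (hp : ∀ i < K, pick Q (run Q ω i) ≠ none) :
    K ≤ Q.card + vol d (covered ω K) + vol d (seedVertices Q (run Q ω K).r) +
      (collisions Q ω).card := by
  classical
  have I := invariant_run (Q := Q) (ω := ω) le_rfl
  obtain ⟨h1, -, -⟩ := unfinished_bounds (Q := Q) (ω := ω) le_rfl hp
  have h2 := Finset.card_filter_le (collisions Q ω) fun i : Fin K => (i : ℕ) < K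
  have h3 : (run Q ω K).A.card ≤ Q.card + vol d (foundSet (run Q ω K).r) := by
    rw [← card_filter_fst_mem]
    refine (Finset.card_le_card fun a ha => ?_).trans (Finset.card_union_le _ _)
    rcases I.source a ha with h | h
    · exact Finset.mem_union_left _ h
    · exact Finset.mem_union_right _ (by simpa [foundSet] using h)
  have h4 : vol d (foundSet (run Q ω K).r) ≤
      vol d (covered ω K) + vol d (seedVertices Q (run Q ω K).r) := by
    refine (vol_mono fun v hv => ?_).trans (vol_union_le _ _)
    exact Finset.mem_union.2 (I.found v (by simpa [foundSet] using hv))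
  have h5 := I.card_A
  omega

/-- The exploration does not finish before half of the number of seeds. -/
theorem card_seeds_le (hk : k ≤ K) (hp : pick Q (run Q ω k) = none) : Q.card ≤ 2 * k := by
  classical
  have I := invariant_run (Q := Q) (ω := ω) hk
  -- At the end all seeds are matched, and each of the `k` steps contributes at most one source and
  -- one sample.
  have hsub : Q ⊆ (run Q ω k).A ∪
      (Finset.univ.filter fun i : Fin K => (i : ℕ) < k).image fun i => (ω i).1 := by
    intro h hh
    rcases I.matched h ((pick_eq_none hp).2 h hh) with h | ⟨i, hi, rfl⟩
    · exact Finset.mem_union_left _ h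
    · exact Finset.mem_union_right _ (Finset.mem_image_of_mem _ (by simpa using hi))
  have h1 := (Finset.card_le_card hsub).trans (Finset.card_union_le _ _)
  have h2 : ((Finset.univ.filter fun i : Fin K => (i : ℕ) < k).image fun i => (ω i).1).card ≤ k := by
    refine Finset.card_image_le.trans ?_
    have : (Finset.univ.filter fun i : Fin K => (i : ℕ) < k).card ≤ (Finset.range k).card :=
      Finset.card_le_card_of_injOn (fun i => (i : ℕ)) (fun i hi => by simpa using hi)
        (fun i _ j _ h => Fin.ext h)
    simpa using this
  have h3 := I.card_A
  have h4 := I.card_m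
  omega

/-- As long as there are active half-edges, everything found is in the same component. -/
theorem reachable_window {k₁ : ℕ} {h : HalfEdge d} (hh : Active (run Q ω k₁) h) {k₂ : ℕ}
    (h12 : k₁ ≤ k₂) (hk : k₂ ≤ K) (hact : ∀ k, k₁ ≤ k → k < k₂ → ∃ g, Active (run Q ω k) g) :
    (∀ e ∈ (run Q ω k₂).r, e ∉ (run Q ω k₁).r → ∀ g ∈ e,
      (skeleton ((run Q ω k₂).r : Set (Sym2 (HalfEdge d)))).Reachable h.1 g.1) ∧
    (∀ i : Fin K, k₁ ≤ i → (i : ℕ) < k₂ → (ω i).2 = true → ¬ Collides Q ω i →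
      (skeleton ((run Q ω k₂).r : Set (Sym2 (HalfEdge d)))).Reachable h.1 (ω i).1.1) ∧
    ∀ g, Active (run Q ω k₂) g →
      (skeleton ((run Q ω k₂).r : Set (Sym2 (HalfEdge d)))).Reachable h.1 g.1 := by
  induction k₂, h12 using Nat.le_induction with
  | base =>
    refine ⟨fun e he hne => absurd he hne, fun i h1 h2 => by omega, fun g hg => ?_⟩
    exact (invariant_run (by omega)).connected h g hh hg
  | succ k hk1 ih =>
    obtain ⟨i1, i2, i3⟩ := ih (by omega) fun j hj hjk => hact j hj (by omega)
    set i : Fin K := ⟨k, hk⟩ with hi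
    have I : Invariant Q ω (i : ℕ) (run Q ω k) := invariant_run (by omega)
    have hrs : run Q ω (k + 1) = advance Q (run Q ω k) (ω i) := run_succ i
    have hmono : ((run Q ω k).r : Set (Sym2 (HalfEdge d))) ⊆ (run Q ω (k + 1)).r := by
      exact_mod_cast run_r_mono_step i
    obtain ⟨g0, hg0⟩ := hact k hk1 (by omega)
    have hlt : ∀ j : Fin K, (j : ℕ) < k + 1 → (j : ℕ) < k ∨ j = i := fun j hj => by
      by_cases h : (j : ℕ) < k
      · exact Or.inl h
      · exact Or.inr (Fin.ext (by simp [hi]; omega))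
    rcases advance_cases Q (run Q ω k) (ω i) with ⟨hst, hn | ⟨a, ha, hrej⟩⟩ | ⟨a, ha, hx, hxa, hst⟩
    · exact absurd hg0 ((pick_eq_none hn).1 g0)
    · rw [hrs, hst]
      refine ⟨i1, fun j hj1 hj2 hc hcol => ?_, i3⟩
      rcases hlt j hj2 with h | rfl
      · exact i2 j hj1 h hc hcol
      · exact absurd (I.collides_of_rejected ha hrej) hcol
    -- Active half-edges take precedence over seeds, so within the window no new component is
    -- started.
    · have haa : Active (run Q ω k) a := by
        rcases (pick_eq_some ha).2 with h | h
        · exact h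
        · exact absurd hg0 (h.1 g0)
      have hra := (i3 a haa).mono (skeleton_mono hmono)
      have hmem : (ω i).2 = true → s(a, (ω i).1) ∈ ((run Q ω (k + 1)).r : Set (Sym2 (HalfEdge d))) := by
        intro hc; rw [hrs, hst]; simp [hc]
      refine ⟨?_, ?_, ?_⟩
      · intro e he hne g hg
        by_cases hek : e ∈ (run Q ω k).r
        · exact (i1 e hek hne g hg).mono (skeleton_mono hmono)
        · have hc : (ω i).2 = true := by
            by_contra hc
            rw [hrs, hst] at he
            simp only [hc] at he
            exact hek (by simpa using he)
          have hee : e = s(a, (ω i).1) := by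
            rw [hrs, hst] at he
            simp only [hc, if_true, Finset.mem_insert] at he
            exact he.resolve_right hek
          subst hee
          rcases Sym2.mem_iff.1 hg with rfl | rfl
          · exact hra
          · exact hra.trans (reachable_of_mem (hmem hc))
      · intro j hj1 hj2 hc hcol
        rcases hlt j hj2 with h | rfl
        · exact (i2 j hj1 h hc hcol).mono (skeleton_mono hmono)
        · exact hra.trans (reachable_of_mem (hmem hc))
      · rw [hrs, hst]
        refine reachable_of_active_insert (A := (run Q ω k).A) i3 ?_
        intro hc R hR _
        exact (i3 a haa).mono (skeleton_mono hR)

end Invariants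

end ConfigModel

end

noncomputable section

namespace ConfigModel

/-! ### Components of the retained multigraph and the component seen in the active window -/

section Components

variable {n : ℕ} {d : Fin n → ℕ}

/-- The edges of a component. -/
def componentEdges (R : Set (Sym2 (HalfEdge d))) (C : Component R) : Set (Sym2 (HalfEdge d)) :=
  {e ∈ R | ∀ h ∈ e, h.1 ∈ C.supp}

theorem edgeCount_eq (R : Set (Sym2 (HalfEdge d))) (C : Component R) :
    edgeCount R C = (componentEdges R C).ncard := rfl

theorem fst_mem_supp_of_mem {R : Set (Sym2 (HalfEdge d))} {C : Component R} {e : Sym2 (HalfEdge d)}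
    (he : e ∈ R) {g h : HalfEdge d} (hg : g ∈ e) (hh : h ∈ e) (hgC : g.1 ∈ C.supp) :
    h.1 ∈ C.supp := by
  rw [SimpleGraph.ConnectedComponent.mem_supp_iff] at hgC ⊢
  rw [← hgC, SimpleGraph.ConnectedComponent.eq]
  by_cases hgh : g = h
  · rw [hgh]
  · have : e = s(h, g) := ((Sym2.mem_and_mem_iff (Ne.symm hgh)).1 ⟨hh, hg⟩)
    exact reachable_of_mem (this ▸ he)

theorem mem_componentEdges {R : Set (Sym2 (HalfEdge d))} {C : Component R} {e : Sym2 (HalfEdge d)}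
    (he : e ∈ R) {g : HalfEdge d} (hg : g ∈ e) (hgC : g.1 ∈ C.supp) : e ∈ componentEdges R C :=
  ⟨he, fun _ hh => fst_mem_supp_of_mem he hg hh hgC⟩

theorem componentEdges_disjoint {R : Set (Sym2 (HalfEdge d))} {C C' : Component R} (hC : C ≠ C') :
    Disjoint (componentEdges R C) (componentEdges R C') := by
  rw [Set.disjoint_left]
  intro e h1 h2
  induction e using Sym2.ind with
  | _ a b =>
    have h3 := h1.2 a (by simp)
    have h4 := h2.2 a (by simp)
    rw [SimpleGraph.ConnectedComponent.mem_supp_iff] at h3 h4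
    exact hC (h3.symm.trans h4)

/-- A component has at most one more vertex than edges. -/
theorem ncard_supp_le (R : Set (Sym2 (HalfEdge d))) (C : Component R) :
    C.supp.ncard ≤ edgeCount R C + 1 := by
  classical
  have h1 := C.connected_toSimpleGraph.card_vert_le_card_edgeSet_add_one
  have hN : Nat.card C = C.supp.ncard := rfl
  rw [hN] at h1
  refine h1.trans (Nat.add_le_add_right ?_ 1)
  -- Each edge of the simple graph lifts to a multigraph edge of the component, and the lift is
  -- injective because it is a section of the projection; then the tree bound for connected simple
  -- graphs applies.
  have hex : ∀ e : C.toSimpleGraph.edgeSet, ∃ e' ∈ componentEdges R C,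
      Sym2.map Sigma.fst e' = Sym2.map Subtype.val (e : Sym2 C) := by
    rintro ⟨e, he⟩
    induction e using Sym2.ind with
    | _ a b =>
      rw [SimpleGraph.mem_edgeSet] at he
      have hadj : (skeleton R).Adj a.1 b.1 := he
      unfold skeleton at hadj
      rw [SimpleGraph.fromEdgeSet_adj] at hadj
      obtain ⟨⟨e', he', hee⟩, -⟩ := hadj
      refine ⟨e', ?_, by simpa using hee⟩
      have : a.1 ∈ Sym2.map Sigma.fst e' := by rw [hee]; simp
      obtain ⟨g, hg, hga⟩ := Sym2.mem_map.1 this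
      exact mem_componentEdges he' hg (by rw [hga]; exact a.2)
  choose F hF1 hF2 using hex
  rw [edgeCount_eq, ← Nat.card_coe_set_eq]
  refine Nat.card_le_card_of_injective (fun e => (⟨F e, hF1 e⟩ : componentEdges R C)) ?_
  intro e e' h
  have h3 : F e = F e' := congrArg Subtype.val h
  apply Subtype.ext
  apply Sym2.map.injective Subtype.val_injective
  rw [← hF2, ← hF2, h3]

variable {K : ℕ} {Q : Finset (HalfEdge d)} {ω : Fin K → HalfEdge d × Bool}

/-- After the exploration has finished, the component of a found vertex consists of explored
edges. -/
theorem componentEdges_subset_of_found {st : Exploration d} {f : Pairing (HalfEdge d)}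
    {R' : Finset (Sym2 (HalfEdge d))}
    (hfin : pick Q st = none) (hf : f ∈ extensions st.m) (hR' : R' ⊆ f.edgeFinset \ st.m) :
    (∀ e ∈ (↑(st.r ∪ R') : Set (Sym2 (HalfEdge d))), ∀ g ∈ e, g ∈ Q → e ∈ st.r) ∧
    ∀ C : Component (↑(st.r ∪ R') : Set (Sym2 (HalfEdge d))),
      (∃ v ∈ C.supp, Found st.r v) → componentEdges _ C ⊆ st.r := by
  rw [mem_extensions] at hf
  set R : Set (Sym2 (HalfEdge d)) := ↑(st.r ∪ R') with hR
  -- In a matching each half-edge lies on one edge only. If that edge has been revealed, its coin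
  -- has been revealed too.
  have hmatch : ∀ e ∈ R, ∀ g ∈ e, Matched st.m g → e ∈ st.r := by
    rintro e he g hg ⟨e', he', hg'⟩
    rw [hR, Finset.mem_coe, Finset.mem_union] at he
    rcases he with he | he
    · exact he
    · have h1 := Finset.mem_sdiff.1 (hR' he)
      have : e = e' := f.edge_unique h1.1 (hf he') hg hg'
      exact absurd (this ▸ he') h1.2
  have hfound : ∀ e ∈ R, ∀ g ∈ e, Found st.r g.1 → e ∈ st.r := by
    intro e he g hg hgf
    refine hmatch e he g hg ?_
    by_contra hc
    exact (pick_eq_none hfin).1 g ⟨hc, hgf⟩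
  refine ⟨fun e he g hg hgQ => hmatch e he g hg ((pick_eq_none hfin).2 g hgQ), ?_⟩
  rintro C ⟨v, hv, hvf⟩ e ⟨he, hesupp⟩
  -- Being found propagates along retained edges: no half-edge at a found vertex is active any more,
  -- so its edge is a revealed one.
  have hall : ∀ w, (skeleton R).Reachable v w → Found st.r w := by
    intro w hw
    rw [SimpleGraph.reachable_iff_reflTransGen] at hw
    induction hw with
    | refl => exact hvf
    | tail _ hadj ih =>
      unfold skeleton at hadj
      rw [SimpleGraph.fromEdgeSet_adj] at hadj
      obtain ⟨⟨e', he', hee⟩, -⟩ := hadj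
      rename_i b c _
      obtain ⟨g, hg, hga⟩ := Sym2.mem_map.1 (show b ∈ Sym2.map Sigma.fst e' by rw [hee]; simp)
      obtain ⟨g', hg', hga'⟩ := Sym2.mem_map.1 (show c ∈ Sym2.map Sigma.fst e' by rw [hee]; simp)
      exact ⟨e', hfound e' he' g hg (hga ▸ ih), g', hg', hga'⟩
  induction e using Sym2.ind with
  | _ a b =>
    refine hfound _ he a (by simp) (hall _ ?_)
    have h1 := hesupp a (by simp)
    rw [SimpleGraph.ConnectedComponent.mem_supp_iff] at h1 hv
    rw [← SimpleGraph.ConnectedComponent.eq, h1, hv]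

/-- The giant component seen by an exploration that finishes and has active half-edges during
`[k₁, k₂]`. -/
theorem exists_component_of_window {k₁ k₂ : ℕ} (h12 : k₁ ≤ k₂) (hk : k₂ ≤ K)
    (hact : ∀ k, k₁ ≤ k → k ≤ k₂ → ∃ g, Active (run Q ω k) g)
    (hfin : pick Q (run Q ω K) = none) {f : Pairing (HalfEdge d)} {R' : Finset (Sym2 (HalfEdge d))}
    (hf : f ∈ extensions (run Q ω K).m) (hR' : R' ⊆ f.edgeFinset \ (run Q ω K).m) :
    ∃ C : Component (↑((run Q ω K).r ∪ R') : Set (Sym2 (HalfEdge d))),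
      (coins ω k₂).card ≤ edgeCount _ C + (coins ω k₁).card + (coinCollisions Q ω).card ∧
      edgeCount _ C ≤ (coins ω K).card ∧
      (coins ω k₂).card ≤ C.supp.ncard + (coins ω k₁).card + (coinCollisions Q ω).card ∧
      ∀ C', C' ≠ C → (∃ g ∈ Q, ∃ e ∈ (↑((run Q ω K).r ∪ R') : Set (Sym2 (HalfEdge d))),
        g ∈ e ∧ g.1 ∈ C'.supp) →
        edgeCount _ C' + (coins ω k₂).card ≤
          (coins ω K).card + (coins ω k₁).card + (coinCollisions Q ω).card := by
  classical
  -- A finished exploration never moves again, so finishing at time `i` would leave no active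
  -- half-edge at time `max i k₁`, which lies in the window.
  have hunf : ∀ i < k₂, pick Q (run Q ω i) ≠ none := by
    intro i hi hn
    obtain ⟨g, hg⟩ := hact (max i k₁) (le_max_right _ _) (max_le hi.le h12)
    rw [pick_run_none_mono (le_max_left i k₁) (by omega) hn] at hg
    exact (pick_eq_none hn).1 g hg
  obtain ⟨-, hr2, -⟩ := unfinished_bounds hk hunf
  have hr2' := Finset.card_filter_le (coinCollisions Q ω) fun i : Fin K => (i : ℕ) < k₂
  have hr1 := (invariant_run (Q := Q) (ω := ω) (h12.trans hk)).card_r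
  have IK := invariant_run (Q := Q) (ω := ω) (le_refl K)
  have hrK := IK.card_r
  obtain ⟨h, hh⟩ := hact k₁ le_rfl h12
  obtain ⟨w1, w2, -⟩ := reachable_window hh h12 hk fun k a b => hact k a b.le
  obtain ⟨hseed, hcomp⟩ := componentEdges_subset_of_found hfin hf hR'
  have hmono1 : (run Q ω k₁).r ⊆ (run Q ω K).r := run_r_mono (h12.trans hk) le_rfl
  have hmono12 : (run Q ω k₁).r ⊆ (run Q ω k₂).r := run_r_mono h12 hk
  have hmono2 : (run Q ω k₂).r ⊆ (run Q ω K).r := run_r_mono hk le_rfl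
  set R : Set (Sym2 (HalfEdge d)) := ↑((run Q ω K).r ∪ R') with hR
  have hrR : ((run Q ω k₂).r : Set (Sym2 (HalfEdge d))) ⊆ R := by
    rw [hR]; exact_mod_cast hmono2.trans Finset.subset_union_left
  let C : Component R := (skeleton R).connectedComponentMk h.1
  have hC : ∀ v, (skeleton ((run Q ω k₂).r : Set (Sym2 (HalfEdge d)))).Reachable h.1 v →
      v ∈ C.supp := fun v hv => by
    rw [SimpleGraph.ConnectedComponent.mem_supp_iff, SimpleGraph.ConnectedComponent.eq]
    exact (hv.mono (skeleton_mono hrR)).symm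
  have hnew : ((run Q ω k₂).r \ (run Q ω k₁).r : Finset (Sym2 (HalfEdge d))) ≤
      (componentEdges R C).toFinset := by
    intro e he
    rw [Finset.mem_sdiff] at he
    rw [Set.mem_toFinset]
    exact ⟨hrR he.1, fun g hg => hC _ (w1 e he.1 he.2 g hg)⟩
  have hnewcard : ((run Q ω k₂).r \ (run Q ω k₁).r).card =
      (run Q ω k₂).r.card - (run Q ω k₁).r.card := Finset.card_sdiff_of_subset hmono12
  have hCsub : componentEdges R C ⊆ (run Q ω K).r :=
    hcomp C ⟨h.1, by simp [C], hh.2.mono hmono1⟩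
  refine ⟨C, ?_, ?_, ?_, ?_⟩
  · have h3 := Finset.card_le_card hnew
    rw [← Set.ncard_eq_toFinset_card', ← edgeCount_eq] at h3
    omega
  · rw [edgeCount_eq, Set.ncard_eq_toFinset_card']
    refine (Finset.card_le_card ?_).trans hrK
    intro e he
    exact hCsub (Set.mem_toFinset.1 he)
  · set S : Finset (Fin K) := Finset.univ.filter fun i =>
      k₁ ≤ (i : ℕ) ∧ (i : ℕ) < k₂ ∧ (ω i).2 = true ∧ ¬ Collides Q ω i with hS
    have h3 : coins ω k₂ ⊆ (S ∪ coins ω k₁) ∪ coinCollisions Q ω := by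
      intro i hi
      rw [mem_coins] at hi
      simp only [hS, Finset.mem_union, Finset.mem_filter, Finset.mem_univ, true_and, mem_coins,
        coinCollisions]
      by_cases hc : Collides Q ω i
      · exact Or.inr ⟨hc, hi.2⟩
      · by_cases hk1 : (i : ℕ) < k₁
        · exact Or.inl (Or.inr ⟨hk1, hi.2⟩)
        · exact Or.inl (Or.inl ⟨by omega, hi.1, hi.2, hc⟩)
    have h4 := (Finset.card_le_card h3).trans (Finset.card_union_le _ _)
    have h5 := Finset.card_union_le S (coins ω k₁)
    have h6 : S.card ≤ C.supp.ncard := by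
      rw [Set.ncard_eq_toFinset_card']
      refine Finset.card_le_card_of_injOn (fun i => (ω i).1.1) ?_ ?_
      · intro i hi
        simp only [hS, Finset.coe_filter, Finset.mem_univ, true_and, Set.mem_ofPred_eq] at hi
        simp only [Finset.mem_coe, Set.mem_toFinset]
        exact hC _ (w2 i hi.1 hi.2.1 hi.2.2.1 hi.2.2.2)
      · intro i _ j hj hij
        simp only [hS, Finset.coe_filter, Finset.mem_univ, true_and, Set.mem_ofPred_eq] at hj
        by_contra hne
        exact hj.2.2.2 (Or.inl ⟨i, hne, hij⟩)
    omega
  · rintro C' hC' ⟨g, hgQ, e, he, hge, hgC'⟩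
    have her := hseed e he g hge hgQ
    have hsub' := hcomp C' ⟨g.1, hgC', e, her, g, hge, rfl⟩
    -- A touched component has only explored edges, and being different from `C` it contains none of
    -- those found during the window.
    have h3 : (componentEdges R C').toFinset ⊆
        (run Q ω K).r \ ((run Q ω k₂).r \ (run Q ω k₁).r) := by
      intro e he
      rw [Set.mem_toFinset] at he
      refine Finset.mem_sdiff.2 ⟨hsub' he, fun hc => ?_⟩
      exact Set.disjoint_left.1 (componentEdges_disjoint hC') he (Set.mem_toFinset.1 (hnew hc))
    have h4 := Finset.card_le_card h3
    rw [Finset.card_sdiff_of_subset (Finset.sdiff_subset.trans hmono2), hnewcard,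
      ← Set.ncard_eq_toFinset_card', ← edgeCount_eq] at h4
    have h5 := Finset.card_le_card hmono2
    omega

end Components

end ConfigModel

end

noncomputable section

namespace ConfigModel

/-! ### Random seeds and reduction to properties of the exploration -/

section Seeds

variable {H : Type} [Fintype H] [DecidableEq H]

theorem condP_or_le {p : ℝ} (hp0 : 0 ≤ p) (hp1 : p ≤ 1) {B B₁ B₂ : Set (Sym2 H) → Prop}
    (h : ∀ R, B R → B₁ R ∨ B₂ R) (m r : Finset (Sym2 H)) :
    condP p B m r ≤ condP p B₁ m r + condP p B₂ m r := by
  classical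
  unfold condP
  rw [← add_div, ← Finset.sum_add_distrib]
  refine div_le_div_of_nonneg_right (Finset.sum_le_sum fun f _ => ?_) (Nat.cast_nonneg _)
  unfold coinAvg
  rw [← Finset.sum_add_distrib]
  refine Finset.sum_le_sum fun R _ => ?_
  rw [← mul_add]
  refine mul_le_mul_of_nonneg_left ?_ (mul_nonneg (pow_nonneg hp0 _) (pow_nonneg (by linarith) _))
  have := h ↑(r ∪ R)
  by_cases hB : B ↑(r ∪ R)
  · rw [if_pos hB]
    rcases this hB with h1 | h1
    · rw [if_pos h1]; split_ifs <;> norm_num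
    · rw [if_pos h1]; split_ifs <;> norm_num
  · rw [if_neg hB]; split_ifs <;> norm_num

/-- Exchange of the average over the seeds with the average over matchings and coins: it suffices to
bound the probability over the seeds for each fixed retained graph. -/
theorem iidE_condP_le {ι α : Type*} [Fintype ι] [DecidableEq ι] [Fintype α] {w : α → ℝ}
    {p c : ℝ} (hp0 : 0 ≤ p) (hp1 : p ≤ 1) (hc : 0 ≤ c) (B : (ι → α) → Set (Sym2 H) → Prop)
    (h : ∀ f : Pairing H, ∀ R ⊆ f.edgeFinset, iidP w (fun y => B y ↑R) ≤ c) :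
    iidE w (fun y => condP p (B y) ∅ ∅) ≤ c := by
  classical
  have hcoin : ∀ f : Pairing H, iidE w (fun y => coinAvg p (B y) (f.edgeFinset \ ∅) ∅) ≤ c := by
    intro f
    unfold coinAvg
    rw [iidE_sum]
    simp only [iidE_const_mul]
    have h1 : ∑ R ∈ (f.edgeFinset \ ∅).powerset,
        p ^ R.card * (1 - p) ^ ((f.edgeFinset \ ∅).card - R.card) * c = c := by
      rw [← Finset.sum_mul, Finset.sum_pow_mul_eq_add_pow]; simp
    rw [← h1]
    refine Finset.sum_le_sum fun R hR => mul_le_mul_of_nonneg_left ?_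
      (mul_nonneg (pow_nonneg hp0 _) (pow_nonneg (by linarith) _))
    have h2 := h f R ((Finset.mem_powerset.1 hR).trans Finset.sdiff_subset)
    refine le_of_eq_of_le ?_ h2
    unfold iidP
    congr 1; funext y
    rw [Finset.empty_union]
  unfold condP
  simp only [div_eq_inv_mul]
  rw [iidE_const_mul, iidE_sum, ← div_eq_inv_mul]
  refine div_le_of_le_mul₀ (Nat.cast_nonneg _) hc ?_
  refine (Finset.sum_le_card_nsmul _ _ c fun f _ => hcoin f).trans ?_
  rw [nsmul_eq_mul, mul_comm]

/-- The law of a coin with success probability `η`. -/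
def coinWeight (η : ℝ) (b : Bool) : ℝ := if b then η else 1 - η

theorem isWeight_coinWeight {η : ℝ} (h0 : 0 ≤ η) (h1 : η ≤ 1) : IsWeight (coinWeight η) :=
  ⟨fun b => by unfold coinWeight; split_ifs <;> linarith, by simp [coinWeight]⟩

/-- The random set of seeds. -/
def seedSet (y : H → Bool) : Finset H := Finset.univ.filter fun h => y h = true

theorem mem_seedSet {y : H → Bool} {h : H} : h ∈ seedSet y ↔ y h = true := by simp [seedSet]

theorem iidP_mem_seedSet {η : ℝ} (h0 : 0 ≤ η) (h1 : η ≤ 1) (h : H) :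
    iidP (coinWeight η) (fun y : H → Bool => h ∈ seedSet y) = η := by
  have := iidE_coord (isWeight_coinWeight h0 h1) h (fun b : Bool => if b then (1 : ℝ) else 0)
  simp only [Fintype.univ_bool, coinWeight] at this
  simp only [iidP, mem_seedSet]
  convert this using 3
  simp

/-- The probability that the seeds miss a given set. -/
theorem iidP_seedSet_disjoint_le {η : ℝ} (h0 : 0 ≤ η) (h1 : η ≤ 1) (S : Finset H) :
    iidP (coinWeight η) (fun y : H → Bool => ∀ h ∈ S, h ∉ seedSet y) ≤ Real.exp (-(η * S.card)) := by
  have h2 := iidE_prod_subset (isWeight_coinWeight h0 h1) S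
    (fun b : Bool => if b then (0 : ℝ) else 1)
  have h3 : ∑ b, coinWeight η b * (if b then (0 : ℝ) else 1) = 1 - η := by simp [coinWeight]
  rw [h3] at h2
  have h4 : iidP (coinWeight η) (fun y : H → Bool => ∀ h ∈ S, h ∉ seedSet y) =
      (1 - η) ^ S.card := by
    rw [← h2]
    unfold iidP
    congr 1; funext y
    split_ifs with hy
    · rw [Finset.prod_eq_one]
      intro h hS
      have := hy h hS
      rw [mem_seedSet] at this
      simp [this]
    · push Not at hy
      obtain ⟨h, hS, hh⟩ := hy
      rw [mem_seedSet] at hh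
      exact (Finset.prod_eq_zero hS (by simp [hh])).symm
  rw [h4]
  have h5 : 1 - η ≤ Real.exp (-η) := by linarith [Real.add_one_le_exp (-η)]
  calc (1 - η) ^ S.card ≤ Real.exp (-η) ^ S.card := pow_le_pow_left₀ (by linarith) h5 _
    _ = Real.exp (-(η * S.card)) := by rw [← Real.exp_nat_mul]; congr 1; ring

end Seeds

/-! ### From a successful exploration to a unique giant -/

section Reduction

variable {n : ℕ} {d : Fin n → ℕ}

/-- There is a component with numbers of edges and vertices at least `lo` and with at most `hi`
edges, and all other components have at most `x` edges. -/
def HasGiant (lo hi x : ℝ) (R : Set (Sym2 (HalfEdge d))) : Prop :=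
  ∃ C : Component R, lo ≤ edgeCount R C ∧ (edgeCount R C : ℝ) ≤ hi ∧ lo ≤ C.supp.ncard ∧
    ∀ C', C' ≠ C → (edgeCount R C' : ℝ) ≤ x

/-- The seeds meet a retained edge of the component `C`. -/
def Touches (Q : Finset (HalfEdge d)) (R : Set (Sym2 (HalfEdge d))) (C : Component R) : Prop :=
  ∃ g ∈ Q, ∃ e ∈ R, g ∈ e ∧ g.1 ∈ C.supp

/-- The exploration reveals a giant component. -/
def Succeeds {K : ℕ} (lo hi x : ℝ) (Q : Finset (HalfEdge d)) (ω : Fin K → HalfEdge d × Bool) :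
    Prop :=
  pick Q (run Q ω K) = none ∧ ∃ k₁ k₂, k₁ ≤ k₂ ∧ k₂ ≤ K ∧
    (∀ k, k₁ ≤ k → k ≤ k₂ → ∃ g, Active (run Q ω k) g) ∧
    lo + (coins ω k₁).card + (coinCollisions Q ω).card ≤ (coins ω k₂).card ∧
    ((coins ω K).card : ℝ) ≤ hi ∧
    ((coins ω K).card : ℝ) + (coins ω k₁).card + (coinCollisions Q ω).card ≤
      x + (coins ω k₂).card

theorem iidP_not_touches_le {η : ℝ} (h0 : 0 ≤ η) (h1 : η ≤ 1) {f : Pairing (HalfEdge d)}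
    {R : Finset (Sym2 (HalfEdge d))} (hR : R ⊆ f.edgeFinset)
    (C : Component (R : Set (Sym2 (HalfEdge d)))) :
    iidP (coinWeight η) (fun y : HalfEdge d → Bool => ¬ Touches (seedSet y) ↑R C) ≤
      Real.exp (-(η * edgeCount _ C)) := by
  classical
  set S : Finset (HalfEdge d) := Finset.univ.filter fun g => ∃ e ∈ R, g ∈ e ∧ g.1 ∈ C.supp with hS
  -- Retained edges are edges of a matching, hence pairwise disjoint, so one half-edge from each
  -- gives distinct elements.
  have hcard : edgeCount _ C ≤ S.card := by
    rw [edgeCount_eq, Set.ncard_eq_toFinset_card']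
    have hex : ∀ e : Sym2 (HalfEdge d), ∃ g, g ∈ e := fun e => by
      induction e using Sym2.ind with
      | _ a b => exact ⟨a, by simp⟩
    choose F hF using hex
    refine Finset.card_le_card_of_injOn F ?_ ?_
    · intro e he
      simp only [Finset.mem_coe, Set.mem_toFinset] at he
      simp only [hS, Finset.coe_filter, Finset.mem_univ, true_and, Set.mem_ofPred_eq]
      exact ⟨e, he.1, hF e, he.2 _ (hF e)⟩
    · intro e he e' he' hee
      simp only [Finset.mem_coe, Set.mem_toFinset] at he he'
      refine f.edge_unique (hR he.1) (hR he'.1) (hF e) ?_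
      rw [hee]; exact hF e'
  refine (iidP_mono (isWeight_coinWeight h0 h1) fun y hy => ?_).trans
    ((iidP_seedSet_disjoint_le h0 h1 S).trans (Real.exp_le_exp.2 (neg_le_neg
      (mul_le_mul_of_nonneg_left (by exact_mod_cast hcard) h0))))
  intro g hg hgy
  simp only [hS, Finset.mem_filter, Finset.mem_univ, true_and] at hg
  obtain ⟨e, he, hge⟩ := hg
  exact hy ⟨g, hgy, e, he, hge⟩

/-- The probability that there is no giant component is bounded by the probability that an
exploration from random seeds does not reveal one. -/
theorem percolatedLaw_not_hasGiant_le [Nonempty (HalfEdge d)] (hd : Even (totalDegree d))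
    (p : unitInterval) {η : ℝ} (h0 : 0 ≤ η) (h1 : η ≤ 1) (K : ℕ) {lo hi x : ℝ} (hx : x < lo) :
    (percolatedLaw d p).real {R | ¬ HasGiant lo hi x R} ≤
      iidE (coinWeight η) (fun y : HalfEdge d → Bool => iidP (sampleWeight d p)
        fun ω : Fin K → HalfEdge d × Bool => ¬ Succeeds lo hi x (seedSet y) ω) +
      2 * Real.exp (-(η * x)) := by
  classical
  have hp0 : (0 : ℝ) ≤ p := p.2.1
  have hp1 : (p : ℝ) ≤ 1 := p.2.2
  have hwc := isWeight_coinWeight h0 h1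
  have hws := isWeight_sampleWeight (d := d) hp0 hp1
  -- `Two R` holds if there are two large components; then two of them are singled out
  let Two : Set (Sym2 (HalfEdge d)) → Prop := fun R =>
    ∃ Cs : Component R × Component R, Cs.1 ≠ Cs.2 ∧ x < edgeCount R Cs.1 ∧ x < edgeCount R Cs.2
  -- The pair selected by `choose` depends on `R` alone and not on the seeds. Two exponential bounds
  -- therefore suffice, with no union over pairs of components.
  let Miss : (HalfEdge d → Bool) → Set (Sym2 (HalfEdge d)) → Prop := fun y R =>
    ∃ h : Two R, ¬ Touches (seedSet y) R h.choose.1 ∨ ¬ Touches (seedSet y) R h.choose.2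
  rw [percolatedLaw_real_eq_condP d hd]
  have hsplit : ∀ y : HalfEdge d → Bool, condP p (fun R : Set (Sym2 (HalfEdge d)) => ¬ HasGiant lo hi x R) ∅ ∅ ≤
      iidP (sampleWeight d p) (fun ω : Fin K → HalfEdge d × Bool =>
        ¬ Succeeds lo hi x (seedSet y) ω) + condP p (Miss y) ∅ ∅ := by
    intro y
    -- Outside `Miss`, success of the exploration forces a giant whatever the unrevealed edges are,
    -- so the conditional probability of the first event vanishes on success.
    refine (condP_or_le hp0 hp1 (B₁ := fun R => ¬ HasGiant lo hi x R ∧ ¬ Miss y R) (B₂ := Miss y)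
      (fun R hR => ?_) ∅ ∅).trans (add_le_add_left ?_ _)
    · by_cases h : Miss y R
      · exact Or.inr h
      · exact Or.inl ⟨hR, h⟩
    rw [← iidE_condP_run hp0 hp1 _ (seedSet y) (le_refl K)]
    refine iidE_mono hws fun ω => ?_
    split_ifs with hs
    · exact condP_le_one hp0 hp1 _ _ _
    · rw [not_not] at hs
      refine (condP_eq_zero ?_).le
      rintro f hf R' hR' ⟨hG, hM⟩
      obtain ⟨hfin, k₁, k₂, h12, hk, hact, hlo, hhi, hxx⟩ := hs
      obtain ⟨C, e1, e2, e3, e4⟩ := exists_component_of_window h12 hk hact hfin hf hR'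
      have e1' : ((coins ω k₂).card : ℝ) ≤ edgeCount _ C + (coins ω k₁).card +
        (coinCollisions (seedSet y) ω).card := by exact_mod_cast e1
      have e2' : (edgeCount _ C : ℝ) ≤ (coins ω K).card := by exact_mod_cast e2
      have e3' : ((coins ω k₂).card : ℝ) ≤ C.supp.ncard + (coins ω k₁).card +
        (coinCollisions (seedSet y) ω).card := by exact_mod_cast e3
      have hsmall : ∀ C', C' ≠ C → Touches (seedSet y) _ C' → (edgeCount _ C' : ℝ) ≤ x := by
        intro C' hC' ht
        have e4' : (edgeCount _ C' : ℝ) + (coins ω k₂).card ≤ (coins ω K).card +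
          (coins ω k₁).card + (coinCollisions (seedSet y) ω).card := by
            exact_mod_cast e4 C' hC' ht
        linarith
      have hCex : ¬ ∀ C', C' ≠ C → (edgeCount _ C' : ℝ) ≤ x := fun hall =>
        hG ⟨C, by linarith, by linarith, by linarith, hall⟩
      push Not at hCex
      obtain ⟨C', hne, hC'⟩ := hCex
      have hTwo : Two ↑((run (seedSet y) ω K).r ∪ R') :=
        ⟨(C, C'), Ne.symm hne, by linarith, hC'⟩
      have hT : Touches (seedSet y) _ hTwo.choose.1 ∧ Touches (seedSet y) _ hTwo.choose.2 := by
        by_contra hc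
        exact hM ⟨hTwo, not_and_or.1 hc⟩
      -- At least one of the two selected components differs from `C`; being touched by the seeds it
      -- has at most `x` edges, against its choice.
      obtain ⟨s1, s2, s3⟩ := hTwo.choose_spec
      by_cases hc1 : hTwo.choose.1 = C
      · have := hsmall hTwo.choose.2 (fun h => s1 (hc1.trans h.symm)) hT.2
        linarith
      · have := hsmall hTwo.choose.1 hc1 hT.1
        linarith
  have hMiss : iidE (coinWeight η) (fun y : HalfEdge d → Bool => condP p (Miss y) ∅ ∅) ≤
      2 * Real.exp (-(η * x)) := by
    refine iidE_condP_le hp0 hp1 (by positivity) Miss fun f R hR => ?_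
    by_cases hT : Two ↑R
    · have hexp : ∀ C : Component (↑R : Set (Sym2 (HalfEdge d))), x < edgeCount _ C →
          iidP (coinWeight η) (fun y : HalfEdge d → Bool => ¬ Touches (seedSet y) ↑R C) ≤
            Real.exp (-(η * x)) := fun C hC =>
        (iidP_not_touches_le h0 h1 hR C).trans (Real.exp_le_exp.2 (neg_le_neg
          (mul_le_mul_of_nonneg_left hC.le h0)))
      have h3 := hT.choose_spec
      calc iidP (coinWeight η) (fun y => Miss y ↑R) ≤ iidP (coinWeight η)
            (fun y : HalfEdge d → Bool => ¬ Touches (seedSet y) ↑R hT.choose.1 ∨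
              ¬ Touches (seedSet y) ↑R hT.choose.2) :=
            iidP_mono hwc fun y ⟨_, hy⟩ => hy
        _ ≤ _ := (iidP_or_le hwc _ _).trans (add_le_add (hexp _ h3.2.1) (hexp _ h3.2.2))
        _ = 2 * Real.exp (-(η * x)) := by ring
    · refine (iidP_mono hwc (B := fun _ => False) fun y ⟨h, _⟩ => hT h).trans ?_
      have : iidP (coinWeight η) (fun _ : HalfEdge d → Bool => False) = 0 := by
        simp [iidP, iidE]
      rw [this]; positivity
  calc condP p (fun R : Set (Sym2 (HalfEdge d)) => ¬ HasGiant lo hi x R) ∅ ∅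
      = iidE (coinWeight η) (fun _ : HalfEdge d → Bool =>
          condP p (fun R : Set (Sym2 (HalfEdge d)) => ¬ HasGiant lo hi x R) ∅ ∅) :=
        (iidE_const hwc _).symm
    _ ≤ _ := iidE_mono hwc hsplit
    _ = _ := iidE_add _ _
    _ ≤ _ := add_le_add_right hMiss _

/-- A given half-edge is retained during an exploration with probability at most `p`. -/
theorem iidP_matched_run_le [Nonempty (HalfEdge d)] (hd : Even (totalDegree d)) {p : ℝ}
    (hp0 : 0 ≤ p) (hp1 : p ≤ 1) (K : ℕ) (Q : Finset (HalfEdge d)) (h : HalfEdge d) :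
    iidP (sampleWeight d p) (fun ω : Fin K → HalfEdge d × Bool => Matched (run Q ω K).r h) ≤ p := by
  have hne := pairing_nonempty d hd
  conv_rhs => rw [← condP_mem_retained p h]
  rw [← iidE_condP_run hp0 hp1 _ Q (le_refl K)]
  refine iidE_mono (isWeight_sampleWeight hp0 hp1) fun ω => ?_
  split_ifs with hm
  · refine (condP_eq_one (extensions_run_nonempty hne le_rfl) ?_).ge
    intro f _ R' _
    obtain ⟨e, he, hhe⟩ := hm
    exact ⟨e, by simp [he], hhe⟩
  · exact condP_nonneg hp0 hp1 _ _ _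

end Reduction

end ConfigModel

end

noncomputable section

namespace ConfigModel

/-! ### Moment bounds for the samples and the seeds -/

section Moments

variable {n : ℕ} {d : Fin n → ℕ} {K : ℕ}

theorem card_halfEdge (d : Fin n → ℕ) : Fintype.card (HalfEdge d) = totalDegree d := by
  simp [totalDegree]

theorem sum_fst_eq (v : Fin n) (c : ℝ) :
    ∑ x : HalfEdge d, (if x.1 = v then c else 0) = d v * c := by
  have h : ∀ x, ∑ _y : Fin (d x), (if x = v then c else 0) = if x = v then d v * c else 0 := by
    intro x
    rw [Finset.sum_const, Finset.card_univ, Fintype.card_fin, nsmul_eq_mul]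
    split_ifs with hx
    · rw [hx]
    · simp
  rw [Fintype.sum_sigma]
  simp only [h]
  simp

/-- The truncated second moment `∑ d_v min(1, θ d_v)`. -/
def truncMoment (d : Fin n → ℕ) (θ : ℝ) : ℝ := ∑ v, (d v : ℝ) * min 1 (θ * d v)

theorem truncMoment_nonneg {θ : ℝ} (h : 0 ≤ θ) : 0 ≤ truncMoment d θ :=
  Finset.sum_nonneg fun v _ => by positivity

theorem truncMoment_mono {θ θ' : ℝ} (h : θ ≤ θ') : truncMoment d θ ≤ truncMoment d θ' :=
  Finset.sum_le_sum fun v _ => by gcongr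

theorem le_mul_min {x a b : ℝ} (ha : 0 ≤ a) (h1 : x ≤ a) (h2 : x ≤ a * b) : x ≤ a * min 1 b := by
  rw [mul_min_of_nonneg _ _ ha, mul_one]; exact le_min h1 h2

variable [Nonempty (HalfEdge d)] {p η : ℝ}

theorem sum_sampleWeight_coin (d : Fin n → ℕ) [Nonempty (HalfEdge d)] (p : ℝ) :
    ∑ y, sampleWeight d p y * (if y.2 = true then (1 : ℝ) else 0) = p := by
  rw [sum_sampleWeight_mul]
  have : (Fintype.card (HalfEdge d) : ℝ) ≠ 0 := by exact_mod_cast Fintype.card_ne_zero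
  simp only [if_true, mul_one, Bool.false_eq_true, if_false, mul_zero, add_zero, Finset.sum_const,
    Finset.card_univ, nsmul_eq_mul]
  field_simp

theorem card_lt_of_le {k : ℕ} (hk : k ≤ K) :
    (Finset.univ.filter fun i : Fin K => (i : ℕ) < k).card = k := by
  have := Fin.card_filter_val_lt (n := K) (m := k)
  rw [this]; exact min_eq_right hk

theorem iidP_coins_le (hp0 : 0 ≤ p) (hp1 : p ≤ 1) {k : ℕ} (hk : k ≤ K) {c : ℝ} (hc : 0 < c) :
    iidP (sampleWeight d p) (fun ω : Fin K → HalfEdge d × Bool =>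
      c < |((coins ω k).card : ℝ) - k * p|) ≤ k * p / c ^ 2 := by
  have hw := isWeight_sampleWeight (d := d) hp0 hp1
  refine (iidP_chebyshev hw _ _ hc).trans (div_le_div_of_nonneg_right ?_ (by positivity))
  have h := iidE_sq_count_le hw (fun y : HalfEdge d × Bool => if y.2 = true then (1 : ℝ) else 0)
    (fun y => by split_ifs <;> norm_num) (Finset.univ.filter fun i : Fin K => (i : ℕ) < k)
  rw [sum_sampleWeight_coin, card_lt_of_le hk] at h
  refine le_of_eq_of_le ?_ h
  congr 1; funext ω
  congr 2
  rw [← Finset.sum_filter, Finset.filter_filter]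
  simp [coins]

theorem iidP_seeds_le (h0 : 0 ≤ η) (h1 : η ≤ 1) {c : ℝ} (hc : 0 < c) :
    iidP (coinWeight η) (fun y : HalfEdge d → Bool =>
      c < |((seedSet y).card : ℝ) - totalDegree d * η|) ≤ totalDegree d * η / c ^ 2 := by
  have hw := isWeight_coinWeight h0 h1
  refine (iidP_chebyshev hw _ _ hc).trans (div_le_div_of_nonneg_right ?_ (by positivity))
  have h := iidE_sq_count_le hw (fun b : Bool => if b = true then (1 : ℝ) else 0)
    (fun y => by split_ifs <;> norm_num) (Finset.univ : Finset (HalfEdge d))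
  have h3 : ∑ b, coinWeight η b * (if b = true then (1 : ℝ) else 0) = η := by simp [coinWeight]
  rw [h3, Finset.card_univ, card_halfEdge] at h
  refine le_of_eq_of_le ?_ h
  congr 1; funext y
  congr 2
  rw [← Finset.sum_filter]
  simp [seedSet]

/-- The mean volume covered by `k` samples. -/
def meanCovered (d : Fin n → ℕ) (p : ℝ) (k : ℕ) : ℝ :=
  ∑ v, (d v : ℝ) * (1 - (1 - p * d v / totalDegree d) ^ k)

theorem sum_sampleWeight_vertex_coin (d : Fin n → ℕ) [Nonempty (HalfEdge d)] (p : ℝ) (v : Fin n)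
    (g : Bool → ℝ) :
    ∑ y : HalfEdge d × Bool, sampleWeight d p y * (if y.1.1 = v then g y.2 else 0) =
      (p * g true + (1 - p) * g false) * (d v / totalDegree d) := by
  rw [sum_sampleWeight_mul p (fun y : HalfEdge d × Bool => if y.1.1 = v then g y.2 else 0)]
  have : ∀ x : HalfEdge d, p * (if x.1 = v then g true else 0) +
      (1 - p) * (if x.1 = v then g false else 0) =
      if x.1 = v then p * g true + (1 - p) * g false else 0 := fun x => by split_ifs <;> ring
  simp only [this]
  rw [sum_fst_eq, card_halfEdge]
  ring

theorem sum_sampleWeight_halfEdge (d : Fin n → ℕ) [Nonempty (HalfEdge d)] (p : ℝ) (h : HalfEdge d)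
    (g : Bool → ℝ) :
    ∑ y : HalfEdge d × Bool, sampleWeight d p y * (if y.1 = h then g y.2 else 0) =
      (p * g true + (1 - p) * g false) / totalDegree d := by
  rw [sum_sampleWeight_mul p (fun y : HalfEdge d × Bool => if y.1 = h then g y.2 else 0)]
  have : ∀ x : HalfEdge d, p * (if x = h then g true else 0) +
      (1 - p) * (if x = h then g false else 0) =
      if x = h then p * g true + (1 - p) * g false else 0 := fun x => by split_ifs <;> ring
  simp only [this]
  rw [Finset.sum_ite_eq' Finset.univ h, card_halfEdge]
  simp; ring

/-- Weighted coverage, where the kind `v` is a sample at `v` with retention coin and has weight `d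
v`. The variance is at most the largest degree times the mean. -/
theorem iidP_covered_le (hp0 : 0 ≤ p) (hp1 : p ≤ 1) {k : ℕ} (hk : k ≤ K) {c Δ : ℝ} (hc : 0 < c)
    (hΔ : ∀ v, (d v : ℝ) ≤ Δ) :
    iidP (sampleWeight d p) (fun ω : Fin K → HalfEdge d × Bool =>
      c < |(vol d (covered ω k) : ℝ) - meanCovered d p k|) ≤ Δ * meanCovered d p k / c ^ 2 := by
  classical
  have hw := isWeight_sampleWeight (d := d) hp0 hp1
  refine (iidP_chebyshev hw _ _ hc).trans (div_le_div_of_nonneg_right ?_ (by positivity))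
  set f : Fin n → HalfEdge d × Bool → ℝ :=
    fun v y => if y.1.1 = v then (if y.2 = true then 1 else 0) else 0 with hf
  set J := Finset.univ.filter fun i : Fin K => (i : ℕ) < k with hJ
  have hq : ∀ v, ∑ y, sampleWeight d p y * f v y = p * d v / totalDegree d := by
    intro v
    have := sum_sampleWeight_vertex_coin d p v (fun b => if b = true then 1 else 0)
    simp only [if_true, mul_one, Bool.false_eq_true, if_false, mul_zero, add_zero] at this
    rw [hf]; simp only; rw [this]; ring
  have h := iidE_sq_uncovered_le hw f (fun v y => by simp only [hf]; split_ifs <;> norm_num)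
    (fun u v huv y => by
      simp only [hf]
      by_cases h1 : y.1.1 = u
      · have : y.1.1 ≠ v := fun h2 => huv (h1.symm.trans h2)
        simp [this]
      · simp [h1])
    (fun u v huv y => by
      simp only [hf]
      by_cases h1 : y.1.1 = u
      · have : y.1.1 ≠ v := fun h2 => huv (h1.symm.trans h2)
        rw [if_neg this]; split_ifs <;> norm_num
      · rw [if_neg h1]; split_ifs <;> norm_num)
    (fun v y => by simp only [hf]; split_ifs <;> norm_num)
    (fun v => (d v : ℝ)) (fun v => Nat.cast_nonneg _) J hΔ
  simp only [hq] at h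
  rw [card_lt_of_le hk] at h
  refine le_of_eq_of_le ?_ h
  congr 1; funext ω
  have hprod : ∀ v, ∏ i ∈ J, (1 - f v (ω i)) = if v ∈ covered ω k then 0 else 1 := by
    intro v
    split_ifs with hv
    · obtain ⟨i, hi, hc, hv⟩ := mem_covered.1 hv
      exact Finset.prod_eq_zero (i := i) (by simp [hJ, hi]) (by simp [hf, hc, hv])
    · refine Finset.prod_eq_one fun i hi => ?_
      have hi' : (i : ℕ) < k := by simpa [hJ] using hi
      have : ¬ ((ω i).1.1 = v ∧ (ω i).2 = true) := fun h =>
        hv (mem_covered.2 ⟨i, hi', h.2, h.1⟩)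
      simp only [hf]
      rw [not_and] at this
      split_ifs with h1 h2
      · exact absurd h2 (this h1)
      · ring
      · ring
  simp only [hprod]
  have hvol : (vol d (covered ω k) : ℝ) =
      ∑ v, (d v : ℝ) - ∑ v, (d v : ℝ) * (if v ∈ covered ω k then 0 else 1) := by
    rw [← Finset.sum_sub_distrib]
    unfold vol
    push_cast
    rw [← Finset.sum_subset (Finset.subset_univ (covered ω k))]
    · exact Finset.sum_congr rfl fun v hv => by simp [hv]
    · intro v _ hv; simp [hv]
  rw [hvol]
  unfold meanCovered
  simp only [mul_sub, mul_one, Finset.sum_sub_distrib]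
  ring

open Classical in
/-- The mean number of collisions, among the samples whose coin is counted by `g`. -/
theorem iidE_collisions_le (hp0 : 0 ≤ p) (hp1 : p ≤ 1) (h0 : 0 ≤ η) (h1 : η ≤ 1) (g : Bool → ℝ)
    (hg : ∀ b, 0 ≤ g b) :
    iidE (coinWeight η) (fun y : HalfEdge d → Bool => iidE (sampleWeight d p)
      fun ω : Fin K → HalfEdge d × Bool =>
        ∑ i, if Collides (seedSet y) ω i then g (ω i).2 else 0) ≤
      K * ((p * g true + (1 - p) * g false) / totalDegree d *
        truncMoment d (K / totalDegree d + η)) := by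
  have hwc := isWeight_coinWeight h0 h1
  have hws := isWeight_sampleWeight (d := d) hp0 hp1
  set N : ℝ := ((totalDegree d : ℕ) : ℝ) with hN
  set θ : ℝ := p * g true + (1 - p) * g false with hθ
  have hθ0 : 0 ≤ θ := add_nonneg (mul_nonneg hp0 (hg _)) (mul_nonneg (by linarith) (hg _))
  simp only [iidE_sum]
  have key : ∀ i : Fin K, iidE (coinWeight η) (fun y : HalfEdge d → Bool =>
      iidE (sampleWeight d p) fun ω : Fin K → HalfEdge d × Bool =>
        if Collides (seedSet y) ω i then g (ω i).2 else 0) ≤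
      θ / N * truncMoment d (K / N + η) := by
    intro i
    have hsplit : ∀ (y : HalfEdge d → Bool) (ω : Fin K → HalfEdge d × Bool),
        (if Collides (seedSet y) ω i then g (ω i).2 else 0) =
        ∑ v, if (ω i).1.1 = v then (if Collides (seedSet y) ω i then g (ω i).2 else 0) else 0 := by
      intro y ω; simp
    refine (iidE_mono hwc fun y => iidE_mono hws fun ω => (hsplit y ω).le).trans ?_
    simp only [iidE_sum]
    unfold truncMoment
    rw [Finset.mul_sum]
    refine Finset.sum_le_sum fun v _ => ?_
    have hav : iidE (coinWeight η) (fun _ : HalfEdge d → Bool => iidE (sampleWeight d p)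
        fun ω : Fin K → HalfEdge d × Bool => if (ω i).1.1 = v then g (ω i).2 else 0) =
        θ * (d v / N) := by
      rw [iidE_const hwc, iidE_coord hws i (fun y => if y.1.1 = v then g y.2 else 0),
        sum_sampleWeight_vertex_coin]
    rw [show θ / N * ((d v : ℝ) * min 1 ((K / N + η) * d v)) =
      θ * (d v / N) * min 1 ((K / N + η) * d v) by ring]
    -- The first bound ignores the collision. The second is a union bound over its causes: at most
    -- `K` other samples, each at `v` with probability `d v / N`, and the `d v` half-edges of `v`,
    -- each a seed with probability `η`.
    refine le_mul_min (by positivity) ?_ ?_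
    · rw [← hav]
      refine iidE_mono hwc fun y => iidE_mono hws fun ω => ?_
      split_ifs
      · exact le_rfl
      · exact hg _
      · exact le_rfl
    · have hbound : ∀ (y : HalfEdge d → Bool) (ω : Fin K → HalfEdge d × Bool),
          (if (ω i).1.1 = v then (if Collides (seedSet y) ω i then g (ω i).2 else 0) else 0) ≤
          (∑ j ∈ Finset.univ.erase i, (if (ω i).1.1 = v then g (ω i).2 else 0) *
            (if (ω j).1.1 = v then 1 else 0)) +
          (∑ h : HalfEdge d, (if h.1 = v then (if y h = true then (1 : ℝ) else 0) else 0)) *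
            (if (ω i).1.1 = v then g (ω i).2 else 0) := by
        intro y ω
        have hs1 : 0 ≤ ∑ j ∈ Finset.univ.erase i, (if (ω i).1.1 = v then g (ω i).2 else 0) *
            (if (ω j).1.1 = v then (1 : ℝ) else 0) :=
          Finset.sum_nonneg fun j _ => mul_nonneg (by split_ifs <;> simp [hg])
            (by split_ifs <;> norm_num)
        have hs2 : 0 ≤ ∑ h : HalfEdge d,
            (if h.1 = v then (if y h = true then (1 : ℝ) else 0) else 0) :=
          Finset.sum_nonneg fun h _ => by split_ifs <;> norm_num
        by_cases hv : (ω i).1.1 = v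
        · simp only [if_pos hv] at hs1 ⊢
          have hs3 := mul_nonneg hs2 (hg (ω i).2)
          split_ifs with hc
          · rcases hc with ⟨j, hj, hjv⟩ | ⟨h, hhQ, hhv⟩
            · have := Finset.single_le_sum (f := fun j => g (ω i).2 *
                  (if (ω j).1.1 = v then (1 : ℝ) else 0))
                (fun j _ => mul_nonneg (hg _) (by split_ifs <;> norm_num))
                (Finset.mem_erase.2 ⟨hj, Finset.mem_univ j⟩)
              simp only [hjv.trans hv, if_true, mul_one] at this
              linarith
            · have := Finset.single_le_sum (f := fun h : HalfEdge d =>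
                  if h.1 = v then (if y h = true then (1 : ℝ) else 0) else 0)
                (fun h _ => by split_ifs <;> norm_num) (Finset.mem_univ h)
              simp only [hhv.trans hv, mem_seedSet.1 hhQ, if_true] at this
              nlinarith [hg (ω i).2]
          · linarith
        · simp only [if_neg hv] at hs1 ⊢
          simp
      refine (iidE_mono hwc fun y => iidE_mono hws fun ω => hbound y ω).trans ?_
      simp only [iidE_add, iidE_const_mul, iidE_sum]
      have e1 : ∀ j ∈ Finset.univ.erase i, iidE (sampleWeight d p)
          (fun ω : Fin K → HalfEdge d × Bool => (if (ω i).1.1 = v then g (ω i).2 else 0) *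
            (if (ω j).1.1 = v then 1 else 0)) = θ * (d v / N) * (d v / N) := by
        intro j hj
        rw [iidE_coord_mul hws (Finset.ne_of_mem_erase hj).symm
          (fun y => if y.1.1 = v then g y.2 else 0) (fun y => if y.1.1 = v then 1 else 0),
          sum_sampleWeight_vertex_coin]
        have := sum_sampleWeight_vertex_coin d p v (fun _ => 1)
        rw [this]; ring
      have e2 : iidE (sampleWeight d p) (fun ω : Fin K → HalfEdge d × Bool =>
          if (ω i).1.1 = v then g (ω i).2 else 0) = θ * (d v / N) := by
        rw [iidE_coord hws i (fun y => if y.1.1 = v then g y.2 else 0),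
          sum_sampleWeight_vertex_coin]
      simp only [iidE_const hwc]
      rw [Finset.sum_congr rfl e1, e2]
      have e3 : iidE (coinWeight η) (fun y : HalfEdge d → Bool => (∑ h : HalfEdge d,
          (if h.1 = v then (if y h = true then (1 : ℝ) else 0) else 0)) * (θ * (d v / N))) =
          η * d v * (θ * (d v / N)) := by
        simp only [mul_comm _ (θ * (d v / N))]
        rw [iidE_const_mul, iidE_sum]
        congr 1
        have : ∀ h : HalfEdge d, iidE (coinWeight η) (fun y : HalfEdge d → Bool =>
            (if h.1 = v then (if y h = true then (1 : ℝ) else 0) else 0)) =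
            if h.1 = v then η else 0 := by
          intro h
          split_ifs with hv
          · simpa [iidP, mem_seedSet] using iidP_mem_seedSet h0 h1 h
          · exact iidE_const hwc 0
        simp only [this]
        rw [sum_fst_eq]; ring
      rw [e3, Finset.sum_const, nsmul_eq_mul]
      have hc : ((Finset.univ.erase i).card : ℝ) ≤ K := by
        have := Finset.card_erase_le (s := (Finset.univ : Finset (Fin K))) (a := i)
        rw [Finset.card_univ, Fintype.card_fin] at this
        exact_mod_cast this
      have hnn : 0 ≤ θ * (d v / N) * (d v / N) := by positivity
      calc _ ≤ K * (θ * (d v / N) * (d v / N)) + η * d v * (θ * (d v / N)) := by gcongr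
        _ = _ := by ring
  refine (Finset.sum_le_card_nsmul _ _ _ fun i _ => key i).trans ?_
  simp

end Moments

end ConfigModel

end

noncomputable section

namespace ConfigModel

/-! ### Mean volume of retained seeds and of spoiled vertices -/

section SeedMoments

variable {n : ℕ} {d : Fin n → ℕ} {K : ℕ} [Nonempty (HalfEdge d)] {p η : ℝ}

theorem vol_eq_sum (W : Finset (Fin n)) :
    (vol d W : ℝ) = ∑ v, (d v : ℝ) * if v ∈ W then 1 else 0 := by
  unfold vol
  push_cast
  simp

/-- Bounding the mean volume of a random set of vertices through its inclusion probabilities. -/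
theorem iidE_vol_le_truncMoment {ι α : Type*} [Fintype ι] [DecidableEq ι] [Fintype α] {w : α → ℝ}
    {ι' α' : Type*} [Fintype ι'] [DecidableEq ι'] [Fintype α'] {w' : α' → ℝ}
    (hw : IsWeight w) (hw' : IsWeight w') (W : (ι → α) → (ι' → α') → Finset (Fin n)) {θ : ℝ}
    (h : ∀ v, iidE w (fun y => iidE w' fun ω => if v ∈ W y ω then (1 : ℝ) else 0) ≤ θ * d v) :
    iidE w (fun y => iidE w' fun ω => (vol d (W y ω) : ℝ)) ≤ truncMoment d θ := by
  simp only [vol_eq_sum, iidE_sum, iidE_const_mul]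
  refine Finset.sum_le_sum fun v _ => mul_le_mul_of_nonneg_left (le_min ?_ (h v)) (Nat.cast_nonneg _)
  refine (iidE_mono hw (G := fun _ => 1) fun y => ?_).trans (iidE_const hw 1).le
  refine (iidE_mono hw' (G := fun _ => 1) fun ω => ?_).trans (iidE_const hw' 1).le
  split_ifs <;> norm_num

theorem iidE_seed_coord (h0 : 0 ≤ η) (h1 : η ≤ 1) (h : HalfEdge d) :
    iidE (coinWeight η) (fun y : HalfEdge d → Bool => if y h = true then (1 : ℝ) else 0) = η := by
  simpa [iidP, mem_seedSet] using iidP_mem_seedSet h0 h1 h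

/-- Whether a seed is retained depends on the whole exploration, but given the seeds its probability
is at most `p` because the exploration preserves the law of the model. A union bound over the
half-edges of `v` then gives `p η d_v`. -/
theorem iidE_seedVertices_le (hd : Even (totalDegree d)) (hp0 : 0 ≤ p) (hp1 : p ≤ 1) (h0 : 0 ≤ η)
    (h1 : η ≤ 1) :
    iidE (coinWeight η) (fun y : HalfEdge d → Bool => iidE (sampleWeight d p)
      fun ω : Fin K → HalfEdge d × Bool =>
        (vol d (seedVertices (seedSet y) (run (seedSet y) ω K).r) : ℝ)) ≤
      truncMoment d (p * η) := by
  classical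
  have hwc := isWeight_coinWeight h0 h1
  have hws := isWeight_sampleWeight (d := d) hp0 hp1
  refine iidE_vol_le_truncMoment hwc hws _ fun v => ?_
  have hb : ∀ (y : HalfEdge d → Bool) (ω : Fin K → HalfEdge d × Bool),
      (if v ∈ seedVertices (seedSet y) (run (seedSet y) ω K).r then (1 : ℝ) else 0) ≤
      ∑ h : HalfEdge d, (if h.1 = v then (if y h = true then (1 : ℝ) else 0) else 0) *
        if Matched (run (seedSet y) ω K).r h then 1 else 0 := by
    intro y ω
    have hnn : ∀ h ∈ (Finset.univ : Finset (HalfEdge d)),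
        0 ≤ (if h.1 = v then (if y h = true then (1 : ℝ) else 0) else 0) *
        if Matched (run (seedSet y) ω K).r h then 1 else 0 := fun h _ =>
      mul_nonneg (by split_ifs <;> norm_num) (by split_ifs <;> norm_num)
    split_ifs with hv
    · obtain ⟨h, hQ, hhv, hm⟩ := mem_seedVertices.1 hv
      refine le_trans ?_ (Finset.single_le_sum hnn (Finset.mem_univ h))
      simp [hhv, mem_seedSet.1 hQ, hm]
    · exact Finset.sum_nonneg hnn
  refine (iidE_mono hwc fun y => iidE_mono hws fun ω => hb y ω).trans ?_
  simp only [iidE_sum, iidE_const_mul]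
  have hm : ∀ (y : HalfEdge d → Bool) (h : HalfEdge d), iidE (sampleWeight d p)
      (fun ω : Fin K → HalfEdge d × Bool =>
        if Matched (run (seedSet y) ω K).r h then (1 : ℝ) else 0) ≤ p := by
    intro y h
    refine le_of_eq_of_le ?_ (iidP_matched_run_le hd hp0 hp1 K (seedSet y) h)
    unfold iidP
    congr!
  calc _ ≤ ∑ h : HalfEdge d, if h.1 = v then p * η else 0 := by
        refine Finset.sum_le_sum fun h _ => ?_
        split_ifs with hv
        · have hc := iidE_const_mul (w := coinWeight η) p
            (fun y : HalfEdge d → Bool => if y h = true then (1 : ℝ) else 0)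
          rw [iidE_seed_coord h0 h1 h] at hc
          refine le_of_le_of_eq (iidE_mono hwc fun y => ?_) hc
          rw [mul_comm]
          exact mul_le_mul_of_nonneg_right (hm y h) (by split_ifs <;> norm_num)
        · simp [iidE]
    _ = _ := by rw [sum_fst_eq]; ring

/-- A retained sample equal to a given half-edge has expected number `K p / N`, and needs in
addition a second such sample or a seed. Since the repetition is of a half-edge and not just of a
vertex, the sum over the half-edges of `v` is linear in `d_v`. -/
theorem iidE_spoiled_le (hp0 : 0 ≤ p) (hp1 : p ≤ 1) (h0 : 0 ≤ η) (h1 : η ≤ 1) :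
    iidE (coinWeight η) (fun y : HalfEdge d → Bool => iidE (sampleWeight d p)
      fun ω : Fin K → HalfEdge d × Bool => (vol d (spoiled (seedSet y) ω) : ℝ)) ≤
      truncMoment d (K * p / totalDegree d * (K / totalDegree d + η)) := by
  classical
  have hwc := isWeight_coinWeight h0 h1
  have hws := isWeight_sampleWeight (d := d) hp0 hp1
  set N : ℝ := ((totalDegree d : ℕ) : ℝ) with hN
  refine iidE_vol_le_truncMoment hwc hws _ fun v => ?_
  let G : HalfEdge d → HalfEdge d × Bool → ℝ :=
    fun h y => if y.1 = h then (if y.2 = true then 1 else 0) else 0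
  let G' : HalfEdge d → HalfEdge d × Bool → ℝ := fun h y => if y.1 = h then 1 else 0
  have hG0 : ∀ h y, 0 ≤ G h y := fun h y => by simp only [G]; split_ifs <;> norm_num
  have hG0' : ∀ h y, 0 ≤ G' h y := fun h y => by simp only [G']; split_ifs <;> norm_num
  have hb : ∀ (y : HalfEdge d → Bool) (ω : Fin K → HalfEdge d × Bool),
      (if v ∈ spoiled (seedSet y) ω then (1 : ℝ) else 0) ≤
      ∑ h : HalfEdge d, if h.1 = v then ∑ i : Fin K,
        ((∑ j ∈ Finset.univ.erase i, G h (ω i) * G' h (ω j)) +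
          (if y h = true then (1 : ℝ) else 0) * G h (ω i)) else 0 := by
    intro y ω
    have hn1 : ∀ (h : HalfEdge d) (i : Fin K),
        0 ≤ ∑ j ∈ Finset.univ.erase i, G h (ω i) * G' h (ω j) := fun h i =>
      Finset.sum_nonneg fun j _ => mul_nonneg (hG0 _ _) (hG0' _ _)
    have hn2 : ∀ (h : HalfEdge d) (i : Fin K),
        0 ≤ (if y h = true then (1 : ℝ) else 0) * G h (ω i) := fun h i =>
      mul_nonneg (by split_ifs <;> norm_num) (hG0 _ _)
    have hnn : ∀ h ∈ (Finset.univ : Finset (HalfEdge d)),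
        0 ≤ if h.1 = v then ∑ i : Fin K,
        ((∑ j ∈ Finset.univ.erase i, G h (ω i) * G' h (ω j)) +
          (if y h = true then (1 : ℝ) else 0) * G h (ω i)) else 0 := fun h _ => by
      by_cases hv : h.1 = v
      · rw [if_pos hv]; exact Finset.sum_nonneg fun i _ => add_nonneg (hn1 h i) (hn2 h i)
      · rw [if_neg hv]
    split_ifs with hv
    · simp only [spoiled, Finset.mem_filter, Finset.mem_univ, true_and] at hv
      obtain ⟨i, hc, hiv, hor⟩ := hv
      refine le_trans ?_ (Finset.single_le_sum hnn (Finset.mem_univ (ω i).1))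
      rw [if_pos hiv]
      refine le_trans ?_ (Finset.single_le_sum (f := fun k => (∑ j ∈ Finset.univ.erase k,
        G (ω i).1 (ω k) * G' (ω i).1 (ω j)) + (if y (ω i).1 = true then (1 : ℝ) else 0) *
          G (ω i).1 (ω k)) (fun k _ => add_nonneg (hn1 _ k) (hn2 _ k)) (Finset.mem_univ i))
      rcases hor with ⟨j, hj, hji⟩ | hQ
      · refine le_trans ?_ (le_add_of_nonneg_right (hn2 _ _))
        refine le_trans ?_ (Finset.single_le_sum (f := fun j => G (ω i).1 (ω i) * G' (ω i).1 (ω j))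
          (fun j _ => mul_nonneg (hG0 _ _) (hG0' _ _))
          (Finset.mem_erase.2 ⟨hj.ne, Finset.mem_univ j⟩))
        simp [G, G', hc, hji]
      · refine le_trans ?_ (le_add_of_nonneg_left (hn1 _ _))
        simp [G, hc, mem_seedSet.1 hQ]
    · exact Finset.sum_nonneg hnn
  refine (iidE_mono hwc fun y => iidE_mono hws fun ω => hb y ω).trans ?_
  simp only [iidE_sum]
  have e1 : ∀ (h : HalfEdge d) (i : Fin K), ∀ j ∈ Finset.univ.erase i, iidE (sampleWeight d p)
      (fun ω : Fin K → HalfEdge d × Bool => G h (ω i) * G' h (ω j)) = p / N * (1 / N) := by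
    intro h i j hj
    rw [iidE_coord_mul hws (Finset.ne_of_mem_erase hj).symm (G h) (G' h)]
    have h1 := sum_sampleWeight_halfEdge d p h (fun b => if b = true then 1 else 0)
    have h2 := sum_sampleWeight_halfEdge d p h (fun _ => 1)
    simp only [if_true, mul_one, Bool.false_eq_true, if_false, mul_zero, add_zero,
      add_sub_cancel] at h1 h2
    simp only [G, G']
    rw [h1, h2]
  have e2 : ∀ (h : HalfEdge d) (i : Fin K), iidE (sampleWeight d p)
      (fun ω : Fin K → HalfEdge d × Bool => G h (ω i)) = p / N := by
    intro h i
    rw [iidE_coord hws i (G h)]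
    have h1 := sum_sampleWeight_halfEdge d p h (fun b => if b = true then 1 else 0)
    simp only [if_true, mul_one, Bool.false_eq_true, if_false, mul_zero, add_zero] at h1
    simp only [G]
    rw [h1]
  calc _ ≤ ∑ h : HalfEdge d, if h.1 = v then K * (K * (p / N * (1 / N)) + η * (p / N)) else 0 := by
        refine Finset.sum_le_sum fun h _ => ?_
        split_ifs with hv
        · simp only [iidE_sum, iidE_add, iidE_const_mul, e2]
          have e3 : ∀ i : Fin K, ∑ j ∈ Finset.univ.erase i, iidE (coinWeight η)
              (fun _ : HalfEdge d → Bool => iidE (sampleWeight d p)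
              (fun ω : Fin K → HalfEdge d × Bool => G h (ω i) * G' h (ω j))) ≤
              K * (p / N * (1 / N)) := by
            intro i
            rw [Finset.sum_congr rfl fun j hj => by rw [e1 h i j hj, iidE_const hwc]]
            rw [Finset.sum_const, nsmul_eq_mul]
            have hc : ((Finset.univ.erase i).card : ℝ) ≤ K := by
              have := Finset.card_erase_le (s := (Finset.univ : Finset (Fin K))) (a := i)
              rw [Finset.card_univ, Fintype.card_fin] at this
              exact_mod_cast this
            gcongr
          have e4 : iidE (coinWeight η) (fun y : HalfEdge d → Bool =>
              (if y h = true then (1 : ℝ) else 0) * (p / N)) = η * (p / N) := by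
            simp only [mul_comm _ (p / N)]
            rw [iidE_const_mul, iidE_seed_coord h0 h1]
          refine (Finset.sum_le_card_nsmul _ _ _ fun i _ =>
            add_le_add (e3 i) e4.le).trans ?_
          rw [Finset.card_univ, Fintype.card_fin, nsmul_eq_mul]
        · simp [iidE]
    _ = _ := by rw [sum_fst_eq]; ring

end SeedMoments

end ConfigModel

end

noncomputable section

namespace ConfigModel

/-! ### Typical samples make the exploration succeed -/

section Success

variable {n : ℕ} {d : Fin n → ℕ} {K : ℕ}

/-- The typical behaviour of samples and seeds. The numbers `L` and `M` are the orders of magnitude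
of the number of steps and of the number of edges found. -/
structure Typical (p L M δ ε ε' : ℝ) (k₁ k₂ : ℕ) (grid : Finset ℕ) (Q : Finset (HalfEdge d))
    (ω : Fin K → HalfEdge d × Bool) : Prop where
  coins₁ : |((coins ω k₁).card : ℝ) - k₁ * p| ≤ ε * M
  coins₂ : |((coins ω k₂).card : ℝ) - k₂ * p| ≤ ε * M
  coinsK : |((coins ω K).card : ℝ) - K * p| ≤ ε * M
  collisions : ((collisions Q ω).card : ℝ) ≤ ε * L
  coinCollisions : ((coinCollisions Q ω).card : ℝ) ≤ ε * M
  covered : ∀ k ∈ grid, |(vol d (covered ω k) : ℝ) - meanCovered d p k| ≤ ε * L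
  spoiled : (vol d (spoiled Q ω) : ℝ) ≤ ε * L
  seedVertices : (vol d (seedVertices Q (run Q ω K).r) : ℝ) ≤ ε' * L
  seeds : |(Q.card : ℝ) - δ * L| ≤ δ * L / 2

/-- The numerical conditions under which typical samples and seeds reveal a giant component. -/
structure Admissible (d : Fin n → ℕ) (K : ℕ) (p L M δ ε ε' : ℝ) (k₁ k₂ : ℕ) (grid : Finset ℕ)
    (lo hi x : ℝ) : Prop where
  le₁₂ : k₁ ≤ k₂
  le₂ : k₂ ≤ K
  window : ∀ k, k₁ ≤ k → k ≤ k₂ → ∃ g ∈ grid, g ≤ k ∧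
    k + (K * p + ε * M) + 3 * (ε * L) < meanCovered d p g
  seeds : 2 * (k₁ : ℝ) < δ * L / 2
  mem_grid : K ∈ grid
  finish : δ * L + δ * L / 2 + meanCovered d p K + 2 * (ε * L) + ε' * L < K
  lo : lo + k₁ * p + 3 * (ε * M) ≤ k₂ * p
  hi : K * p + ε * M ≤ hi
  x : K * p + k₁ * p + 4 * (ε * M) ≤ x + k₂ * p

variable {p L M δ ε ε' : ℝ} {k₁ k₂ : ℕ} {grid : Finset ℕ} {lo hi x : ℝ}
  {Q : Finset (HalfEdge d)} {ω : Fin K → HalfEdge d × Bool}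

/-- The bounds `vol_covered_le` and `le_of_unfinished` turn the numerical inequalities into
contradictions: throughout the window the covered volume exceeds what could have been used up, and
by time `K` the available half-edges would not suffice for `K` steps. -/
theorem Typical.succeeds (T : Typical p L M δ ε ε' k₁ k₂ grid Q ω)
    (A : Admissible d K p L M δ ε ε' k₁ k₂ grid lo hi x) : Succeeds lo hi x Q ω := by
  have hc1 := abs_le.1 T.coins₁
  have hc2 := abs_le.1 T.coins₂
  have hcK := abs_le.1 T.coinsK
  have hcol := T.collisions
  have hccol := T.coinCollisions
  have hsp := T.spoiled
  have hsv := T.seedVertices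
  have hQ := abs_le.1 T.seeds
  have hact : ∀ k, k₁ ≤ k → k ≤ k₂ → ∃ g, Active (run Q ω k) g := by
    intro k
    induction k using Nat.strong_induction_on with
    | _ k ih =>
      intro h1 h2
      by_contra hno
      push Not at hno
      have hkK : k ≤ K := h2.trans A.le₂
      -- Earlier times in the window are active by induction; before the window the seeds cannot be
      -- exhausted, since exhausting them takes at least half their number of steps.
      have hunf : ∀ i < k, pick Q (run Q ω i) ≠ none := by
        intro i hi hn
        by_cases hik : k₁ ≤ i
        · obtain ⟨g, hg⟩ := ih i hi hik (by omega)
          exact (pick_eq_none hn).1 g hg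
        · have h3 := card_seeds_le (Q := Q) (ω := ω) (k := i) (by omega) hn
          have h4 : (Q.card : ℝ) ≤ 2 * k₁ := by
            have : Q.card ≤ 2 * k₁ := by omega
            exact_mod_cast this
          linarith [A.seeds]
      have h5 := vol_covered_le hkK hunf hno
      obtain ⟨g, hg, hgk, hlt⟩ := A.window k h1 h2
      have h6 := (abs_le.1 (T.covered g hg)).1
      have h7 : (vol d (ConfigModel.covered ω g) : ℝ) ≤ vol d (ConfigModel.covered ω k) := by
        exact_mod_cast vol_mono (covered_mono hgk)
      have h8 : (vol d (ConfigModel.covered ω k) : ℝ) ≤ vol d (ConfigModel.spoiled Q ω) + k +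
          (coins ω K).card + (ConfigModel.collisions Q ω).card := by exact_mod_cast h5
      linarith
  have hfin : pick Q (run Q ω K) = none := by
    by_contra hne
    have hunf : ∀ i < K, pick Q (run Q ω i) ≠ none := by
      intro i hi hn
      rw [pick_run_none_mono hi.le le_rfl hn] at hne
      exact hne hn
    have h5 := le_of_unfinished hunf
    have h6 := (abs_le.1 (T.covered K A.mem_grid)).2
    have h8 : (K : ℝ) ≤ Q.card + vol d (ConfigModel.covered ω K) +
        vol d (ConfigModel.seedVertices Q (run Q ω K).r) +
        (ConfigModel.collisions Q ω).card := by exact_mod_cast h5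
    linarith [A.finish]
  refine ⟨hfin, k₁, k₂, A.le₁₂, A.le₂, hact, ?_, ?_, ?_⟩
  · linarith [A.lo]
  · linarith [A.hi]
  · linarith [A.x]

theorem not_typical (h : ¬ Typical p L M δ ε ε' k₁ k₂ grid Q ω) :
    (∃ k ∈ ({k₁, k₂, K} : Finset ℕ), ε * M < |((coins ω k).card : ℝ) - k * p|) ∨
    ε * L < ((collisions Q ω).card : ℝ) ∨ ε * M < ((coinCollisions Q ω).card : ℝ) ∨
    (∃ k ∈ grid, ε * L < |(vol d (covered ω k) : ℝ) - meanCovered d p k|) ∨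
    ε * L < (vol d (spoiled Q ω) : ℝ) ∨
    ε' * L < (vol d (seedVertices Q (run Q ω K).r) : ℝ) ∨
    δ * L / 2 < |(Q.card : ℝ) - δ * L| := by
  by_contra hc
  push Not at hc
  obtain ⟨h1, h2, h3, h4, h5, h6, h7⟩ := hc
  exact h ⟨h1 _ (by simp), h1 _ (by simp), h1 _ (by simp), h2, h3, h4, h5, h6, h7⟩

variable [Nonempty (HalfEdge d)] {η : ℝ}

/-- The probability of untypical behaviour. -/
theorem iidE_not_typical_le (hd : Even (totalDegree d)) (hp0 : 0 ≤ p) (hp1 : p ≤ 1) (h0 : 0 ≤ η)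
    (h1 : η ≤ 1) (hL : 0 < L) (hM : 0 < M) (hδ : 0 < δ) (hε : 0 < ε) (hε' : 0 < ε')
    (hη : totalDegree d * η = δ * L) (hk₁ : k₁ ≤ K) (hk₂ : k₂ ≤ K) (hgrid : ∀ k ∈ grid, k ≤ K)
    {Δ : ℝ} (hΔ : ∀ v, (d v : ℝ) ≤ Δ) :
    iidE (coinWeight η) (fun y : HalfEdge d → Bool => iidP (sampleWeight d p)
      fun ω : Fin K → HalfEdge d × Bool => ¬ Typical p L M δ ε ε' k₁ k₂ grid (seedSet y) ω) ≤
      3 * (K * p / (ε * M) ^ 2) +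
      (K / totalDegree d * truncMoment d (K / totalDegree d + η) / (ε * L) +
      (K * p / totalDegree d * truncMoment d (K / totalDegree d + η) / (ε * M) +
      (∑ k ∈ grid, Δ * meanCovered d p k / (ε * L) ^ 2 +
      (truncMoment d (K * p / totalDegree d * (K / totalDegree d + η)) / (ε * L) +
      (truncMoment d (p * η) / (ε' * L) + 4 / (δ * L)))))) := by
  classical
  have hwc := isWeight_coinWeight h0 h1
  have hws := isWeight_sampleWeight (d := d) hp0 hp1
  have hεL : 0 < ε * L := by positivity
  have hεM : 0 < ε * M := by positivity
  have hεL' : 0 < ε' * L := by positivity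
  have hy : ∀ y : HalfEdge d → Bool, iidP (sampleWeight d p)
      (fun ω : Fin K → HalfEdge d × Bool => ¬ Typical p L M δ ε ε' k₁ k₂ grid (seedSet y) ω) ≤
      3 * (K * p / (ε * M) ^ 2) +
      ((ε * L)⁻¹ * iidE (sampleWeight d p) (fun ω : Fin K → HalfEdge d × Bool =>
        ∑ i, if Collides (seedSet y) ω i then (fun _ => (1 : ℝ)) (ω i).2 else 0) +
      ((ε * M)⁻¹ * iidE (sampleWeight d p) (fun ω : Fin K → HalfEdge d × Bool =>
        ∑ i, if Collides (seedSet y) ω i then (fun b => if b = true then (1 : ℝ) else 0) (ω i).2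
          else 0) +
      (∑ k ∈ grid, Δ * meanCovered d p k / (ε * L) ^ 2 +
      ((ε * L)⁻¹ * iidE (sampleWeight d p) (fun ω : Fin K → HalfEdge d × Bool =>
        (vol d (spoiled (seedSet y) ω) : ℝ)) +
      ((ε' * L)⁻¹ * iidE (sampleWeight d p) (fun ω : Fin K → HalfEdge d × Bool =>
        (vol d (seedVertices (seedSet y) (run (seedSet y) ω K).r) : ℝ)) +
      (if δ * L / 2 < |((seedSet y).card : ℝ) - totalDegree d * η| then 1 else 0)))))) := by
    intro y
    refine (iidP_mono hws fun ω h => not_typical h).trans ?_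
    refine (iidP_or_le hws _ _).trans (add_le_add ?_ ?_)
    · refine (iidP_exists_le hws _ _).trans ?_
      refine (Finset.sum_le_card_nsmul _ _ (K * p / (ε * M) ^ 2) fun k hk => ?_).trans ?_
      · have hkK : k ≤ K := by
          simp only [Finset.mem_insert, Finset.mem_singleton] at hk
          rcases hk with rfl | rfl | rfl <;> first | assumption | exact le_rfl
        refine (iidP_coins_le hp0 hp1 hkK hεM).trans ?_
        gcongr
      · rw [nsmul_eq_mul]
        have : (({k₁, k₂, K} : Finset ℕ).card : ℝ) ≤ 3 := by exact_mod_cast Finset.card_le_three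
        gcongr
    refine (iidP_or_le hws _ _).trans (add_le_add ?_ ?_)
    · rw [← div_eq_inv_mul]
      refine le_trans (le_of_eq ?_) (iidP_markov hws (fun ω => Finset.sum_nonneg fun i _ => by
        split_ifs <;> norm_num) hεL)
      congr 1; funext ω
      simp [collisions]
    refine (iidP_or_le hws _ _).trans (add_le_add ?_ ?_)
    · rw [← div_eq_inv_mul]
      refine le_trans (le_of_eq ?_) (iidP_markov hws (fun ω => Finset.sum_nonneg fun i _ => by
        split_ifs with h
        · simp only; split_ifs <;> norm_num
        · exact le_rfl) hεM)
      congr 1; funext ω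
      simp only [coinCollisions, ← ite_and]
      rw [Finset.sum_boole]
    refine (iidP_or_le hws _ _).trans (add_le_add ?_ ?_)
    · refine (iidP_exists_le hws _ _).trans (Finset.sum_le_sum fun k hk => ?_)
      exact iidP_covered_le hp0 hp1 (hgrid k hk) hεL hΔ
    refine (iidP_or_le hws _ _).trans (add_le_add ?_ ?_)
    · rw [← div_eq_inv_mul]
      exact iidP_markov hws (fun ω => Nat.cast_nonneg _) hεL
    refine (iidP_or_le hws _ _).trans (add_le_add ?_ ?_)
    · rw [← div_eq_inv_mul]
      exact iidP_markov hws (fun ω => Nat.cast_nonneg _) hεL'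
    · rw [hη]
      split_ifs with h
      · exact iidP_le_one hws _
      · simp [iidP, iidE, h]
  refine (iidE_mono hwc hy).trans ?_
  simp only [iidE_add, iidE_const hwc, iidE_const_mul]
  refine add_le_add le_rfl (add_le_add ?_ (add_le_add ?_ (add_le_add le_rfl (add_le_add ?_
    (add_le_add ?_ ?_)))))
  · have := iidE_collisions_le (d := d) (K := K) hp0 hp1 h0 h1 (fun _ => 1) (fun _ => zero_le_one)
    rw [← div_eq_inv_mul]
    refine div_le_div_of_nonneg_right (this.trans (le_of_eq ?_)) hεL.le
    ring
  · have := iidE_collisions_le (d := d) (K := K) hp0 hp1 h0 h1 (fun b => if b = true then 1 else 0)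
      (fun b => by split_ifs <;> norm_num)
    rw [← div_eq_inv_mul]
    refine div_le_div_of_nonneg_right (this.trans (le_of_eq ?_)) hεM.le
    simp only [if_true, Bool.false_eq_true, if_false]
    ring
  · rw [← div_eq_inv_mul]
    exact div_le_div_of_nonneg_right (iidE_spoiled_le hp0 hp1 h0 h1) hεL.le
  · rw [← div_eq_inv_mul]
    exact div_le_div_of_nonneg_right (iidE_seedVertices_le hd hp0 hp1 h0 h1) hεL'.le
  · have h3 := iidP_seeds_le (d := d) h0 h1 (c := δ * L / 2) (by positivity)
    have h4 : (totalDegree d : ℝ) * η / (δ * L / 2) ^ 2 = 4 / (δ * L) := by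
      rw [hη]; field_simp; norm_num
    rw [h4] at h3
    refine le_trans (le_of_eq ?_) h3
    unfold iidP
    congr!

end Success

end ConfigModel

end

noncomputable section

namespace ConfigModel

/-! ### The ranked components in the presence of a giant -/

section Ranking

variable {n : ℕ} {d : Fin n → ℕ}

theorem size_le (R : Set (Sym2 (HalfEdge d))) (C : Component R) :
    size R C ≤ edgeCount R C + 1 := by
  unfold size
  split_ifs
  · omega
  · exact ncard_supp_le R C

theorem HasGiant.ranked {lo hi x : ℝ} {R : Set (Sym2 (HalfEdge d))} (h : HasGiant lo hi x R)
    (hx0 : 0 ≤ x) (hx : x + 1 < lo) :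
    (lo ≤ rankedSize 1 R ∧ (rankedSize 1 R : ℝ) ≤ hi + 1) ∧
    (lo ≤ rankedEdges 1 R ∧ (rankedEdges 1 R : ℝ) ≤ hi) ∧
    ∀ i, 2 ≤ i → (rankedSize i R : ℝ) ≤ x + 1 ∧ (rankedEdges i R : ℝ) ≤ x := by
  classical
  obtain ⟨C, h1, h2, h3, h4⟩ := h
  have hsize : size R C = C.supp.ncard := by
    unfold size
    rw [if_neg]
    intro h0
    rw [h0] at h1
    push_cast at h1
    linarith
  have hsup : ((C.supp.ncard : ℕ) : ℝ) ≤ hi + 1 := by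
    have : (C.supp.ncard : ℝ) ≤ edgeCount R C + 1 := by exact_mod_cast ncard_supp_le R C
    linarith
  have hother : ∀ C', C' ≠ C → (size R C' : ℝ) ≤ x + 1 := by
    intro C' hC'
    have : (size R C' : ℝ) ≤ edgeCount R C' + 1 := by exact_mod_cast size_le R C'
    linarith [h4 C' hC']
  set key : Component R → ℕ ×ₗ ℕ := fun C => toLex (size R C, edgeCount R C) with hkey
  -- Every other component has size at most `x + 1 < lo`, so `C` is strictly first in the
  -- lexicographic order and heads the sorted list.
  have hprof : profile R = key C ::
      ((Finset.univ.erase C).val.map key).sort (· ≥ ·) := by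
    rw [← Multiset.sort_cons]
    · unfold profile
      congr 1
      rw [← Multiset.map_cons, ← Finset.insert_val_of_notMem (Finset.notMem_erase C _),
        Finset.insert_erase (Finset.mem_univ C)]
    · intro b hb
      obtain ⟨C', hC', rfl⟩ := Multiset.mem_map.1 hb
      have hne : C' ≠ C := (Finset.mem_erase.1 (Finset.mem_val ▸ hC')).1
      refine le_of_lt ?_
      rw [hkey, Prod.Lex.toLex_lt_toLex]
      left
      simp only
      have : (size R C' : ℝ) < size R C := by
        rw [hsize]; linarith [hother C' hne]
      exact_mod_cast this
  refine ⟨?_, ?_, ?_⟩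
  · have : rankedSize 1 R = C.supp.ncard := by
      unfold rankedSize
      rw [hprof, ← hsize]
      rfl
    rw [this]
    exact ⟨h3, hsup⟩
  · have : rankedEdges 1 R = edgeCount R C := by
      unfold rankedEdges
      rw [hprof]
      rfl
    rw [this]
    exact ⟨h1, h2⟩
  · intro i hi2
    -- The rank `i = j + 2` is list position `j + 1`, that is, position `j` of the tail, or the
    -- default pair of zeros beyond its end.
    obtain ⟨j, rfl⟩ : ∃ j, i = j + 2 := ⟨i - 2, by omega⟩
    set l := ((Finset.univ.erase C).val.map key).sort (· ≥ ·) with hl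
    have hget : (profile R).getD (j + 2 - 1) (toLex (0, 0)) = l.getD j (toLex (0, 0)) := by
      rw [hprof]
      exact List.getD_cons_succ
    have hval : l.getD j (toLex (0, 0)) = toLex (0, 0) ∨
        ∃ C', C' ≠ C ∧ l.getD j (toLex (0, 0)) = key C' := by
      by_cases hj : j < l.length
      · right
        have hmem : l.getD j (toLex (0, 0)) ∈ l := by
          rw [List.getD_eq_getElem _ _ hj]; exact List.getElem_mem hj
        have hmem' : l.getD j (toLex (0, 0)) ∈ (Finset.univ.erase C).val.map key := by
          rwa [hl, Multiset.mem_sort] at hmem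
        obtain ⟨C', hC', hk⟩ := Multiset.mem_map.1 hmem'
        exact ⟨C', (Finset.mem_erase.1 (Finset.mem_val ▸ hC')).1, hk.symm⟩
      · left
        exact List.getD_eq_default _ _ (by omega)
    unfold rankedSize rankedEdges
    rw [hget]
    rcases hval with h | ⟨C', hne, h⟩
    · rw [h]
      simp only [ofLex_toLex, Nat.cast_zero]
      exact ⟨by linarith, hx0⟩
    · rw [h]
      simp only [hkey, ofLex_toLex]
      exact ⟨hother C' hne, h4 C' hne⟩

end Ranking

end ConfigModel

end

noncomputable section

namespace ConfigModel

/-! ### Asymptotics of degree functionals -/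

section Functionals

variable {n : ℕ} (d : Fin n → ℕ)

/-- The sum `∑ d_v (1 - exp(-s d_v))`. -/
def laplaceVolume (s : ℝ) : ℝ := ∑ v, (d v : ℝ) * (1 - Real.exp (-(s * d v)))

variable {d}

theorem cast_totalDegree : (totalDegree d : ℝ) = ∑ v, (d v : ℝ) := by
  simp [totalDegree]

theorem one_sub_sizeBiasedLaplace (h : (totalDegree d : ℝ) ≠ 0) (s : ℝ) :
    1 - sizeBiasedLaplace d s = laplaceVolume d s / totalDegree d := by
  have h1 : (1 : ℝ) = ∑ v, (d v : ℝ) / totalDegree d := by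
    rw [← Finset.sum_div, ← cast_totalDegree, div_self h]
  unfold sizeBiasedLaplace laplaceVolume
  conv_lhs => rw [h1]
  rw [← Finset.sum_sub_distrib, Finset.sum_div]
  exact Finset.sum_congr rfl fun v _ => by ring

theorem laplaceVolume_mono {s s' : ℝ} (h : s ≤ s') : laplaceVolume d s ≤ laplaceVolume d s' := by
  refine Finset.sum_le_sum fun v _ => mul_le_mul_of_nonneg_left ?_ (Nat.cast_nonneg _)
  have : s * (d v : ℝ) ≤ s' * d v := mul_le_mul_of_nonneg_right h (Nat.cast_nonneg _)
  have := Real.exp_le_exp.2 (neg_le_neg this)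
  linarith

theorem div_one_add_le_one_sub_exp {z : ℝ} (hz : 0 ≤ z) : z / (1 + z) ≤ 1 - Real.exp (-z) := by
  have h1 : 1 + z ≤ Real.exp z := by linarith [Real.add_one_le_exp z]
  have h2 : Real.exp (-z) ≤ 1 / (1 + z) := by
    rw [Real.exp_neg, ← one_div]
    exact one_div_le_one_div_of_le (by linarith) h1
  have h3 : z / (1 + z) = 1 - 1 / (1 + z) := by field_simp; ring
  linarith

theorem min_one_le_two_mul {z : ℝ} (hz : 0 ≤ z) : min 1 z ≤ 2 * (1 - Real.exp (-z)) := by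
  have h := div_one_add_le_one_sub_exp hz
  rcases le_total z 1 with h1 | h1
  · rw [min_eq_right h1]
    have : z / 2 ≤ z / (1 + z) := by gcongr; linarith
    linarith
  · rw [min_eq_left h1]
    have : 1 / 2 ≤ z / (1 + z) := by
      rw [div_le_div_iff₀ (by norm_num) (by linarith)]; linarith
    linarith

theorem truncMoment_le_laplaceVolume {θ : ℝ} (h : 0 ≤ θ) :
    truncMoment d θ ≤ 2 * laplaceVolume d θ := by
  unfold truncMoment laplaceVolume
  rw [Finset.mul_sum]
  refine Finset.sum_le_sum fun v _ => ?_
  have := mul_le_mul_of_nonneg_left (min_one_le_two_mul (z := θ * d v) (by positivity))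
    (Nat.cast_nonneg (α := ℝ) (d v))
  linarith

/-- If `s d_v` is bounded by `B`, then `1 - exp(-s d_v)` is comparable to `s d_v`, so rescaling by
`t` costs at most a factor linear in `t`. This contradicts the limit `t^{τ-2}` for small `t`. -/
theorem laplaceVolume_mul_le {s t B : ℝ} (hs : 0 ≤ s) (ht : 0 ≤ t) (hB : ∀ v, s * d v ≤ B) :
    laplaceVolume d (t * s) ≤ (1 + B) * t * laplaceVolume d s := by
  unfold laplaceVolume
  rw [Finset.mul_sum]
  refine Finset.sum_le_sum fun v _ => ?_
  set z : ℝ := s * d v with hz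
  have hz0 : 0 ≤ z := by positivity
  have h1 := div_one_add_le_one_sub_exp hz0
  have h2 : z ≤ (1 + B) * (1 - Real.exp (-z)) := by
    have h3 : z ≤ (1 + z) * (1 - Real.exp (-z)) := by
      rw [div_le_iff₀ (by linarith)] at h1; linarith
    have h4 : 0 ≤ 1 - Real.exp (-z) := le_trans (by positivity) h1
    nlinarith [hB v]
  have h5 : 1 - Real.exp (-(t * s * d v)) ≤ t * z := by
    have := Real.add_one_le_exp (-(t * s * d v))
    have h6 : t * z = t * s * d v := by rw [hz]; ring
    linarith
  have h7 : 1 - Real.exp (-(t * s * d v)) ≤ (1 + B) * t * (1 - Real.exp (-z)) := by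
    have := mul_le_mul_of_nonneg_left h2 ht
    linarith
  have := mul_le_mul_of_nonneg_left h7 (Nat.cast_nonneg (α := ℝ) (d v))
  linarith

/-- From `1 - y ≤ exp(-y)`, applied to the probability `y` that one sample is retained at the given
vertex. -/
theorem laplaceVolume_le_meanCovered {p s : ℝ} {k : ℕ} (hp1 : p ≤ 1)
    (hs : s ≤ k * p / totalDegree d) : laplaceVolume d s ≤ meanCovered d p k := by
  refine (laplaceVolume_mono hs).trans (Finset.sum_le_sum fun v _ =>
    mul_le_mul_of_nonneg_left ?_ (Nat.cast_nonneg _))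
  have hle : (d v : ℝ) / totalDegree d ≤ 1 := by
    refine div_le_one_of_le₀ ?_ (Nat.cast_nonneg _)
    exact_mod_cast Finset.single_le_sum (fun _ _ => Nat.zero_le _) (Finset.mem_univ v)
  have h0 : 0 ≤ (d v : ℝ) / totalDegree d := by positivity
  have h1 : 0 ≤ 1 - p * d v / totalDegree d := by
    rw [mul_div_assoc]; nlinarith
  have h2 : (1 - p * d v / totalDegree d) ^ k ≤ Real.exp (-(p * d v / totalDegree d)) ^ k :=
    pow_le_pow_left₀ h1 (by linarith [Real.add_one_le_exp (-(p * d v / totalDegree d))]) k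
  rw [← Real.exp_nat_mul] at h2
  have h3 : (k : ℝ) * -(p * d v / totalDegree d) = -(k * p / totalDegree d * d v) := by ring
  rw [h3] at h2
  linarith

theorem meanCovered_nonneg {p : ℝ} (hp0 : 0 ≤ p) (hp1 : p ≤ 1) (k : ℕ) :
    0 ≤ meanCovered d p k := by
  refine le_trans (le_of_eq ?_) (laplaceVolume_le_meanCovered hp1 (by positivity : (0 : ℝ) ≤ _))
  simp [laplaceVolume]

/-- The converse comparison `exp(-y / (1 - a)) ≤ 1 - y` for `0 ≤ y ≤ a < 1`. The loss `1 - a` is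
harmless because the largest `p d_v / N` tends to zero. -/
theorem meanCovered_le_laplaceVolume {p s a : ℝ} {k : ℕ} (hp0 : 0 ≤ p) (ha1 : a < 1)
    (ha : ∀ v, p * d v / totalDegree d ≤ a) (hs : k * p / totalDegree d / (1 - a) ≤ s) :
    meanCovered d p k ≤ laplaceVolume d s := by
  refine le_trans (Finset.sum_le_sum fun v _ =>
    mul_le_mul_of_nonneg_left ?_ (Nat.cast_nonneg _)) (laplaceVolume_mono hs)
  set y : ℝ := p * d v / totalDegree d with hy
  have hy0 : 0 ≤ y := by positivity
  have hya : y ≤ a := ha v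
  have h1 : Real.exp (-(y / (1 - a))) ≤ 1 - y := by
    have h2 : 1 + y / (1 - a) ≤ Real.exp (y / (1 - a)) := by
      linarith [Real.add_one_le_exp (y / (1 - a))]
    have h3 : 1 ≤ (1 - y) * (1 + y / (1 - a)) := by
      have h4 : y ≤ y / (1 - a) * (1 - y) := by
        rw [div_mul_eq_mul_div, le_div_iff₀ (by linarith)]
        nlinarith
      nlinarith
    rw [Real.exp_neg, inv_le_iff_one_le_mul₀ (Real.exp_pos _)]
    refine h3.trans ?_
    exact mul_le_mul_of_nonneg_left h2 (by linarith)
  have h2 : Real.exp (-(y / (1 - a))) ^ k ≤ (1 - y) ^ k := pow_le_pow_left₀ (Real.exp_pos _).le h1 k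
  rw [← Real.exp_nat_mul] at h2
  have h3 : (k : ℝ) * -(y / (1 - a)) = -(k * p / totalDegree d / (1 - a) * d v) := by
    rw [hy]; ring
  rw [h3] at h2
  linarith

/-- Truncation at level `A`. -/
theorem truncMoment_le {θ A : ℝ} (hθ : 0 ≤ θ) (hA : 0 ≤ A) :
    truncMoment d θ ≤ θ * A * totalDegree d + meanDegreeAbove d A * n := by
  classical
  have hn : meanDegreeAbove d A * n = ∑ v with A < (d v : ℝ), (d v : ℝ) := by
    unfold meanDegreeAbove
    rcases Nat.eq_zero_or_pos n with h | h
    · subst h; simp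
    · have : (n : ℝ) ≠ 0 := by exact_mod_cast h.ne'
      field_simp
  rw [hn, Finset.sum_filter, cast_totalDegree, Finset.mul_sum, ← Finset.sum_add_distrib]
  refine Finset.sum_le_sum fun v _ => ?_
  have h0 : (0 : ℝ) ≤ d v := Nat.cast_nonneg _
  split_ifs with h
  · have : (d v : ℝ) * min 1 (θ * d v) ≤ d v * 1 := mul_le_mul_of_nonneg_left (min_le_left _ _) h0
    have : 0 ≤ θ * A * d v := by positivity
    linarith
  · have h2 : (d v : ℝ) * min 1 (θ * d v) ≤ d v * (θ * d v) :=
      mul_le_mul_of_nonneg_left (min_le_right _ _) h0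
    have h3 : (d v : ℝ) * (θ * d v) ≤ d v * (θ * A) := by gcongr; exact not_lt.1 h
    linarith

end Functionals

end ConfigModel

end

noncomputable section

namespace ConfigModel

/-! ### The barely supercritical regime -/

/-- Degree sequences in the barely supercritical regime together with vanishing positive retention
probabilities. -/
structure BarelySupercritical (τ μ κ : ℝ) (d : ∀ n : ℕ, Fin n → ℕ) (p : ℕ → unitInterval) :
    Prop where
  two_lt : 2 < τ
  lt_three : τ < 3
  pos : ∀ n, 0 < p n
  small : Tendsto (fun n => (p n : ℝ)) atTop (𝓝 0)
  degrees : SupercriticalDegrees τ μ κ d p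

/-- The order `p_n^{1/(3-τ)}` of the proportion of edges in the giant component. -/
def giantScale (τ : ℝ) (p : ℕ → unitInterval) (n : ℕ) : ℝ := (p n : ℝ) ^ (1 / (3 - τ))

/-- The order `p_n^{(τ-2)/(3-τ)}` of the proportion of half-edges at the vertices of the giant
component. -/
def volumeScale (τ : ℝ) (p : ℕ → unitInterval) (n : ℕ) : ℝ := (p n : ℝ) ^ ((τ - 2) / (3 - τ))

namespace BarelySupercritical

variable {τ μ κ : ℝ} {d : ∀ n : ℕ, Fin n → ℕ} {p : ℕ → unitInterval}

theorem coe_pos (H : BarelySupercritical τ μ κ d p) (n : ℕ) : 0 < (p n : ℝ) := H.pos n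

theorem giantScale_pos (H : BarelySupercritical τ μ κ d p) (n : ℕ) : 0 < giantScale τ p n :=
  Real.rpow_pos_of_pos (H.coe_pos n) _

theorem volumeScale_pos (H : BarelySupercritical τ μ κ d p) (n : ℕ) : 0 < volumeScale τ p n :=
  Real.rpow_pos_of_pos (H.coe_pos n) _

/-- The two exponents differ by exactly one: of the order `N σ` of half-edges explored, a fraction
`p` is retained. -/
theorem volumeScale_mul (H : BarelySupercritical τ μ κ d p) (n : ℕ) :
    volumeScale τ p n * p n = giantScale τ p n := by
  have h3 : 3 - τ ≠ 0 := by linarith [H.lt_three]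
  have h : 1 / (3 - τ) = (τ - 2) / (3 - τ) + 1 := by field_simp; ring
  rw [volumeScale, giantScale, h, Real.rpow_add_one (H.coe_pos n).ne']

theorem volumeScale_eq (H : BarelySupercritical τ μ κ d p) (n : ℕ) :
    volumeScale τ p n = giantScale τ p n ^ (τ - 2) := by
  rw [volumeScale, giantScale, ← Real.rpow_mul (H.coe_pos n).le]
  congr 1; ring

theorem tendsto_volumeScale (H : BarelySupercritical τ μ κ d p) :
    Tendsto (volumeScale τ p) atTop (𝓝 0) := by
  have h : 0 < (τ - 2) / (3 - τ) := by
    have := H.lt_three; have := H.two_lt; exact div_pos (by linarith) (by linarith)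
  have := H.small.rpow_const (p := (τ - 2) / (3 - τ)) (Or.inr h.le)
  rwa [Real.zero_rpow h.ne'] at this

theorem tendsto_totalDegree_div (H : BarelySupercritical τ μ κ d p) :
    Tendsto (fun n => (totalDegree (d n) : ℝ) / n) atTop (𝓝 μ) := by
  have := H.degrees.mean
  simpa only [meanDegree, ← cast_totalDegree] using this

theorem tendsto_div_totalDegree (H : BarelySupercritical τ μ κ d p) :
    Tendsto (fun n : ℕ => (n : ℝ) / totalDegree (d n)) atTop (𝓝 μ⁻¹) := by
  have := H.tendsto_totalDegree_div.inv₀ H.degrees.mu_pos.ne'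
  simpa only [inv_div] using this

theorem eventually_totalDegree_pos (H : BarelySupercritical τ μ κ d p) :
    ∀ᶠ n in atTop, 0 < (totalDegree (d n) : ℝ) := by
  filter_upwards [H.tendsto_totalDegree_div.eventually (lt_mem_nhds H.degrees.mu_pos)] with n hn
  by_contra h
  have h0 : (totalDegree (d n) : ℝ) = 0 := le_antisymm (not_lt.1 h) (Nat.cast_nonneg _)
  rw [h0, zero_div] at hn
  exact lt_irrefl _ hn

theorem tendsto_laplaceVolume (H : BarelySupercritical τ μ κ d p) {t : ℝ} (ht : 0 < t) :
    Tendsto (fun n => laplaceVolume (d n) (t * giantScale τ p n) /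
      (totalDegree (d n) * volumeScale τ p n)) atTop (𝓝 (κ * t ^ (τ - 2))) := by
  refine ((H.degrees.laplace t ht).const_mul κ).congr' ?_
  filter_upwards [H.eventually_totalDegree_pos] with n hn
  have h1 := H.volumeScale_pos n
  have h2 := H.degrees.kappa_pos
  rw [one_sub_sizeBiasedLaplace hn.ne']
  change κ * (laplaceVolume (d n) (t * giantScale τ p n) / totalDegree (d n) /
    (κ * volumeScale τ p n)) = _
  field_simp

/-- The largest degree is not of the order `1 / giantScale`. -/
theorem eventually_exists_lt (H : BarelySupercritical τ μ κ d p) (B : ℝ) :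
    ∀ᶠ n in atTop, ∃ v, B < giantScale τ p n * d n v := by
  wlog hB : 0 < B generalizing B
  · filter_upwards [this 1 one_pos] with n ⟨v, hv⟩
    exact ⟨v, by linarith⟩
  have h3 := H.lt_three
  have h2 := H.two_lt
  have hκ := H.degrees.kappa_pos
  -- a small `t` with `(1 + B) t < t ^ (τ - 2)`
  set t : ℝ := (2 * (1 + B)) ^ (-(1 / (3 - τ))) with ht
  have ht0 : 0 < t := Real.rpow_pos_of_pos (by linarith) _
  have htt : t ^ (τ - 2) = t * (2 * (1 + B)) := by
    have : t ^ (τ - 3) = 2 * (1 + B) := by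
      rw [ht, ← Real.rpow_mul (by linarith)]
      have : -(1 / (3 - τ)) * (τ - 3) = 1 := by
        have : 3 - τ ≠ 0 := by linarith
        field_simp; ring
      rw [this, Real.rpow_one]
    rw [show τ - 2 = 1 + (τ - 3) by ring, Real.rpow_add ht0, Real.rpow_one, this]
  -- If all `s d_v` were at most `B`, `laplaceVolume_mul_le` would bound the functional at `t` by
  -- `(1 + B) t` times that at `1`; the strict inequality of the limits forbids this for large `n`.
  have h1 := (H.tendsto_laplaceVolume one_pos).const_mul ((1 + B) * t)
  have hlt : (1 + B) * t * (κ * 1 ^ (τ - 2)) < κ * t ^ (τ - 2) := by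
    rw [htt, Real.one_rpow]
    have : 0 < κ * t * (1 + B) := by positivity
    linarith
  filter_upwards [h1.eventually_lt (H.tendsto_laplaceVolume ht0) hlt,
    H.eventually_totalDegree_pos] with n hn hN
  by_contra hc
  push Not at hc
  have h4 := laplaceVolume_mul_le (d := d n) (H.giantScale_pos n).le ht0.le hc
  have hL : 0 < (totalDegree (d n) : ℝ) * volumeScale τ p n := mul_pos hN (H.volumeScale_pos n)
  rw [← mul_div_assoc, div_lt_div_iff_of_pos_right hL, one_mul] at hn
  linarith

theorem exists_forall_le (H : BarelySupercritical τ μ κ d p) :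
    ∃ C : ℝ, 0 < C ∧ ∀ n v, (d n v : ℝ) ≤ C * (n : ℝ) ^ (1 / (τ - 1)) := by
  obtain ⟨C, hC⟩ := H.degrees.maxDegree
  refine ⟨max C 1, by positivity, fun n v => ?_⟩
  have hn : 0 < n := v.pos
  have h1 : (d n v : ℝ) ≤ d n ⟨0, hn⟩ := by
    exact_mod_cast H.degrees.antitone n (Fin.mk_le_of_le_val (Nat.zero_le _))
  refine h1.trans ((hC n hn).trans ?_)
  gcongr
  exact le_max_left _ _

/-- All degrees are `O(n^{1/(τ-1)})`, yet the largest one times `s` exceeds every constant. -/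
theorem tendsto_rpow_mul_giantScale (H : BarelySupercritical τ μ κ d p) :
    Tendsto (fun n : ℕ => (n : ℝ) ^ (1 / (τ - 1)) * giantScale τ p n) atTop atTop := by
  obtain ⟨C, hC0, hC⟩ := H.exists_forall_le
  refine tendsto_atTop.2 fun b => ?_
  filter_upwards [H.eventually_exists_lt (C * b)] with n ⟨v, hv⟩
  have h1 := mul_le_mul_of_nonneg_left (hC n v) (H.giantScale_pos n).le
  have h2 : C * b < C * ((n : ℝ) ^ (1 / (τ - 1)) * giantScale τ p n) := by linarith
  exact (lt_of_mul_lt_mul_left h2 hC0.le).le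

/-- As `σ = s^{τ-2}`, the quantity `n s σ` equals `(n^{1/(τ-1)} s)^{τ-1}`. Up to constants the
product here is the number of seeds expected to touch a component of giant order. -/
theorem tendsto_totalDegree_mul_scales (H : BarelySupercritical τ μ κ d p) :
    Tendsto (fun n => (totalDegree (d n) : ℝ) * giantScale τ p n * volumeScale τ p n)
      atTop atTop := by
  have h2 := H.two_lt
  have h1 := (tendsto_rpow_atTop (y := τ - 1) (by linarith)).comp H.tendsto_rpow_mul_giantScale
  refine (H.tendsto_totalDegree_div.pos_mul_atTop H.degrees.mu_pos h1).congr' ?_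
  filter_upwards [eventually_gt_atTop 0] with n hn
  have hn' : (0 : ℝ) < n := by exact_mod_cast hn
  have hs := H.giantScale_pos n
  simp only [Function.comp]
  rw [Real.mul_rpow (by positivity) hs.le, ← Real.rpow_mul hn'.le, H.volumeScale_eq,
    one_div_mul_cancel (by linarith), Real.rpow_one, show τ - 1 = 1 + (τ - 2) by ring,
    Real.rpow_add hs, Real.rpow_one]
  field_simp

theorem eventually_volumeScale_le_one (H : BarelySupercritical τ μ κ d p) :
    ∀ᶠ n in atTop, volumeScale τ p n ≤ 1 :=
  (H.tendsto_volumeScale.eventually (gt_mem_nhds one_pos)).mono fun _ h => h.le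

theorem tendsto_totalDegree_mul_giantScale (H : BarelySupercritical τ μ κ d p) :
    Tendsto (fun n => (totalDegree (d n) : ℝ) * giantScale τ p n) atTop atTop := by
  refine tendsto_atTop_mono' _ ?_ H.tendsto_totalDegree_mul_scales
  filter_upwards [H.eventually_volumeScale_le_one] with n hn
  exact mul_le_of_le_one_right (mul_nonneg (Nat.cast_nonneg _) (H.giantScale_pos n).le) hn

theorem tendsto_totalDegree_mul_volumeScale (H : BarelySupercritical τ μ κ d p) :
    Tendsto (fun n => (totalDegree (d n) : ℝ) * volumeScale τ p n) atTop atTop := by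
  refine tendsto_atTop_mono (fun n => ?_) H.tendsto_totalDegree_mul_giantScale
  rw [← H.volumeScale_mul n]
  exact mul_le_mul_of_nonneg_left (mul_le_of_le_one_right (H.volumeScale_pos n).le (p n).2.2)
    (Nat.cast_nonneg _)

/-- Here `n^{1/(τ-1)} / (n σ) = (n^{1/(τ-1)} s)^{-(τ-2)}`. This makes the largest degree negligible
against the covered volume, as the second-moment bound requires. -/
theorem tendsto_rpow_div (H : BarelySupercritical τ μ κ d p) (C : ℝ) :
    Tendsto (fun n : ℕ => C * (n : ℝ) ^ (1 / (τ - 1)) / (totalDegree (d n) * volumeScale τ p n))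
      atTop (𝓝 0) := by
  have h2 := H.two_lt
  have h1 := (tendsto_rpow_neg_atTop (y := τ - 2) (by linarith)).comp H.tendsto_rpow_mul_giantScale
  have h3 := (H.tendsto_div_totalDegree.const_mul C).mul h1
  rw [mul_zero] at h3
  refine h3.congr' ?_
  filter_upwards [eventually_gt_atTop 0, H.eventually_totalDegree_pos] with n hn hN
  have hn' : (0 : ℝ) < n := by exact_mod_cast hn
  have hs := H.giantScale_pos n
  have hσ := H.volumeScale_pos n
  have ha : (0 : ℝ) < (n : ℝ) ^ (1 / (τ - 1)) := Real.rpow_pos_of_pos hn' _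
  have hn1 : (n : ℝ) = (n : ℝ) ^ (1 / (τ - 1)) * ((n : ℝ) ^ (1 / (τ - 1))) ^ (τ - 2) := by
    rw [← Real.rpow_mul hn'.le, ← Real.rpow_add hn']
    have : 1 / (τ - 1) + 1 / (τ - 1) * (τ - 2) = 1 := by
      have : τ - 1 ≠ 0 := by linarith
      field_simp; ring
    rw [this, Real.rpow_one]
  simp only [Function.comp]
  rw [Real.rpow_neg (by positivity), Real.mul_rpow ha.le hs.le, ← H.volumeScale_eq]
  have hb : 0 < ((n : ℝ) ^ (1 / (τ - 1))) ^ (τ - 2) := Real.rpow_pos_of_pos ha _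
  field_simp
  rw [mul_assoc, ← hn1]

/-- The largest single-step jump `p d_v / ℓ_n` vanishes uniformly. -/
theorem eventually_mul_div_le (H : BarelySupercritical τ μ κ d p) {a : ℝ} (ha : 0 < a) :
    ∀ᶠ n in atTop, ∀ v, (p n : ℝ) * d n v / totalDegree (d n) ≤ a := by
  obtain ⟨C, hC0, hC⟩ := H.exists_forall_le
  filter_upwards [(H.tendsto_rpow_div C).eventually (gt_mem_nhds ha),
    H.eventually_volumeScale_le_one, H.eventually_totalDegree_pos] with n hn hσ hN v
  refine le_trans ?_ hn.le
  have h0 := H.volumeScale_pos n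
  have h1 : (p n : ℝ) * d n v ≤ C * (n : ℝ) ^ (1 / (τ - 1)) :=
    (mul_le_of_le_one_left (Nat.cast_nonneg _) (p n).2.2).trans (hC n v)
  exact div_le_div₀ (by positivity) h1 (by positivity) (mul_le_of_le_one_right hN.le hσ)

theorem eventually_truncMoment_le (H : BarelySupercritical τ μ κ d p) {c r : ℝ} (hc : 0 < c)
    (hr : 2 * (κ * c ^ (τ - 2)) < r) :
    ∀ᶠ n in atTop, truncMoment (d n) (c * giantScale τ p n) ≤
      r * (totalDegree (d n) * volumeScale τ p n) := by
  filter_upwards [((H.tendsto_laplaceVolume hc).const_mul 2).eventually (gt_mem_nhds hr),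
    H.eventually_totalDegree_pos] with n hn hN
  have hL : 0 < (totalDegree (d n) : ℝ) * volumeScale τ p n := mul_pos hN (H.volumeScale_pos n)
  rw [← mul_div_assoc, div_lt_iff₀ hL] at hn
  exact (truncMoment_le_laplaceVolume (mul_pos hc (H.giantScale_pos n)).le).trans hn.le

/-- Degrees below a fixed level `A` contribute at most `c σ A N`, which is `o(N)`; those above
contribute at most `n E[D_n 1{D_n > A}]`, small by uniform integrability. This controls collisions.
-/
theorem tendsto_truncMoment_volumeScale (H : BarelySupercritical τ μ κ d p) {c : ℝ} (hc : 0 ≤ c) :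
    Tendsto (fun n => truncMoment (d n) (c * volumeScale τ p n) / totalDegree (d n))
      atTop (𝓝 0) := by
  have hμ := H.degrees.mu_pos
  rw [Metric.tendsto_atTop']
  have key : ∀ ε : ℝ, 0 < ε → ∀ᶠ n in atTop,
      truncMoment (d n) (c * volumeScale τ p n) / totalDegree (d n) < ε := by
    intro ε hε
    obtain ⟨A, hA⟩ := H.degrees.unifIntegrable (ε * μ / 4) (by positivity)
    have h1 : Tendsto (fun n => c * volumeScale τ p n * max A 0) atTop (𝓝 0) := by
      simpa using (H.tendsto_volumeScale.const_mul c).mul_const (max A 0)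
    have h2 : ∀ᶠ n : ℕ in atTop, (n : ℝ) / totalDegree (d n) < 2 * μ⁻¹ :=
      H.tendsto_div_totalDegree.eventually (gt_mem_nhds (by linarith [inv_pos.2 hμ]))
    filter_upwards [h1.eventually (gt_mem_nhds (half_pos hε)), h2,
      H.eventually_totalDegree_pos] with n h1 h2 hN
    have h3 := truncMoment_le (d := d n) (θ := c * volumeScale τ p n) (A := max A 0)
      (mul_nonneg hc (H.volumeScale_pos n).le) (le_max_right _ _)
    have h4 : meanDegreeAbove (d n) (max A 0) ≤ ε * μ / 4 := by
      refine le_trans ?_ (hA n)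
      unfold meanDegreeAbove
      gcongr
      exact le_max_left A 0
    have h5 : truncMoment (d n) (c * volumeScale τ p n) / totalDegree (d n) ≤
        c * volumeScale τ p n * max A 0 + ε * μ / 4 * (n / totalDegree (d n)) := by
      rw [div_le_iff₀ hN, add_mul]
      have h6 : ε * μ / 4 * ((n : ℝ) / totalDegree (d n)) * totalDegree (d n) =
          ε * μ / 4 * n := by field_simp
      rw [h6]
      have := mul_le_mul_of_nonneg_right h4 (Nat.cast_nonneg (α := ℝ) n)
      linarith
    have h7 : ε * μ / 4 * ((n : ℝ) / totalDegree (d n)) < ε * μ / 4 * (2 * μ⁻¹) := by gcongr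
    have h8 : ε * μ / 4 * (2 * μ⁻¹) = ε / 2 := by field_simp; norm_num
    linarith
  intro ε hε
  obtain ⟨n₀, hn₀⟩ := eventually_atTop.1 (key ε hε)
  refine ⟨n₀, fun n hn => ?_⟩
  rw [Real.dist_eq, sub_zero, abs_of_nonneg]
  · exact hn₀ n hn.le
  · exact div_nonneg (truncMoment_nonneg (mul_nonneg hc (H.volumeScale_pos n).le))
      (Nat.cast_nonneg _)

/-- The mean is squeezed between Laplace functionals at parameters `u` slightly below and slightly
above `t`, and the limit is continuous in the parameter. -/
theorem tendsto_meanCovered (H : BarelySupercritical τ μ κ d p) {t : ℝ} (ht : 0 < t) :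
    Tendsto (fun n => meanCovered (d n) (p n)
      ⌊t * (totalDegree (d n) * volumeScale τ p n)⌋₊ / (totalDegree (d n) * volumeScale τ p n))
      atTop (𝓝 (κ * t ^ (τ - 2))) := by
  have hcont : ContinuousAt (fun u : ℝ => κ * u ^ (τ - 2)) t :=
    (Real.continuousAt_rpow_const _ _ (Or.inl ht.ne')).const_mul κ
  have hle : ∀ᶠ n in atTop, 0 < (totalDegree (d n) : ℝ) * volumeScale τ p n := by
    filter_upwards [H.eventually_totalDegree_pos] with n hN using mul_pos hN (H.volumeScale_pos n)
  rw [tendsto_order]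
  constructor
  · intro b hb
    -- The gap `t - u` absorbs the rounding of `t L`, once `(t - u) L ≥ 1`.
    obtain ⟨u, hu1, hu2⟩ : ∃ u ∈ Set.Ioo 0 t, b < κ * u ^ (τ - 2) :=
      ((((hcont.eventually (lt_mem_nhds hb)).filter_mono nhdsWithin_le_nhds).and
        (Ioo_mem_nhdsLT ht)).exists).imp fun u h => ⟨h.2, h.1⟩
    filter_upwards [(H.tendsto_laplaceVolume hu1.1).eventually (lt_mem_nhds hu2), hle,
      H.eventually_totalDegree_pos,
      H.tendsto_totalDegree_mul_volumeScale.eventually_ge_atTop (1 / (t - u))] with n h1 hL hN h2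
    refine h1.trans_le (div_le_div_of_nonneg_right ?_ hL.le)
    refine laplaceVolume_le_meanCovered (p n).2.2 ?_
    have h3 := Nat.lt_floor_add_one (t * (totalDegree (d n) * volumeScale τ p n))
    have htu : 0 < t - u := by linarith [hu1.2]
    rw [div_le_iff₀ htu] at h2
    rw [le_div_iff₀ hN, ← H.volumeScale_mul]
    have h4 : u * (totalDegree (d n) * volumeScale τ p n) ≤
      ⌊t * (totalDegree (d n) * volumeScale τ p n)⌋₊ := by linarith
    have := mul_le_mul_of_nonneg_right h4 (H.coe_pos n).le
    linarith
  · intro b hb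
    obtain ⟨u, hu1, hu2⟩ : ∃ u, t < u ∧ κ * u ^ (τ - 2) < b :=
      ((((hcont.eventually (gt_mem_nhds hb)).filter_mono nhdsWithin_le_nhds).and
        (self_mem_nhdsWithin (s := Set.Ioi t))).exists).imp fun u h => ⟨h.2, h.1⟩
    have hu0 : 0 < u := ht.trans hu1
    -- The choice `a = 1 - t / u` makes `t / (1 - a)` equal to `u`.
    have ha1 : 1 - t / u < 1 := by linarith [div_pos ht hu0]
    have ha0 : 0 < 1 - t / u := by linarith [(div_lt_one hu0).2 hu1]
    filter_upwards [(H.tendsto_laplaceVolume hu0).eventually (gt_mem_nhds hu2), hle,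
      H.eventually_totalDegree_pos, H.eventually_mul_div_le ha0] with n h1 hL hN h2
    refine lt_of_le_of_lt (div_le_div_of_nonneg_right ?_ hL.le) h1
    refine meanCovered_le_laplaceVolume (H.coe_pos n).le ha1 h2 ?_
    have h3 := Nat.floor_le (mul_pos ht hL).le
    rw [sub_sub_cancel, div_div, div_le_iff₀ (by positivity), ← H.volumeScale_mul]
    have := mul_le_mul_of_nonneg_right h3 (H.coe_pos n).le
    refine this.trans (le_of_eq ?_)
    field_simp

end BarelySupercritical

end ConfigModel

end

noncomputable section

namespace ConfigModel

/-! ### Choice of the parameters of the exploration -/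

/-- Parameters of the exploration, in units of the scales of the model, where `m` is the limiting
size of the giant component, `e` the accuracy and `r` the tolerance for the volume of the seeds. -/
structure Parameters (τ κ m e r t₁ t₂ T δ ε ε' : ℝ) (G : Finset ℝ) : Prop where
  t₁_pos : 0 < t₁
  t₁_lt : t₁ < t₂
  t₂_lt : t₂ < T
  δ_pos : 0 < δ
  ε_pos : 0 < ε
  ε'_pos : 0 < ε'
  seeds : 4 * t₁ < δ
  lo : m - e + t₁ + 4 * ε ≤ t₂
  hi : T + ε ≤ m + e
  x : T + t₁ + 5 * ε ≤ e + t₂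
  finish : κ * T ^ (τ - 2) + 2 * δ + 4 * ε + ε' < T
  seedVolume : 2 * (κ * δ ^ (τ - 2)) < r * ε'
  grid_pos : ∀ g ∈ G, 0 < g
  grid_le : ∀ g ∈ G, g ≤ T
  mem_grid : T ∈ G
  window : ∀ u, t₁ ≤ u → u ≤ t₂ → ∃ g ∈ G, g ≤ u ∧ u + 6 * ε < κ * g ^ (τ - 2)

section Exists

variable {τ κ : ℝ}

/-- Dividing by `u^{τ-2}`, the claim is `u^{3-τ} < m^{3-τ}`. The point `m` is where the volume found
and the volume explored balance. -/
theorem lt_mul_rpow (h3 : τ < 3) {m u : ℝ} (hm : m ^ (3 - τ) = κ) (hu : 0 < u) (hum : u < m) :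
    u < κ * u ^ (τ - 2) := by
  have h1 : u ^ (3 - τ) < κ := hm ▸ Real.rpow_lt_rpow hu.le hum (by linarith)
  calc u = u ^ (3 - τ) * u ^ (τ - 2) := by
        rw [← Real.rpow_add hu, show 3 - τ + (τ - 2) = 1 by ring, Real.rpow_one]
    _ < κ * u ^ (τ - 2) := mul_lt_mul_of_pos_right h1 (Real.rpow_pos_of_pos hu _)

theorem mul_rpow_lt (h3 : τ < 3) {m u : ℝ} (hm0 : 0 < m) (hm : m ^ (3 - τ) = κ) (hum : m < u) :
    κ * u ^ (τ - 2) < u := by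
  have hu : 0 < u := hm0.trans hum
  have h1 : κ < u ^ (3 - τ) := hm ▸ Real.rpow_lt_rpow hm0.le hum (by linarith)
  calc κ * u ^ (τ - 2) < u ^ (3 - τ) * u ^ (τ - 2) :=
        mul_lt_mul_of_pos_right h1 (Real.rpow_pos_of_pos hu _)
    _ = u := by rw [← Real.rpow_add hu, show 3 - τ + (τ - 2) = 1 by ring, Real.rpow_one]

/-- Concentration of the covered volume is available at finitely many times only. Covered volume
grows with time, so it is enough to compare each `u` with a slightly earlier grid point, at the
price of a smaller margin `c`. -/
theorem exists_window (h3 : τ < 3) {m t₁ t₂ : ℝ} (hm : m ^ (3 - τ) = κ) (ht₁ : 0 < t₁)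
    (ht : t₁ < t₂) (ht₂ : t₂ < m) :
    ∃ c : ℝ, 0 < c ∧ ∃ G : Finset ℝ, (∀ g ∈ G, 0 < g ∧ g ≤ t₂) ∧
      ∀ u, t₁ ≤ u → u ≤ t₂ → ∃ g ∈ G, g ≤ u ∧ u + c < κ * g ^ (τ - 2) := by
  classical
  have hcont : ContinuousOn (fun u : ℝ => κ * u ^ (τ - 2) - u) (Set.Icc t₁ t₂) := fun u hu =>
    (((Real.continuousAt_rpow_const u _ (Or.inl (ht₁.trans_le hu.1).ne')).const_mul κ).sub
      continuousAt_id).continuousWithinAt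
  obtain ⟨u₀, hu₀, hmin⟩ := isCompact_Icc.exists_isMinOn ⟨t₁, le_rfl, ht.le⟩ hcont
  set c := κ * u₀ ^ (τ - 2) - u₀ with hc
  have hc0 : 0 < c := by
    have := lt_mul_rpow h3 hm (ht₁.trans_le hu₀.1) (hu₀.2.trans_lt ht₂)
    linarith
  -- By continuity half of the minimal margin survives at some `g < u`. A neighbourhood of `u` to
  -- the right of `g` and of width `c / 4` on the right then loses at most another quarter, and
  -- finitely many of these cover the interval.
  have hex : ∀ u ∈ Set.Icc t₁ t₂, ∃ g, 0 < g ∧ g < u ∧ u + c / 2 < κ * g ^ (τ - 2) := by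
    intro u hu
    have hu0 : 0 < u := ht₁.trans_le hu.1
    have h1 : u + c / 2 < κ * u ^ (τ - 2) := by
      have : c ≤ κ * u ^ (τ - 2) - u := hmin hu
      linarith
    have h2 : ContinuousAt (fun u : ℝ => κ * u ^ (τ - 2)) u :=
      (Real.continuousAt_rpow_const _ _ (Or.inl hu0.ne')).const_mul κ
    exact ((((h2.eventually (lt_mem_nhds h1)).filter_mono nhdsWithin_le_nhds).and
      (Ioo_mem_nhdsLT hu0)).exists).imp fun g h => ⟨h.2.1, h.2.2, h.1⟩
  choose! f hf0 hf1 hf2 using hex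
  obtain ⟨S, hS, hcov⟩ := isCompact_Icc.elim_nhds_subcover (fun u => Set.Ioo (f u) (u + c / 4))
    fun u hu => Ioo_mem_nhds (hf1 u hu) (by linarith)
  refine ⟨c / 4, by linarith, S.image f, fun g hg => ?_, fun u h1 h2 => ?_⟩
  · obtain ⟨u, hu, rfl⟩ := Finset.mem_image.1 hg
    exact ⟨hf0 u (hS u hu), (hf1 u (hS u hu)).le.trans (hS u hu).2⟩
  · obtain ⟨v, hv, huv⟩ := Set.mem_iUnion₂.1 (hcov ⟨h1, h2⟩)
    refine ⟨f v, Finset.mem_image_of_mem f hv, huv.1.le, ?_⟩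
    have := hf2 v (hS v hv)
    linarith [huv.2]

/-- The window ends at `m - e/4` and the exploration at `T = m + e/4`, where the deficit `c₁ = T - κ
T^{τ-2}` is positive. The seed density `δ` is fixed next, small against `c₁` and against the
tolerance `r`; the window then starts at `δ/8`, and `ε` is chosen last, below the margins of window
and finish. -/
theorem exists_parameters (h2 : 2 < τ) (h3 : τ < 3) {m e r : ℝ} (hm0 : 0 < m)
    (hm : m ^ (3 - τ) = κ) (he : 0 < e) (hem : e < m) (hr : 0 < r) :
    ∃ t₁ t₂ T δ ε ε' : ℝ, ∃ G : Finset ℝ, Parameters τ κ m e r t₁ t₂ T δ ε ε' G := by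
  classical
  set T := m + e / 4 with hT
  set c₁ := T - κ * T ^ (τ - 2) with hc₁
  have hc₁0 : 0 < c₁ := sub_pos.2 (mul_rpow_lt h3 hm0 hm (by linarith))
  obtain ⟨δ, hδ0, hδ1, hδ2, hδ3⟩ : ∃ δ : ℝ, 0 < δ ∧ δ < e ∧ δ < c₁ / 8 ∧
      2 * (κ * δ ^ (τ - 2)) < r * (c₁ / 4) := by
    have h1 : ContinuousAt (fun u : ℝ => 2 * (κ * u ^ (τ - 2))) 0 :=
      ((Real.continuousAt_rpow_const 0 _ (Or.inr (by linarith))).const_mul κ).const_mul 2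
    have h4 : (fun u : ℝ => 2 * (κ * u ^ (τ - 2))) 0 < r * (c₁ / 4) := by
      simp only [Real.zero_rpow (by linarith : τ - 2 ≠ 0), mul_zero]
      positivity
    obtain ⟨δ, h5, h6⟩ := (((h1.eventually (gt_mem_nhds h4)).filter_mono
      nhdsWithin_le_nhds).and (Ioo_mem_nhdsGT (lt_min he (by linarith : 0 < c₁ / 8)))).exists
    exact ⟨δ, h6.1, h6.2.trans_le (min_le_left _ _), h6.2.trans_le (min_le_right _ _), h5⟩
  obtain ⟨c, hc0, G, hG, hwin⟩ := exists_window (κ := κ) (m := m) (t₁ := δ / 8) (t₂ := m - e / 4)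
    h3 hm (by linarith) (by linarith) (by linarith)
  obtain ⟨ε, hε0, hε1, hε2, hε3⟩ : ∃ ε : ℝ, 0 < ε ∧ ε ≤ c / 6 ∧ ε ≤ c₁ / 32 ∧ ε ≤ e / 32 :=
    ⟨min (c / 6) (min (c₁ / 32) (e / 32)), by positivity, min_le_left _ _,
      (min_le_right _ _).trans (min_le_left _ _), (min_le_right _ _).trans (min_le_right _ _)⟩
  refine ⟨δ / 8, m - e / 4, T, δ, ε, c₁ / 4, insert T G, ?_⟩
  refine ⟨by linarith, by linarith, by linarith, hδ0, hε0, by linarith, by linarith, by linarith,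
    by linarith, by linarith, by linarith, hδ3, fun g hg => ?_, fun g hg => ?_,
    Finset.mem_insert_self _ _, fun u h4 h5 => ?_⟩
  · rcases Finset.mem_insert.1 hg with rfl | hg
    · linarith
    · exact (hG g hg).1
  · rcases Finset.mem_insert.1 hg with rfl | hg
    · exact le_rfl
    · exact (hG g hg).2.trans (by linarith)
  · obtain ⟨g, hg, h6, h7⟩ := hwin u h4 h5
    exact ⟨g, Finset.mem_insert_of_mem hg, h6, by linarith⟩

end Exists

end ConfigModel

end

noncomputable section

namespace ConfigModel

/-! ### The giant component -/

namespace BarelySupercritical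

variable {τ μ κ : ℝ} {d : ∀ n : ℕ, Fin n → ℕ} {p : ℕ → unitInterval}
  {m e r t₁ t₂ T δ ε ε' : ℝ} {G : Finset ℝ}

/-- The inequalities in `Parameters` carry spare multiples of `ε`: they pay for rounding, for the
deviation of `meanCovered` from its limit, and for terms of order `M`, which is `o(L)` because `M =
L p`. -/
theorem eventually_admissible (H : BarelySupercritical τ μ κ d p)
    (P : Parameters τ κ m e r t₁ t₂ T δ ε ε' G) :
    ∀ᶠ n in atTop, ∀ L M : ℝ, L = totalDegree (d n) * volumeScale τ p n →
      M = totalDegree (d n) * giantScale τ p n →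
      Admissible (d n) ⌊T * L⌋₊ (p n) L M δ ε ε' ⌊t₁ * L⌋₊ ⌊t₂ * L⌋₊
        (G.image fun g => ⌊g * L⌋₊) ((m - e) * M) ((m + e) * M) (e * M) := by
  have hε := P.ε_pos
  have hT0 : 0 < T := P.grid_pos T P.mem_grid
  have hcov : ∀ᶠ n in atTop, ∀ g ∈ G,
      |meanCovered (d n) (p n) ⌊g * (totalDegree (d n) * volumeScale τ p n)⌋₊ /
        (totalDegree (d n) * volumeScale τ p n) - κ * g ^ (τ - 2)| < ε := by
    refine (Filter.eventually_all_finset G).2 fun g hg => ?_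
    have := Metric.tendsto_nhds.1 (H.tendsto_meanCovered (P.grid_pos g hg)) ε hε
    simpa only [Real.dist_eq] using this
  have hTp : ∀ᶠ n in atTop, T * (p n : ℝ) < ε := by
    have := H.small.const_mul T
    rw [mul_zero] at this
    exact this.eventually (gt_mem_nhds hε)
  filter_upwards [hcov, hTp, H.tendsto_totalDegree_mul_volumeScale.eventually_ge_atTop (1 / ε),
    H.tendsto_totalDegree_mul_giantScale.eventually_ge_atTop (1 / ε)] with n hcov hTp hL hM L M eL eM
  have hMp : M = L * p n := by rw [eL, eM, ← H.volumeScale_mul, mul_assoc]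
  rw [← eL] at hL hcov
  rw [← eM] at hM
  rw [div_le_iff₀ hε] at hL hM
  have hL0 : 0 < L := by by_contra h; nlinarith
  have hM0 : 0 < M := by by_contra h; nlinarith
  have hp0 := H.coe_pos n
  have hp1 : (p n : ℝ) ≤ 1 := (p n).2.2
  have ht1 := P.t₁_pos
  have hf1 := Nat.floor_le (mul_pos ht1 hL0).le
  have hf2 := Nat.floor_le (mul_pos (ht1.trans P.t₁_lt) hL0).le
  have hfT := Nat.floor_le (mul_pos hT0 hL0).le
  have hg2 := Nat.lt_floor_add_one (t₂ * L)
  have hgT := Nat.lt_floor_add_one (T * L)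
  have h1p : (⌊t₁ * L⌋₊ : ℝ) * p n ≤ t₁ * M := by
    have := mul_le_mul_of_nonneg_right hf1 hp0.le
    rw [hMp]; linarith
  have h2p : t₂ * M - ε * M ≤ (⌊t₂ * L⌋₊ : ℝ) * p n := by
    have := mul_le_mul_of_nonneg_right hg2.le hp0.le
    have h : t₂ * L * p n = t₂ * M := by rw [hMp]; ring
    linarith
  have hTp' : (⌊T * L⌋₊ : ℝ) * p n ≤ T * M := by
    have := mul_le_mul_of_nonneg_right hfT hp0.le
    rw [hMp]; linarith
  have hML : M ≤ L := by rw [hMp]; exact mul_le_of_le_one_right hL0.le hp1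
  have hTM : T * M ≤ ε * L := by
    have := mul_le_mul_of_nonneg_right hTp.le hL0.le
    rw [hMp]; linarith
  refine ⟨?_, ?_, ?_, ?_, Finset.mem_image_of_mem _ P.mem_grid, ?_, ?_, ?_, ?_⟩
  · exact Nat.floor_mono (mul_le_mul_of_nonneg_right P.t₁_lt.le hL0.le)
  · exact Nat.floor_mono (mul_le_mul_of_nonneg_right P.t₂_lt.le hL0.le)
  · intro k hk1 hk2
    have hk2' : (k : ℝ) ≤ t₂ * L := le_trans (by exact_mod_cast hk2) hf2
    -- The maximum with `t₁` is needed because `k ≥ ⌊t₁ L⌋` only, so `k / L` may lie just below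
    -- `t₁`.
    obtain ⟨g, hg, hgu, hlt⟩ := P.window (max t₁ (k / L)) (le_max_left _ _)
      (max_le P.t₁_lt.le ((div_le_iff₀ hL0).2 hk2'))
    refine ⟨_, Finset.mem_image_of_mem _ hg, ?_, ?_⟩
    · rcases le_max_iff.1 hgu with h | h
      · exact (Nat.floor_mono (mul_le_mul_of_nonneg_right h hL0.le)).trans hk1
      · exact Nat.floor_le_of_le ((le_div_iff₀ hL0).1 h)
    · have h1 := (abs_lt.1 (hcov g hg)).1
      have h2 : (k : ℝ) / L + 5 * ε < meanCovered (d n) (p n) ⌊g * L⌋₊ / L := by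
        linarith [le_max_right t₁ ((k : ℝ) / L)]
      rw [lt_div_iff₀ hL0, add_mul, div_mul_cancel₀ _ hL0.ne'] at h2
      have h3 : ε * M ≤ ε * L := mul_le_mul_of_nonneg_left hML hε.le
      linarith
  · have := mul_lt_mul_of_pos_right P.seeds hL0
    linarith
  · have h1 := (abs_lt.1 (hcov T P.mem_grid)).2
    have h2 : meanCovered (d n) (p n) ⌊T * L⌋₊ / L < κ * T ^ (τ - 2) + ε := by linarith
    rw [div_lt_iff₀ hL0] at h2
    have h3 := mul_lt_mul_of_pos_right P.finish hL0
    have h4 := mul_pos P.δ_pos hL0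
    linarith
  · have := mul_le_mul_of_nonneg_right P.lo hM0.le
    linarith
  · have := mul_le_mul_of_nonneg_right P.hi hM0.le
    linarith
  · have := mul_le_mul_of_nonneg_right P.x hM0.le
    linarith

/-- The bound on the probability of untypical behaviour becomes small. -/
theorem eventually_error_le (H : BarelySupercritical τ μ κ d p)
    (P : Parameters τ κ m e r t₁ t₂ T δ ε ε' G) (he : 0 < e) (hr : 0 < r) {C : ℝ} (hC : 0 ≤ C) :
    ∀ᶠ n in atTop, ∀ N L M η Δ : ℝ, N = totalDegree (d n) → L = N * volumeScale τ p n →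
      M = N * giantScale τ p n → η = δ * volumeScale τ p n →
      Δ = C * (n : ℝ) ^ (1 / (τ - 1)) →
      3 * (⌊T * L⌋₊ * (p n : ℝ) / (ε * M) ^ 2) +
      (⌊T * L⌋₊ / N * truncMoment (d n) (⌊T * L⌋₊ / N + η) / (ε * L) +
      (⌊T * L⌋₊ * (p n : ℝ) / N * truncMoment (d n) (⌊T * L⌋₊ / N + η) / (ε * M) +
      (∑ k ∈ G.image fun g => ⌊g * L⌋₊, Δ * meanCovered (d n) (p n) k / (ε * L) ^ 2 +
      (truncMoment (d n) (⌊T * L⌋₊ * (p n : ℝ) / N * (⌊T * L⌋₊ / N + η)) / (ε * L) +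
      (truncMoment (d n) (p n * η) / (ε' * L) + 4 / (δ * L)))))) +
      2 * Real.exp (-(η * (e * M))) ≤ 3 * r := by
  have hε := P.ε_pos
  have hε' := P.ε'_pos
  have hδ := P.δ_pos
  have hT0 : 0 < T := P.grid_pos T P.mem_grid
  have hMt := H.tendsto_totalDegree_mul_giantScale
  have hLt := H.tendsto_totalDegree_mul_volumeScale
  -- the terms that vanish
  have hvan : Tendsto (fun n => 3 * (T / ε ^ 2 * (totalDegree (d n) * giantScale τ p n)⁻¹) +
      2 * (T / ε * (truncMoment (d n) ((T + δ) * volumeScale τ p n) / totalDegree (d n))) +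
      (∑ g ∈ G, (C * (n : ℝ) ^ (1 / (τ - 1)) / (totalDegree (d n) * volumeScale τ p n)) *
        (meanCovered (d n) (p n) ⌊g * (totalDegree (d n) * volumeScale τ p n)⌋₊ /
          (totalDegree (d n) * volumeScale τ p n)) / ε ^ 2) +
      4 / δ * (totalDegree (d n) * volumeScale τ p n)⁻¹ +
      2 * Real.exp (-(δ * e * (totalDegree (d n) * giantScale τ p n * volumeScale τ p n))))
      atTop (𝓝 0) := by
    have h1 := (hMt.inv_tendsto_atTop.const_mul (T / ε ^ 2)).const_mul 3
    have h2 := ((H.tendsto_truncMoment_volumeScale (c := T + δ) (by linarith)).const_mul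
      (T / ε)).const_mul 2
    have h3 := tendsto_finsetSum G fun g hg => ((H.tendsto_rpow_div C).mul
      (H.tendsto_meanCovered (P.grid_pos g hg))).div_const (ε ^ 2)
    have h4 := hLt.inv_tendsto_atTop.const_mul (4 / δ)
    have h5 := (Real.tendsto_exp_neg_atTop_nhds_zero.comp
      (H.tendsto_totalDegree_mul_scales.const_mul_atTop (mul_pos hδ he))).const_mul 2
    have := (((h1.add h2).add h3).add h4).add h5
    simpa using this
  -- The spoiled volume is a truncated moment at an argument of order `σ s`, which is eventually
  -- below `c s`; with this `c` its Markov bound is at most `r`. The seed volume gives a second `r`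
  -- through `seedVolume`, and the vanishing terms a third.
  obtain ⟨c, hc0, hc⟩ : ∃ c : ℝ, 0 < c ∧ 2 * (κ * c ^ (τ - 2)) < r * ε := by
    have h2 := H.two_lt
    have h1 : ContinuousAt (fun u : ℝ => 2 * (κ * u ^ (τ - 2))) 0 :=
      ((Real.continuousAt_rpow_const 0 _ (Or.inr (by linarith))).const_mul κ).const_mul 2
    have h4 : (fun u : ℝ => 2 * (κ * u ^ (τ - 2))) 0 < r * ε := by
      simp only [Real.zero_rpow (by linarith : τ - 2 ≠ 0), mul_zero]
      positivity
    obtain ⟨c, h5, h6⟩ := (((h1.eventually (gt_mem_nhds h4)).filter_mono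
      nhdsWithin_le_nhds).and (self_mem_nhdsWithin (s := Set.Ioi (0 : ℝ)))).exists
    exact ⟨c, h6, h5⟩
  have hσc : ∀ᶠ n in atTop, T * (T + δ) * volumeScale τ p n < c := by
    have := H.tendsto_volumeScale.const_mul (T * (T + δ))
    rw [mul_zero] at this
    exact this.eventually (gt_mem_nhds hc0)
  filter_upwards [hvan.eventually (gt_mem_nhds hr), hσc, H.eventually_truncMoment_le hc0 hc,
    H.eventually_truncMoment_le hδ P.seedVolume, H.eventually_totalDegree_pos]
    with n hvan hσc htr1 htr2 hN N L M η Δ eN eL eM eη eΔ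
  have hσ := H.volumeScale_pos n
  have hs := H.giantScale_pos n
  have hp0 := H.coe_pos n
  have hp1 : (p n : ℝ) ≤ 1 := (p n).2.2
  have hσp := H.volumeScale_mul n
  rw [← eN] at hN hvan htr1 htr2
  rw [← eΔ] at hvan
  set σ := volumeScale τ p n
  set s := giantScale τ p n
  have hL0 : 0 < L := eL ▸ mul_pos hN hσ
  have hM0 : 0 < M := eM ▸ mul_pos hN hs
  have hK : (⌊T * L⌋₊ : ℝ) ≤ T * L := Nat.floor_le (mul_pos hT0 hL0).le
  have hKN : (⌊T * L⌋₊ : ℝ) / N ≤ T * σ := by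
    rw [div_le_iff₀ hN]; rw [eL] at hK ⊢; linarith
  have hKp : (⌊T * L⌋₊ : ℝ) * p n ≤ T * M := by
    have := mul_le_mul_of_nonneg_right hK hp0.le
    rw [eM, ← hσp]; rw [eL] at this ⊢; linarith
  have hKpN : (⌊T * L⌋₊ : ℝ) * p n / N ≤ T * s := by
    rw [div_le_iff₀ hN]; rw [eM] at hKp; linarith
  have hη0 : 0 ≤ η := by rw [eη]; positivity
  have harg : (⌊T * L⌋₊ : ℝ) / N + η ≤ (T + δ) * σ := by rw [eη]; linarith
  have htrm := truncMoment_mono (d := d n) harg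
  have htr0 : 0 ≤ truncMoment (d n) ((⌊T * L⌋₊ : ℝ) / N + η) :=
    truncMoment_nonneg (by positivity)
  set tr := truncMoment (d n) ((T + δ) * σ)
  have htr0' : 0 ≤ tr := htr0.trans htrm
  have e1 : 3 * ((⌊T * L⌋₊ : ℝ) * p n / (ε * M) ^ 2) ≤ 3 * (T / ε ^ 2 * M⁻¹) := by
    refine mul_le_mul_of_nonneg_left ?_ (by norm_num)
    refine (div_le_div_of_nonneg_right hKp (by positivity)).trans (le_of_eq ?_)
    field_simp
  have e2 : (⌊T * L⌋₊ : ℝ) / N * truncMoment (d n) (⌊T * L⌋₊ / N + η) / (ε * L) ≤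
      T / ε * (tr / N) := by
    refine (div_le_div_of_nonneg_right (mul_le_mul hKN htrm htr0 (by positivity))
      (by positivity)).trans (le_of_eq ?_)
    rw [eL]; field_simp
  have e3 : (⌊T * L⌋₊ : ℝ) * p n / N * truncMoment (d n) (⌊T * L⌋₊ / N + η) / (ε * M) ≤
      T / ε * (tr / N) := by
    refine (div_le_div_of_nonneg_right (mul_le_mul hKpN htrm htr0 (by positivity))
      (by positivity)).trans (le_of_eq ?_)
    rw [eM]; field_simp
  have hΔ : 0 ≤ Δ := by rw [eΔ]; positivity
  have e4 : ∑ k ∈ G.image fun g => ⌊g * L⌋₊, Δ * meanCovered (d n) (p n) k / (ε * L) ^ 2 ≤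
      ∑ g ∈ G, (Δ / L) * (meanCovered (d n) (p n) ⌊g * L⌋₊ / L) / ε ^ 2 := by
    refine (Finset.sum_image_le_of_nonneg fun k _ => ?_).trans (le_of_eq ?_)
    · have := meanCovered_nonneg (d := d n) hp0.le hp1 k
      positivity
    · refine Finset.sum_congr rfl fun g _ => ?_
      field_simp
  have e5 : truncMoment (d n) ((⌊T * L⌋₊ : ℝ) * p n / N * (⌊T * L⌋₊ / N + η)) / (ε * L) ≤ r := by
    rw [div_le_iff₀ (by positivity)]
    refine (truncMoment_mono ?_).trans (htr1.trans (le_of_eq (by rw [eL]; ring)))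
    calc (⌊T * L⌋₊ : ℝ) * p n / N * (⌊T * L⌋₊ / N + η) ≤ T * s * ((T + δ) * σ) :=
          mul_le_mul hKpN harg (by positivity) (by positivity)
      _ = T * (T + δ) * σ * s := by ring
      _ ≤ c * s := mul_le_mul_of_nonneg_right hσc.le hs.le
  have e6 : truncMoment (d n) (p n * η) / (ε' * L) ≤ r := by
    rw [div_le_iff₀ (by positivity)]
    have : (p n : ℝ) * η = δ * s := by rw [eη, ← hσp]; ring
    rw [this]
    exact htr2.trans (le_of_eq (by rw [eL]; ring))
  have e7 : 4 / (δ * L) = 4 / δ * L⁻¹ := by field_simp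
  have e8 : η * (e * M) = δ * e * (M * σ) := by rw [eη]; ring
  rw [← eL, ← eM] at hvan
  rw [e7, e8]
  linarith

/-- There is a giant component with high probability. -/
theorem eventually_hasGiant (H : BarelySupercritical τ μ κ d p) (he : 0 < e)
    (hem : 2 * e < κ ^ (1 / (3 - τ))) {ρ : ℝ} (hρ : 0 < ρ) :
    ∀ᶠ n in atTop, (percolatedLaw (d n) (p n)).real {R | ¬ HasGiant
      ((κ ^ (1 / (3 - τ)) - e) * (totalDegree (d n) * giantScale τ p n))
      ((κ ^ (1 / (3 - τ)) + e) * (totalDegree (d n) * giantScale τ p n))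
      (e * (totalDegree (d n) * giantScale τ p n)) R} ≤ ρ := by
  have h3 := H.lt_three
  have hκ := H.degrees.kappa_pos
  set m := κ ^ (1 / (3 - τ)) with hm
  have hm0 : 0 < m := Real.rpow_pos_of_pos hκ _
  have hmκ : m ^ (3 - τ) = κ := by
    rw [hm, ← Real.rpow_mul hκ.le, one_div_mul_cancel (by linarith), Real.rpow_one]
  obtain ⟨t₁, t₂, T, δ, ε, ε', G, P⟩ := exists_parameters (r := ρ / 3) H.two_lt h3 hm0 hmκ he
    (by linarith) (by linarith)
  obtain ⟨C, hC0, hC⟩ := H.exists_forall_le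
  have hη1 : ∀ᶠ n in atTop, δ * volumeScale τ p n < 1 := by
    have := H.tendsto_volumeScale.const_mul δ
    rw [mul_zero] at this
    exact this.eventually (gt_mem_nhds one_pos)
  filter_upwards [H.eventually_admissible P, H.eventually_error_le P he (by linarith) hC0.le,
    H.eventually_totalDegree_pos, hη1] with n hA hE hN hη1
  have hσ := H.volumeScale_pos n
  have hs := H.giantScale_pos n
  have hne : Nonempty (HalfEdge (d n)) := by
    rw [← Fintype.card_pos_iff, card_halfEdge]
    exact_mod_cast hN
  have hev := H.degrees.even n
  have hA := hA _ _ rfl rfl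
  have hE := hE _ _ _ _ _ rfl rfl rfl rfl rfl
  set L := (totalDegree (d n) : ℝ) * volumeScale τ p n with hL
  set M := (totalDegree (d n) : ℝ) * giantScale τ p n with hM
  have hL0 : 0 < L := mul_pos hN hσ
  have hM0 : 0 < M := mul_pos hN hs
  have hp0 : (0 : ℝ) ≤ p n := (p n).2.1
  have hp1 : (p n : ℝ) ≤ 1 := (p n).2.2
  have hη0 : 0 ≤ δ * volumeScale τ p n := (mul_pos P.δ_pos hσ).le
  have hx : e * M < (m - e) * M := mul_lt_mul_of_pos_right (by linarith) hM0
  have h1 := percolatedLaw_not_hasGiant_le (d := d n) hev (p n) hη0 hη1.le ⌊T * L⌋₊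
    (hi := (m + e) * M) hx
  have h2 := iidE_not_typical_le (d := d n) (p := p n) (K := ⌊T * L⌋₊) (L := L) (M := M)
    (k₁ := ⌊t₁ * L⌋₊) (k₂ := ⌊t₂ * L⌋₊) (grid := G.image fun g => ⌊g * L⌋₊) hev hp0 hp1 hη0 hη1.le
    hL0 hM0 P.δ_pos P.ε_pos P.ε'_pos (by rw [hL]; ring) (hA.le₁₂.trans hA.le₂) hA.le₂
    (fun k hk => by
      obtain ⟨g, hg, rfl⟩ := Finset.mem_image.1 hk
      exact Nat.floor_mono (mul_le_mul_of_nonneg_right (P.grid_le g hg) hL0.le)) (hC n)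
  have h4 := iidE_mono (isWeight_coinWeight hη0 hη1.le)
    (fun y : HalfEdge (d n) → Bool => iidP_mono (isWeight_sampleWeight (d := d n) hp0 hp1)
      (fun (ω : Fin ⌊T * L⌋₊ → HalfEdge (d n) × Bool)
        (h : ¬ Succeeds ((m - e) * M) ((m + e) * M) (e * M) (seedSet y) ω) =>
        fun (hT : Typical (p n) L M δ ε ε' ⌊t₁ * L⌋₊ ⌊t₂ * L⌋₊ (G.image fun g => ⌊g * L⌋₊)
          (seedSet y) ω) => h (hT.succeeds hA)))
  have h5 := h4.trans h2
  linarith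

end BarelySupercritical

end ConfigModel

end

noncomputable section

namespace ConfigModel

/-! ### Convergence in probability -/

/-- The rescaled sizes and numbers of edges of the components are within `ε` of their limits. -/
def Close {n : ℕ} {d : Fin n → ℕ} (a c ε : ℝ) (R : Set (Sym2 (HalfEdge d))) : Prop :=
  |(rankedSize 1 R : ℝ) / a - c| < ε ∧ |(rankedEdges 1 R : ℝ) / a - c| < ε ∧
    ∀ i, 2 ≤ i → |(rankedSize i R : ℝ) / a - 0| < ε ∧ |(rankedEdges i R : ℝ) / a - 0| < ε

namespace BarelySupercritical

variable {τ μ κ : ℝ} {d : ∀ n : ℕ, Fin n → ℕ} {p : ℕ → unitInterval}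

/-- Division by `n s` turns `M` into `N / n`, which tends to `μ`. A component may have one more
vertex than edges; this extra `1` disappears because `N s → ∞`. -/
theorem eventually_close (H : BarelySupercritical τ μ κ d p) {ε ρ : ℝ} (hε : 0 < ε) (hρ : 0 < ρ) :
    ∀ᶠ n in atTop, (percolatedLaw (d n) (p n)).real
      {R | ¬ Close (n * giantScale τ p n) (μ * κ ^ (1 / (3 - τ))) ε R} ≤ ρ := by
  have hμ := H.degrees.mu_pos
  set m := κ ^ (1 / (3 - τ)) with hm
  have hm0 : 0 < m := Real.rpow_pos_of_pos H.degrees.kappa_pos _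
  -- The bound `m / 4` separates the giant from the other components; the bound on `e μ` keeps the
  -- error within `ε` after rescaling.
  obtain ⟨e, he0, hem, heμ⟩ : ∃ e : ℝ, 0 < e ∧ e ≤ m / 4 ∧ e * μ ≤ ε / 4 := by
    refine ⟨min (m / 4) (ε / 4 / μ), by positivity, min_le_left _ _, ?_⟩
    exact (mul_le_mul_of_nonneg_right (min_le_right _ _) hμ.le).trans
      (div_mul_cancel₀ _ hμ.ne').le
  have hw := H.tendsto_totalDegree_div
  have hMt := H.tendsto_totalDegree_mul_giantScale
  have hinv : Tendsto (fun n : ℕ => (totalDegree (d n) : ℝ) / n *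
      (totalDegree (d n) * giantScale τ p n)⁻¹) atTop (𝓝 0) := by
    simpa using hw.mul hMt.inv_tendsto_atTop
  have hlo : ∀ᶠ n : ℕ in atTop, μ * m - ε < (m - e) * ((totalDegree (d n) : ℝ) / n) :=
    (hw.const_mul (m - e)).eventually (lt_mem_nhds (by linarith))
  have hhi : ∀ᶠ n : ℕ in atTop, (m + e) * ((totalDegree (d n) : ℝ) / n) +
      (totalDegree (d n) : ℝ) / n * (totalDegree (d n) * giantScale τ p n)⁻¹ < μ * m + ε :=
    ((hw.const_mul (m + e)).add hinv).eventually (gt_mem_nhds (by linarith))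
  have hx : ∀ᶠ n : ℕ in atTop, e * ((totalDegree (d n) : ℝ) / n) +
      (totalDegree (d n) : ℝ) / n * (totalDegree (d n) * giantScale τ p n)⁻¹ < ε :=
    ((hw.const_mul e).add hinv).eventually (gt_mem_nhds (by linarith))
  filter_upwards [hlo, hhi, hx, H.eventually_hasGiant he0 (by linarith) hρ,
    H.eventually_totalDegree_pos, eventually_gt_atTop 0, hMt.eventually_gt_atTop (1 / e)]
    with n hlo hhi hx hG hN hn hM
  refine le_trans ?_ hG
  have := isProbabilityMeasure_percolatedLaw (d n) (H.degrees.even n) (p n)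
  refine measureReal_mono fun R hR hgiant => hR ?_
  have hn' : (0 : ℝ) < n := by exact_mod_cast hn
  have hs := H.giantScale_pos n
  set s := giantScale τ p n
  set N : ℝ := (totalDegree (d n) : ℝ)
  have hM0 : 0 < N * s := mul_pos hN hs
  have ha : 0 < n * s := mul_pos hn' hs
  have heM : 1 < e * (N * s) := by rwa [div_lt_iff₀' he0] at hM
  obtain ⟨⟨h1, h2⟩, ⟨h3, h4⟩, h5⟩ := hgiant.ranked (by positivity) (by nlinarith)
  have hloa : (μ * m - ε) * (n * s) < (m - e) * (N * s) := by
    have := mul_lt_mul_of_pos_right hlo ha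
    refine this.trans_le (le_of_eq ?_)
    field_simp
  have hhia : (m + e) * (N * s) + 1 < (μ * m + ε) * (n * s) := by
    have := mul_lt_mul_of_pos_right hhi ha
    refine lt_of_le_of_lt (le_of_eq ?_) this
    field_simp
  have hxa : e * (N * s) + 1 < ε * (n * s) := by
    have := mul_lt_mul_of_pos_right hx ha
    refine lt_of_le_of_lt (le_of_eq ?_) this
    field_simp
  have near : ∀ X : ℝ, (m - e) * (N * s) ≤ X → X ≤ (m + e) * (N * s) + 1 →
      |X / (n * s) - μ * m| < ε := by
    intro X hX1 hX2
    have i1 : μ * m - ε < X / (n * s) := (lt_div_iff₀ ha).2 (hloa.trans_le hX1)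
    have i2 : X / (n * s) < μ * m + ε := (div_lt_iff₀ ha).2 (hX2.trans_lt hhia)
    exact abs_lt.2 ⟨by linarith, by linarith⟩
  have near0 : ∀ X : ℝ, 0 ≤ X → X ≤ e * (N * s) + 1 → |X / (n * s) - 0| < ε := by
    intro X hX0 hX
    rw [sub_zero, abs_of_nonneg (div_nonneg hX0 ha.le), div_lt_iff₀ ha]
    exact hX.trans_lt hxa
  exact ⟨near _ h1 h2, near _ h3 (by linarith), fun i hi =>
    ⟨near0 _ (Nat.cast_nonneg _) (h5 i hi).1,
      near0 _ (Nat.cast_nonneg _) (by linarith [(h5 i hi).2])⟩⟩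

theorem tendstoInProb (H : BarelySupercritical τ μ κ d p)
    {X : ∀ n, Set (Sym2 (HalfEdge (d n))) → ℝ} {c : ℝ}
    (h : ∀ ε n R, Close (n * giantScale τ p n) (μ * κ ^ (1 / (3 - τ))) ε R → |X n R - c| < ε) :
    TendstoInProb (fun n => percolatedLaw (d n) (p n)) X c := by
  intro ε hε
  rw [ENNReal.tendsto_nhds_zero]
  intro ρ hρ
  rcases eq_or_ne ρ ⊤ with rfl | hρt
  · exact Eventually.of_forall fun _ => le_top
  filter_upwards [H.eventually_close hε (ENNReal.toReal_pos hρ.ne' hρt)] with n hn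
  have := isProbabilityMeasure_percolatedLaw (d n) (H.degrees.even n) (p n)
  rw [← ENNReal.toReal_le_toReal (measure_ne_top _ _) hρt]
  exact (measureReal_mono fun R hR hc => not_lt.2 hR (h ε n R hc)).trans hn

end BarelySupercritical

end ConfigModel

end

theorem theorem4 (τ : ℝ) (hτ : 2 < τ ∧ τ < 3) (μ κ lam : ℝ) (hlam : 0 < lam)
    (d : ∀ n : ℕ, Fin n → ℕ) (p : ℕ → unitInterval) (hp : ∀ n, 0 < p n)
    (pc : ℕ → ℝ)
    (hpc : Asymptotics.IsEquivalent atTop pc fun n => lam / ConfigModel.criticality (d n))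
    (hsuper : Tendsto (fun n => pc n / (p n : ℝ)) atTop (𝓝 0))
    (hsmall : Tendsto (fun n => (p n : ℝ)) atTop (𝓝 0))
    (hd : ConfigModel.SupercriticalDegrees τ μ κ d p) :
    ConfigModel.TendstoInProb (fun n => ConfigModel.percolatedLaw (d n) (p n))
        (fun n R => (ConfigModel.rankedSize 1 R : ℝ) / (n * (p n : ℝ) ^ (1 / (3 - τ))))
        (μ * κ ^ (1 / (3 - τ))) ∧
      ConfigModel.TendstoInProb (fun n => ConfigModel.percolatedLaw (d n) (p n))
        (fun n R => (ConfigModel.rankedEdges 1 R : ℝ) / (n * (p n : ℝ) ^ (1 / (3 - τ))))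
        (μ * κ ^ (1 / (3 - τ))) ∧
      ∀ i : ℕ, 2 ≤ i →
        ConfigModel.TendstoInProb (fun n => ConfigModel.percolatedLaw (d n) (p n))
            (fun n R => (ConfigModel.rankedSize i R : ℝ) / (n * (p n : ℝ) ^ (1 / (3 - τ)))) 0 ∧
          ConfigModel.TendstoInProb (fun n => ConfigModel.percolatedLaw (d n) (p n))
            (fun n R => (ConfigModel.rankedEdges i R : ℝ) / (n * (p n : ℝ) ^ (1 / (3 - τ)))) 0 := by
  have H : ConfigModel.BarelySupercritical τ μ κ d p := ⟨hτ.1, hτ.2, hp, hsmall, hd⟩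
  exact ⟨H.tendstoInProb fun _ _ _ h => h.1, H.tendstoInProb fun _ _ _ h => h.2.1, fun i hi =>
    ⟨H.tendstoInProb fun _ _ _ h => (h.2.2 i hi).1, H.tendstoInProb fun _ _ _ h => (h.2.2 i hi).2⟩⟩
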